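/- Let $k=\mathbb{F}_q$ be a finite field with $q$ elements and let $X$ be a Noetherian scheme, separated over $k$, which is $F$-finite: the $q$-power Frobenius $F\colon X\to X$ (the identity on the underlying space, $r\mapsto r^q$ on sections of $\mathcal{O}_X$) is a finite morphism. A *Cartier module* on $X$ is a quasi-coherent $\mathcal{O}_X$-module $M$ with an additive map of sheaves $C\colon M\to M$ satisfying $C(r^qm)=rC(m)$; it is coherent if $M$ is. Morphisms are the $\mathcal{O}_X$-linear maps commuting with $C$, and Cartier submodules are the $C$-stable quasi-coherent $\mathcal{O}_X$-submodules. $M$ is *nilpotent* if $C^e(M)=0$ for some $e\ge 0$. It is *minimal* if it has neither nonzero nilpotent Cartier submodules nor nonzero nilpotent Cartier quotients, and *simple* if it is nonzero and its only Cartier submodules are $0$ and $M$. For a coherent Cartier module $M$, the chain $M\supseteq C(M)\supseteq C^2(M)\supseteq\cdots$ becomes stationary, with stable value $\underline{M}$, and $M_{\min}$ denotes the quotient of $\underline{M}$ by its largest nilpotent Cartier submodule. Let $M$ be a coherent Cartier module on $X$. A *nil-decomposition series* of $M$ of length $n$ is a sequence $M=M_0\supseteq M_1\supseteq\cdots\supseteq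 M_n=0$ of Cartier submodules such that no quotient $M_i/M_{i+1}$ $(0\le i<n)$ is nilpotent. A series refines another if the latter is obtained from it by omitting terms; a series is *maximal* if it cannot be refined to a longer nil-decomposition series. The *quasi-length* of $M$ is the length of the shortest maximal nil-decomposition series of $M$. **Theorem 4.24.** (a) Every nil-decomposition series of $M$ can be refined to a maximal nil-decomposition series of $M$. (b) All maximal nil-decomposition series of $M$ have the same length, namely the quasi-length of $M$. (c) For a maximal nil-decomposition series $(M_i)_{0\le i\le n}$ of $M$, the Cartier modules $(M_i/M_{i+1})_{\min}$ are minimal and simple, and they are unique up to order and isomorphism: if $(N_i)_{0\le i\le n'}$ is another maximal nil-decomposition series of $M$, there is a bijection $\sigma\colon\{0,\dots,n-1\}\to\{0,\dots,n'-1\}$ with $(M_i/M_{i+1})_{\min}\cong (N_{\sigma(i)}/N_{\sigma(i)+1})_{\min}$ as Cartier modules for all $i$. -/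

import Mathlib

/-!
Cartier modules on a scheme over a finite field `k` with `q` elements: quasi-coherent sheaves with
a `q⁻¹`-linear endomorphism, their Cartier submodules, subquotients, nilpotence, the minimal
Cartier module `M_min` attached to `M`, and nil-decomposition series.
-/

open CategoryTheory AlgebraicGeometry TopologicalSpace Opposite

universe u

noncomputable section

/-! ### The `q`-power Frobenius of a scheme over a finite field with `q` elements -/

/-- The ring endomorphism `r ↦ r ^ q` of a ring `R` that receives a ring homomorphism from a
field `k` with `q` elements. -/
def powCardHom {k R : Type u} [Field k] [Fintype k] [CommRing R] (φ : k →+* R) : R →+* R :=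
  letI := φ.toAlgebra
  (FiniteField.frobeniusAlgHom k R).toRingHom

theorem powCardHom_apply {k R : Type u} [Field k] [Fintype k] [CommRing R] (φ : k →+* R) (r : R) :
    powCardHom φ r = r ^ Fintype.card k := rfl

/-- The structure map `k → Γ(X, U)` of a scheme `X` over `k`. -/
def scalarsTo {k : Type u} [Field k] {X : Scheme.{u}} (s : X ⟶ Spec (.of k)) (U : X.Opens) :
    k →+* Γ(X, U) :=
  ((Scheme.ΓSpecIso (.of k)).inv ≫ s.appTop ≫ X.presheaf.map (homOfLE le_top).op).hom

/-- The `q`-power Frobenius `F : X ⟶ X` of a scheme over a field with `q` elements: the identity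
on the underlying space, and `r ↦ r ^ q` on sections. -/
def qFrobenius {k : Type u} [Field k] [Fintype k] {X : Scheme.{u}} (s : X ⟶ Spec (.of k)) :
    X ⟶ X where
  base := 𝟙 _
  c :=
    { app := fun U => CommRingCat.ofHom (powCardHom (scalarsTo s U.unop))
      naturality := by
        intro U V f
        ext x
        exact (map_pow (X.presheaf.map f).hom x (Fintype.card k)).symm }
  prop := by
    intro x
    constructor
    intro a ha
    obtain ⟨U, hU, t, rfl⟩ := X.presheaf.exists_germ_eq a
    have key := PresheafedSpace.stalkMap_germ_apply
      (X := X.toPresheafedSpace) (Y := X.toPresheafedSpace)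
      { base := 𝟙 _
        c :=
          { app := fun U => CommRingCat.ofHom (powCardHom (scalarsTo s U.unop))
            naturality := by
              intro U V f
              ext x
              exact (map_pow (X.presheaf.map f).hom x (Fintype.card k)).symm } } U x hU t
    erw [key] at ha
    refine (isUnit_pow_iff (Fintype.card_pos (α := k)).ne').1 ?_
    rw [← map_pow]
    exact ha

/-! ### Cartier modules -/

/-- A sheaf of `𝒪_X`-modules `M` with a `q⁻¹`-linear map `C : M → M`, that is an additive map of
sheaves with `C (r ^ q • m) = r • C m`. It is a *Cartier module* if `M` is quasi-coherent, see
`PreCartier.IsCartier`. -/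
structure PreCartier (q : ℕ) (X : Scheme.{u}) where
  toModules : X.Modules
  C : toModules.presheaf ⟶ toModules.presheaf
  C_smul : ∀ (U : X.Opens) (r : Γ(X, U)) (m : Γ(toModules, U)),
    C.app (op U) (r ^ q • m) = r • C.app (op U) m

namespace PreCartier

variable {q : ℕ} {X : Scheme.{u}}

/-- Morphisms are the `𝒪_X`-linear maps that commute with the structural maps. -/
@[ext]
structure Hom (M N : PreCartier q X) where
  toHom : M.toModules ⟶ N.toModules
  comm : ∀ (U : X.Opens) (m : Γ(M.toModules, U)),
    toHom.app U (M.C.app (op U) m) = N.C.app (op U) (toHom.app U m)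

instance : Category (PreCartier q X) where
  Hom := Hom
  id M := ⟨𝟙 _, fun _ _ => rfl⟩
  comp f g := ⟨f.toHom ≫ g.toHom, fun U m =>
    (congrArg (g.toHom.app U) (f.comm U m)).trans (g.comm U (f.toHom.app U m))⟩

/-- `M` is a Cartier module: the underlying `𝒪_X`-module is quasi-coherent. -/
def IsCartier (M : PreCartier q X) : Prop :=
  M.toModules.IsQuasicoherent

/-- `M` is a coherent Cartier module (on a locally Noetherian scheme): the underlying
`𝒪_X`-module is quasi-coherent, and its sections on affine opens are finitely generated modules. -/
def IsCoherent (M : PreCartier q X) : Prop :=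
  M.IsCartier ∧ ∀ U : X.Opens, IsAffineOpen U → Module.Finite Γ(X, U) Γ(M.toModules, U)

/-- The iterates `C ^ e` of the structural map. -/
def powC (M : PreCartier q X) : ℕ → (M.toModules.presheaf ⟶ M.toModules.presheaf)
  | 0 => 𝟙 _
  | e + 1 => M.powC e ≫ M.C

theorem powC_smul (M : PreCartier q X) (e : ℕ) (U : X.Opens) (r : Γ(X, U))
    (m : Γ(M.toModules, U)) :
    (M.powC e).app (op U) (r ^ q ^ e • m) = r • (M.powC e).app (op U) m := by
  induction e generalizing r with
  | zero =>
    rw [pow_zero, pow_one]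
    rfl
  | succ e ih =>
    change M.C.app (op U) ((M.powC e).app (op U) (r ^ q ^ (e + 1) • m)) =
      r • M.C.app (op U) ((M.powC e).app (op U) m)
    rw [pow_succ' q e, pow_mul, ih, M.C_smul]

/-- `M` is nilpotent: some power of the structural map is zero. -/
def IsNilpotent (M : PreCartier q X) : Prop :=
  ∃ e : ℕ, M.powC e = 0

/-! ### Submodules -/

/-- A `C`-stable subsheaf of `𝒪_X`-modules of `M`. -/
@[ext]
structure Sub (M : PreCartier q X) where
  carrier : ∀ U : X.Opens, Submodule Γ(X, U) Γ(M.toModules, U)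
  map_mem : ∀ {U V : X.Opens} (i : V ⟶ U) {m : Γ(M.toModules, U)}, m ∈ carrier U →
    M.toModules.presheaf.map i.op m ∈ carrier V
  mem_of_locally : ∀ {U : X.Opens} (m : Γ(M.toModules, U)),
    (∀ x ∈ U, ∃ (V : X.Opens) (i : V ⟶ U), x ∈ V ∧
      M.toModules.presheaf.map i.op m ∈ carrier V) → m ∈ carrier U
  C_mem : ∀ {U : X.Opens} {m : Γ(M.toModules, U)}, m ∈ carrier U →
    M.C.app (op U) m ∈ carrier U

namespace Sub

variable {M : PreCartier q X}

/-- The underlying presheaf of submodules. -/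
def toPre (N : M.Sub) : M.toModules.val.Submodule where
  obj U := N.carrier U.unop
  map f := fun _ hm => N.map_mem f.unop hm

/-- A subsheaf of `𝒪_X`-modules as an `𝒪_X`-module. -/
def toModules (N : M.Sub) : X.Modules where
  val := N.toPre.toPresheafOfModules
  isSheaf := by
    refine (TopCat.Presheaf.isSheaf_iff_isSheafUniqueGluing
      (N.toPre.toPresheafOfModules.presheaf : TopCat.Presheaf Ab X)).2 fun ι U sf hsf => ?_
    obtain ⟨t, ht, htu⟩ := TopCat.Presheaf.IsSheaf.isSheafUniqueGluing M.toModules.isSheaf U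
      (fun i => (sf i).1) (fun i j => congrArg Subtype.val (hsf i j))
    refine ⟨⟨t, N.mem_of_locally t fun x hx => ?_⟩, fun i => Subtype.ext (ht i), fun s hs =>
      Subtype.ext (htu s.1 fun i => congrArg Subtype.val (hs i))⟩
    obtain ⟨i, hi⟩ := Opens.mem_iSup.1 hx
    refine ⟨U i, Opens.leSupr U i, hi, ?_⟩
    rw [ht i]
    exact (sf i).2

/-- A `C`-stable subsheaf with the restriction of the structural map. -/
def toPreCartier (N : M.Sub) : PreCartier q X where
  toModules := N.toModules
  C :=
    { app := fun U => AddCommGrpCat.ofHom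
        (((M.C.app U).hom.comp (N.carrier U.unop).subtype.toAddMonoidHom).codRestrict
          (N.carrier U.unop).toAddSubgroup (fun m => N.C_mem m.2))
      naturality := by
        intro U V f
        ext m
        apply Subtype.ext
        exact congr($(M.C.naturality f) m.1) }
  C_smul := by
    intro U r m
    apply Subtype.ext
    exact M.C_smul U r m.1

/-- The order is inclusion. -/
instance : PartialOrder M.Sub :=
  PartialOrder.lift carrier fun _ _ h => Sub.ext h

/-- Two sections of `M` that agree locally are equal. -/
theorem eq_of_locally {U : X.Opens} (m m' : Γ(M.toModules, U))
    (h : ∀ x ∈ U, ∃ (V : X.Opens) (i : V ⟶ U), x ∈ V ∧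
      M.toModules.presheaf.map i.op m = M.toModules.presheaf.map i.op m') : m = m' := by
  choose V i hV he using fun x : U => h x.1 x.2
  exact TopCat.Sheaf.eq_of_locally_eq' ⟨M.toModules.presheaf, M.toModules.isSheaf⟩ V U i
    (fun x hx => Opens.mem_iSup.2 ⟨⟨x, hx⟩, hV _⟩) _ _ he

/-- `M` as a submodule of itself. -/
instance : Top M.Sub where
  top :=
    { carrier := fun _ => ⊤
      map_mem := fun _ _ _ => trivial
      mem_of_locally := fun _ _ => trivial
      C_mem := fun _ => trivial }

/-- The zero submodule. -/
instance : Bot M.Sub where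
  bot :=
    { carrier := fun _ => ⊥
      map_mem := by
        intro U V i m hm
        rw [Submodule.mem_bot] at hm ⊢
        rw [hm, map_zero]
      mem_of_locally := by
        intro U m hm
        rw [Submodule.mem_bot]
        refine eq_of_locally m 0 fun x hx => ?_
        obtain ⟨V, i, hV, h⟩ := hm x hx
        exact ⟨V, i, hV, by rw [(Submodule.mem_bot _).1 h, map_zero]⟩
      C_mem := by
        intro U m hm
        rw [Submodule.mem_bot] at hm ⊢
        rw [hm, map_zero] }

/-- Intersections of submodules. -/
instance : InfSet M.Sub where
  sInf S :=
    { carrier := fun U => ⨅ N ∈ S, N.carrier U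
      map_mem := by
        intro U V i m hm
        simp only [Submodule.mem_iInf] at hm ⊢
        exact fun N hN => N.map_mem i (hm N hN)
      mem_of_locally := by
        intro U m hm
        simp only [Submodule.mem_iInf] at hm ⊢
        intro N hN
        refine N.mem_of_locally m fun x hx => ?_
        obtain ⟨V, i, hV, h⟩ := hm x hx
        exact ⟨V, i, hV, h N hN⟩
      C_mem := by
        intro U m hm
        simp only [Submodule.mem_iInf] at hm ⊢
        exact fun N hN => N.C_mem (hm N hN) }

/-- The lattice of `C`-stable subsheaves of `𝒪_X`-modules; suprema are the sums of subsheaves,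
the smallest subsheaves that contain the given ones. -/
instance : CompleteLattice M.Sub where
  __ := completeLatticeOfInf M.Sub (by
    intro S
    constructor
    · intro N hN U m hm
      exact (Submodule.mem_iInf _).1 ((Submodule.mem_iInf _).1 hm N) hN
    · intro N hN U m hm
      exact (Submodule.mem_iInf _).2 fun K => (Submodule.mem_iInf _).2 fun hK => hN hK U hm)
  top := ⊤
  le_top _ _ := le_top
  bot := ⊥
  bot_le _ _ := bot_le

/-- The Cartier submodules: the `C`-stable subsheaves that are quasi-coherent. -/
def IsCartier (N : M.Sub) : Prop :=
  N.toPreCartier.IsCartier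

/-- The submodule `N' ∩ N` of `N`. -/
def inside (N' N : M.Sub) : N.toPreCartier.Sub where
  carrier U := ((N'.carrier U).comap (N.carrier U).subtype : Submodule Γ(X, U) (N.carrier U))
  map_mem i _ hm := N'.map_mem i hm
  mem_of_locally m hm := N'.mem_of_locally m.1 hm
  C_mem hm := N'.C_mem hm

/-! ### Quotients -/

/-- The presheaf `U ↦ M(U) / N(U)`. -/
def quotPre (N : M.Sub) : X.PresheafOfModules where
  obj U := ModuleCat.of _ (M.toModules.val.obj U ⧸ N.toPre.obj U)
  map {U V} f := ModuleCat.semilinearMapAddEquiv _ _ _ <|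
    (N.toPre.obj U).mapQ (N.toPre.obj V) (M.toModules.val.restrictₛₗ f) (N.toPre.map f)
  map_id U := by
    ext m
    exact congrArg (N.toPre.obj U).mkQ congr($(M.toModules.presheaf.map_id U) m)
  map_comp {U V W} f g := by
    ext m
    exact congrArg (N.toPre.obj W).mkQ congr($(M.toModules.presheaf.map_comp f g) m)

/-- The map induced by `C` on the presheaf `U ↦ M(U) / N(U)`. -/
def quotPreC (N : M.Sub) : N.quotPre.presheaf ⟶ N.quotPre.presheaf where
  app U := AddCommGrpCat.ofHom (QuotientAddGroup.map (N.toPre.obj U).toAddSubgroup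
    (N.toPre.obj U).toAddSubgroup (M.C.app U).hom (fun _ hm => N.C_mem hm))
  naturality U V f := by
    ext m
    obtain ⟨m, rfl⟩ := Submodule.mkQ_surjective _ m
    exact congrArg (N.toPre.obj V).mkQ congr($(M.C.naturality f) m)

/-- The quotient sheaf `M / N`: the sheaf associated with `U ↦ M(U) / N(U)`. -/
def quotModules (N : M.Sub) : X.Modules :=
  (PresheafOfModules.sheafification (𝟙 X.ringCatSheaf.obj)).obj N.quotPre

/-- The projection `M → M / N` on sections. -/
def toQuot (N : M.Sub) (U : X.Opens) : Γ(M.toModules, U) →ₗ[Γ(X, U)] Γ(N.quotModules, U) where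
  toFun m := (CategoryTheory.toSheafify (Opens.grothendieckTopology X) N.quotPre.presheaf).app
    (op U) ((N.toPre.obj (op U)).mkQ m)
  map_add' a b := map_add ((CategoryTheory.toSheafify (Opens.grothendieckTopology X)
    N.quotPre.presheaf).app (op U)).hom ((N.toPre.obj (op U)).mkQ a) ((N.toPre.obj (op U)).mkQ b)
  map_smul' r m := ((PresheafOfModules.toSheafify (𝟙 X.ringCatSheaf.obj)
    (CategoryTheory.toSheafify (Opens.grothendieckTopology X) N.quotPre.presheaf)).app
      (op U)).hom.map_smul r ((N.toPre.obj (op U)).mkQ m)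

theorem exists_toQuot_eq (N : M.Sub) {U : X.Opens} (m : Γ(N.quotModules, U)) (x : X)
    (hx : x ∈ U) :
    ∃ (V : X.Opens) (i : V ⟶ U) (m' : Γ(M.toModules, V)), x ∈ V ∧
      N.toQuot V m' = N.quotModules.presheaf.map i.op m := by
  have h := Presheaf.imageSieve_mem (Opens.grothendieckTopology X)
    (CategoryTheory.toSheafify (Opens.grothendieckTopology X) N.quotPre.presheaf) (U := op U) m
  obtain ⟨V, i, ⟨m', hm'⟩, hV⟩ := h x hx
  obtain ⟨m', rfl⟩ := Submodule.mkQ_surjective _ m'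
  exact ⟨V, i, m', hV, hm'⟩

/-- The map induced by `C` on `M / N`. -/
def quotC (N : M.Sub) : N.quotModules.presheaf ⟶ N.quotModules.presheaf :=
  CategoryTheory.sheafifyMap (Opens.grothendieckTopology X) N.quotPreC

theorem quotC_toQuot (N : M.Sub) {U : X.Opens} (m : Γ(M.toModules, U)) :
    N.quotC.app (op U) (N.toQuot U m) = N.toQuot U (M.C.app (op U) m) :=
  congr($(NatTrans.congr_app (CategoryTheory.toSheafify_naturality
    (Opens.grothendieckTopology X) N.quotPreC) (op U)) ((N.toPre.obj (op U)).mkQ m)).symm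

/-- The quotient `M / N` with the induced structural map. -/
def quot (N : M.Sub) : PreCartier q X where
  toModules := N.quotModules
  C := N.quotC
  C_smul U r m := by
    choose V i m' hV hm' using fun x : U => N.exists_toQuot_eq m x.1 x.2
    refine TopCat.Sheaf.eq_of_locally_eq' ⟨N.quotModules.presheaf, N.quotModules.isSheaf⟩ V U i
      (fun x hx => Opens.mem_iSup.2 ⟨⟨x, hx⟩, hV _⟩) _ _ fun x => ?_
    change N.quotModules.presheaf.map (i x).op _ = N.quotModules.presheaf.map (i x).op _
    have h1 := NatTrans.naturality_apply N.quotC (i x).op (r ^ q • m)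
    have h2 := NatTrans.naturality_apply N.quotC (i x).op m
    rw [← h1, Scheme.Modules.map_smul, Scheme.Modules.map_smul, ← h2, ← hm', map_pow,
      ← map_smul (N.toQuot (V x)), quotC_toQuot, quotC_toQuot, M.C_smul, map_smul]

/-- The subquotient `N / N'` (`N / (N ∩ N')` if `N'` is not contained in `N`). -/
def subquot (N N' : M.Sub) : PreCartier q X :=
  (N'.inside N).quot

end Sub

/-! ### The minimal Cartier module attached to a coherent Cartier module -/

/-- The image sheaf `C ^ e (M)`. -/
def imagePow (M : PreCartier q X) (e : ℕ) : M.Sub where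
  carrier U :=
    { carrier := {m | ∀ x ∈ U, ∃ (V : X.Opens) (i : V ⟶ U), x ∈ V ∧
        ∃ m' : Γ(M.toModules, V), (M.powC e).app (op V) m' = M.toModules.presheaf.map i.op m}
      zero_mem' := fun x hx => ⟨U, 𝟙 U, hx, 0, by rw [map_zero, map_zero]⟩
      add_mem' := by
        intro a b ha hb x hx
        obtain ⟨V, i, hV, a', ha'⟩ := ha x hx
        obtain ⟨W, j, hW, b', hb'⟩ := hb x hx
        refine ⟨V ⊓ W, Opens.infLELeft V W ≫ i, ⟨hV, hW⟩,
          M.toModules.presheaf.map (Opens.infLELeft V W).op a' +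
            M.toModules.presheaf.map (Opens.infLERight V W).op b', ?_⟩
        have h1 := NatTrans.naturality_apply (M.powC e) (Opens.infLELeft V W).op a'
        have h2 := NatTrans.naturality_apply (M.powC e) (Opens.infLERight V W).op b'
        rw [map_add, map_add, h1, h2, ha', hb', ← ConcreteCategory.comp_apply,
          ← ConcreteCategory.comp_apply, ← Functor.map_comp, ← Functor.map_comp]
        rfl
      smul_mem' := by
        intro r m hm x hx
        obtain ⟨V, i, hV, m', hm'⟩ := hm x hx
        refine ⟨V, i, hV, X.presheaf.map i.op r ^ q ^ e • m', ?_⟩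
        rw [M.powC_smul, hm', Scheme.Modules.map_smul] }
  map_mem := by
    intro U V i m hm x hx
    obtain ⟨W, j, hW, m', hm'⟩ := hm x (i.le hx)
    refine ⟨W ⊓ V, Opens.infLERight W V, ⟨hW, hx⟩,
      M.toModules.presheaf.map (Opens.infLELeft W V).op m', ?_⟩
    have h1 := NatTrans.naturality_apply (M.powC e) (Opens.infLELeft W V).op m'
    rw [h1, hm', ← ConcreteCategory.comp_apply, ← ConcreteCategory.comp_apply,
      ← Functor.map_comp, ← Functor.map_comp]
    rfl
  mem_of_locally := by
    intro U m hm x hx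
    obtain ⟨V, i, hV, h⟩ := hm x hx
    obtain ⟨W, j, hW, m', hm'⟩ := h x hV
    refine ⟨W, j ≫ i, hW, m', ?_⟩
    rw [hm', ← ConcreteCategory.comp_apply, ← Functor.map_comp]
    rfl
  C_mem := by
    intro U m hm x hx
    obtain ⟨V, i, hV, m', hm'⟩ := hm x hx
    refine ⟨V, i, hV, M.C.app (op V) m', ?_⟩
    have h1 := NatTrans.naturality_apply M.C i.op m
    have h2 : ∀ (e : ℕ) (m' : Γ(M.toModules, V)),
        (M.powC e).app (op V) (M.C.app (op V) m') = M.C.app (op V) ((M.powC e).app (op V) m') := by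
      intro e
      induction e with
      | zero => intro m'; rfl
      | succ e ih => exact fun m' => congrArg (M.C.app (op V)) (ih m')
    rw [h2, hm']
    exact h1

/-- The stable image of the structural map: the intersection of the descending chain
`M ⊇ C(M) ⊇ C²(M) ⊇ ⋯` (for a coherent Cartier module on a Noetherian scheme the chain is
stationary, and this is `C ^ e (M)` for all large `e`). -/
def stableImage (M : PreCartier q X) : M.Sub :=
  ⨅ e : ℕ, M.imagePow e

/-- `M_nil`, the sum of all nilpotent Cartier submodules of `M`. -/
def nil (M : PreCartier q X) : M.Sub :=
  sSup {N : M.Sub | N.IsCartier ∧ N.toPreCartier.IsNilpotent}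

/-- `M_min`: replace `M` by its stable image, and divide by the largest nilpotent submodule. -/
def min (M : PreCartier q X) : PreCartier q X :=
  M.stableImage.toPreCartier.nil.quot

/-- A Cartier module is minimal if it has neither nonzero nilpotent Cartier submodules nor nonzero
nilpotent Cartier quotients. -/
def IsMinimal (M : PreCartier q X) : Prop :=
  M.IsCartier ∧
  (∀ N : M.Sub, N.IsCartier → N.toPreCartier.IsNilpotent → N = ⊥) ∧
  ∀ N : M.Sub, N.IsCartier → N.quot.IsNilpotent → N = ⊤

/-- A Cartier module is simple if it is nonzero and has no Cartier submodules besides zero and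
itself. -/
def IsSimple (M : PreCartier q X) : Prop :=
  M.IsCartier ∧ (⊥ : M.Sub) ≠ ⊤ ∧ ∀ N : M.Sub, N.IsCartier → N = ⊥ ∨ N = ⊤

/-! ### Nil-decomposition series -/

/-- A nil-decomposition series `M = M_0 ⊇ M_1 ⊇ ⋯ ⊇ M_n = 0`: the `M_i` are Cartier submodules of
`M`, and none of the quotients `M_i / M_{i+1}` is nilpotent. -/
structure NilDecompositionSeries (M : PreCartier q X) where
  length : ℕ
  term : Fin (length + 1) → M.Sub
  isCartier : ∀ i, (term i).IsCartier
  term_zero : term 0 = ⊤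
  term_last : term (Fin.last length) = ⊥
  succ_le : ∀ i : Fin length, term i.succ ≤ term i.castSucc
  not_isNilpotent : ∀ i : Fin length, ¬ ((term i.castSucc).subquot (term i.succ)).IsNilpotent

namespace NilDecompositionSeries

variable {M : PreCartier q X}

/-- The quotient `M_i / M_{i+1}`. -/
def factor (S : M.NilDecompositionSeries) (i : Fin S.length) : PreCartier q X :=
  (S.term i.castSucc).subquot (S.term i.succ)

/-- `S'` refines `S`: the series `S` is obtained from `S'` by omitting terms. -/
def Refines (S' S : M.NilDecompositionSeries) : Prop :=
  ∃ f : Fin (S.length + 1) → Fin (S'.length + 1), StrictMono f ∧ ∀ i, S'.term (f i) = S.term i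

/-- A nil-decomposition series is maximal if it cannot be refined to a longer one. -/
def IsMaximal (S : M.NilDecompositionSeries) : Prop :=
  ∀ S' : M.NilDecompositionSeries, S'.Refines S → ¬ S.length < S'.length

end NilDecompositionSeries

/-- The quasi-length of `M`: the length of the shortest maximal nil-decomposition series of `M`. -/
def quasiLength (M : PreCartier q X) : ℕ :=
  sInf {n | ∃ S : M.NilDecompositionSeries, S.IsMaximal ∧ S.length = n}

end PreCartier

end

universe v

/-! ### Submodules up to torsion -/

section Torsion

variable {R : Type u} [CommRing R] {M : Type v} [AddCommGroup M] [Module R M]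

/-! Cartier submodules are studied up to nilpotence. For large `e` the submodules `C ^ e (N)` agree
with a stable image `core N`, on which `C` is an epimorphism (`IsFull`), and `core N₁ ≤ core N₂`
holds exactly when some `C ^ e` maps `N₁` into `N₂` (`core_le_core_iff`). So `B / A` with `A ≤ B` is
nilpotent exactly when `A` and `B` have the same core, and a nil-decomposition series becomes a
strict chain of full Cartier submodules. These form a modular lattice `FullSub`: the join is the
sum, the meet is the core of the intersection. For a maximal series the chain is a composition
series, since a full `P` strictly between two consecutive cores would allow `M_{i+1} + P` to be
inserted (`IsMaximal.eq_or_eq`). Jordan–Hölder for modular lattices then gives equal lengths and a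
matching of the factors. To turn the matching into isomorphisms, `exists_hom_min` presents `(B /
A)_min` as the quotient of a full submodule `P` by the largest Cartier submodule of `P` that some `C
^ e` maps into `A`.

Two finiteness results over a Noetherian ring `R` carry this. The first is that the images of `C ^
e` become stationary (`iterateRange_stabilizes`). It goes by Noetherian induction on an ideal `I`
that kills an image modulo the intersection of all images. For prime `I` the ranks over `R ⧸ I`
become constant, and an inclusion of `x • C ^ e (M)` in the next image improves to all later images
with `x ^ 2`, because `x • C m = C (x ^ q • m)` and `q ≥ 2`.

The second is finite length up to nilpotence (`hasNilLength`), which gives the existence of maximal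
refinements and rests on `F`-finiteness. Dévissage reduces to a torsion-free module over a domain
with no nonzero submodule killed by `C`. Take a nonzero stable submodule of least rank and replace
it by its stable image `B`. Its nonzero stable submodules `N` are generically equal to `B`, and one
`c ≠ 0` satisfies `c • B ≤ N` for all of them (`exists_smul_mem_of_generically_eq`). Their
intersection is therefore nonzero, hence a minimal stable submodule. The uniform `c` arises as
follows: for the ideal `J` of elements that carry `B` into `N`, some `t` independent of `N`
satisfies `t J ⊆ J ^ 2`; Cayley–Hamilton puts a power of `t` into `J`, and surjectivity of `C`
removes the dependence on the exponent.

The sheaf-theoretic part reduces statements about Cartier modules to sections over a finite affine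
cover. -/

theorem exists_uniform_smul_mem (I : Ideal R) [I.IsPrime] (N₁ N₂ : Submodule R M) (hN : N₂.FG)
    (h : ∀ m ∈ N₂, ∃ c ∉ I, c • m ∈ N₁) : ∃ c ∉ I, ∀ m ∈ N₂, c • m ∈ N₁ := by
  induction N₂, hN using Submodule.fg_induction with
  | singleton x =>
    obtain ⟨c, hc, hx⟩ := h x (Submodule.mem_span_singleton_self x)
    refine ⟨c, hc, fun m hm => ?_⟩
    obtain ⟨r, rfl⟩ := Submodule.mem_span_singleton.1 hm
    rw [smul_comm]
    exact N₁.smul_mem r hx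
  | sup P₁ P₂ _ _ h₁ h₂ =>
    obtain ⟨c₁, hc₁, h₁⟩ := h₁ fun m hm => h m (Submodule.mem_sup_left hm)
    obtain ⟨c₂, hc₂, h₂⟩ := h₂ fun m hm => h m (Submodule.mem_sup_right hm)
    refine ⟨c₁ * c₂, fun hc => (Ideal.IsPrime.mem_or_mem ‹_› hc).elim hc₁ hc₂, fun m hm => ?_⟩
    obtain ⟨a, ha, b, hb, rfl⟩ := Submodule.mem_sup.1 hm
    rw [smul_add, mul_comm c₁, mul_smul, mul_comm c₂, mul_smul]
    exact N₁.add_mem (N₁.smul_mem _ (h₁ a ha)) (N₁.smul_mem _ (h₂ b hb))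

/-- By additivity of the rank, the quotient has rank zero and is torsion; finite generation of `N₂`
allows one common denominator. -/
theorem exists_smul_mem_of_finrank_eq [IsDomain R] [IsNoetherianRing R] [Module.Finite R M]
    {N₁ N₂ : Submodule R M} (h : N₁ ≤ N₂)
    (hr : Module.finrank R N₁ = Module.finrank R N₂) :
    ∃ c : R, c ≠ 0 ∧ ∀ m ∈ N₂, c • m ∈ N₁ := by
  have h1 := Submodule.finrank_quotient_add_finrank (N₁.comap N₂.subtype)
  rw [(Submodule.comapSubtypeEquivOfLe h).finrank_eq, hr] at h1
  have h2 := Module.finrank_eq_zero_iff.1 (Nat.add_eq_right.1 h1)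
  obtain ⟨c, hc, h3⟩ := exists_uniform_smul_mem (⊥ : Ideal R) N₁ N₂ (IsNoetherian.noetherian _)
    fun m hm => by
      obtain ⟨a, ha, h4⟩ := h2 (Submodule.Quotient.mk ⟨m, hm⟩)
      rw [← Submodule.Quotient.mk_smul, Submodule.Quotient.mk_eq_zero] at h4
      exact ⟨a, ha, h4⟩
  exact ⟨c, hc, h3⟩

/-- The rank function of a module over `R ⧸ I`, seen on submodules over `R`. -/
theorem exists_rank_function [IsNoetherianRing R] [Module.Finite R M] (I : Ideal R) [I.IsPrime]
    (hI : ∀ a ∈ I, ∀ m : M, a • m = 0) :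
    ∃ l : Submodule R M → ℕ, ∀ N₁ N₂, N₁ ≤ N₂ →
      l N₁ ≤ l N₂ ∧ (l N₁ = l N₂ → ∃ a ∉ I, ∀ m ∈ N₂, a • m ∈ N₁) := by
  have hT : Module.IsTorsionBySet R M I := fun m a => hI a a.2 m
  let := hT.module
  have hs : IsScalarTower R (R ⧸ I) M := hT.isScalarTower
  have : Module.Finite (R ⧸ I) M := Module.Finite.of_restrictScalars_finite R _ _
  let t : Submodule R M → Submodule (R ⧸ I) M := fun N =>
    { N with
      smul_mem' := by
        intro a m hm
        obtain ⟨a, rfl⟩ := Ideal.Quotient.mk_surjective a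
        exact N.smul_mem a hm }
  refine ⟨fun N => Module.finrank (R ⧸ I) (t N), fun N₁ N₂ h => ⟨?_, fun hr => ?_⟩⟩
  · exact Submodule.finrank_mono (show t N₁ ≤ t N₂ from h)
  · obtain ⟨c, hc, h1⟩ := exists_smul_mem_of_finrank_eq (show t N₁ ≤ t N₂ from h) hr
    obtain ⟨a, rfl⟩ := Ideal.Quotient.mk_surjective c
    exact ⟨a, fun ha => hc (Ideal.Quotient.eq_zero_iff_mem.2 ha), h1⟩

end Torsion

/-! ### Modules with a `q⁻¹`-linear endomorphism -/

section QLinear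

variable {R : Type u} [CommRing R] {q : ℕ} {M : Type v} [AddCommGroup M] [Module R M]
  {C : M →+ M}

theorem iterate_pow_smul (hC : ∀ (r : R) m, C (r ^ q • m) = r • C m) (e : ℕ) (r : R) (m : M) :
    C^[e] (r ^ q ^ e • m) = r • C^[e] m := by
  induction e generalizing r with
  | zero => simp
  | succ e ih =>
    rw [Function.iterate_succ_apply', pow_succ' q e, pow_mul, ih, hC,
      Function.iterate_succ_apply']

theorem iterate_map_mem {N : Submodule R M} (hN : ∀ m ∈ N, C m ∈ N) (e : ℕ) {m : M}
    (hm : m ∈ N) : C^[e] m ∈ N := by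
  induction e with
  | zero => exact hm
  | succ e ih =>
    rw [Function.iterate_succ_apply']
    exact hN _ ih

/-- The image of `C ^ e`. -/
def iterateRange (hC : ∀ (r : R) m, C (r ^ q • m) = r • C m) (e : ℕ) : Submodule R M where
  carrier := Set.range C^[e]
  zero_mem' := ⟨0, iterate_map_zero C e⟩
  add_mem' := by
    rintro _ _ ⟨a, rfl⟩ ⟨b, rfl⟩
    exact ⟨a + b, iterate_map_add C e a b⟩
  smul_mem' := by
    rintro r _ ⟨a, rfl⟩
    exact ⟨r ^ q ^ e • a, iterate_pow_smul hC e r a⟩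

variable (hC : ∀ (r : R) m, C (r ^ q • m) = r • C m)

theorem iterate_mem_iterateRange (e : ℕ) (m : M) : C^[e] m ∈ iterateRange hC e := ⟨m, rfl⟩

theorem iterateRange_antitone : Antitone (iterateRange hC) := by
  refine antitone_nat_of_succ_le fun e => ?_
  rintro _ ⟨a, rfl⟩
  exact ⟨C a, rfl⟩

theorem map_mem_iterateRange_succ {e : ℕ} {m : M} (hm : m ∈ iterateRange hC e) :
    C m ∈ iterateRange hC (e + 1) := by
  obtain ⟨a, rfl⟩ := hm
  exact ⟨a, Function.iterate_succ_apply' C e a⟩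

theorem map_mem_iterateRange {e : ℕ} {m : M} (hm : m ∈ iterateRange hC e) :
    C m ∈ iterateRange hC e :=
  iterateRange_antitone hC e.le_succ (map_mem_iterateRange_succ hC hm)

theorem map_mem_iInf_iterateRange_sup {A : Submodule R M} (hA : ∀ m ∈ A, C m ∈ A) {m : M}
    (hm : m ∈ ⨅ e, iterateRange hC e ⊔ A) : C m ∈ ⨅ e, iterateRange hC e ⊔ A := by
  simp only [Submodule.mem_iInf] at hm ⊢
  intro e
  obtain ⟨a, ha, b, hb, rfl⟩ := Submodule.mem_sup.1 (hm e)
  rw [map_add]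
  exact Submodule.add_mem_sup (map_mem_iterateRange hC ha) (hA b hb)

include hC in
theorem map_mem_torsionBy_mod (hq : q ≠ 0) {W : Submodule R M} (hW : ∀ m ∈ W, C m ∈ W) (a : R)
    {m : M} (hm : a • m ∈ W) : a • C m ∈ W := by
  rw [← hC]
  refine hW _ ?_
  obtain ⟨q, rfl⟩ := Nat.exists_eq_succ_of_ne_zero hq
  rw [pow_succ, mul_smul]
  exact W.smul_mem _ hm

/-- If `x • m = C b + a`, then `x ^ 2 • m = C (x ^ q • b) + x • a`, and `x ^ q = x ^ 2 * x ^ (q -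
2)`, so the same argument applies to `x ^ (q - 2) • b`. The exponent `2` is what leaves a factor `x
^ 2` to continue with when `q ≥ 2`. -/
theorem sq_smul_mem_of_smul_mem_succ (hq : 2 ≤ q) {A : Submodule R M}
    (hA : ∀ m ∈ A, C m ∈ A) {x : R} {e₁ : ℕ}
    (h : ∀ m ∈ iterateRange hC e₁, x • m ∈ iterateRange hC (e₁ + 1) ⊔ A) (e : ℕ) :
    ∀ m ∈ iterateRange hC e₁, x ^ 2 • m ∈ iterateRange hC e ⊔ A := by
  -- Keeping the factor `x ^ 2` inside `C ^ e` makes the claim strong enough for induction on `e`.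
  suffices H : ∀ m ∈ iterateRange hC e₁, ∃ m' ∈ iterateRange hC e₁, ∃ a ∈ A,
      x ^ 2 • m = C^[e] (x ^ 2 • m') + a by
    intro m hm
    obtain ⟨m', -, a, ha, h'⟩ := H m hm
    rw [h']
    exact Submodule.add_mem_sup (iterate_mem_iterateRange hC e _) ha
  induction e with
  | zero => exact fun m hm => ⟨m, hm, 0, A.zero_mem, by simp⟩
  | succ e ih =>
    intro m hm
    obtain ⟨_, ⟨b, rfl⟩, a, ha, h1⟩ := Submodule.mem_sup.1 (h m hm)
    have hb := iterate_mem_iterateRange hC e₁ b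
    obtain ⟨m', hm', a', ha', h2⟩ := ih (x ^ (q - 2) • C^[e₁] b) (Submodule.smul_mem _ _ hb)
    refine ⟨m', hm', C a' + x • a, A.add_mem (hA _ ha') (A.smul_mem _ ha), ?_⟩
    rw [smul_smul, ← pow_add, Nat.add_sub_cancel' hq] at h2
    rw [show x ^ 2 • m = x • x • m by rw [sq, mul_smul], ← h1, smul_add, Function.iterate_succ_apply' C, ← hC, h2, map_add,
      Function.iterate_succ_apply' C, add_assoc]

/-- Modulo `W` the images from `e₀` on are modules over the domain `R ⧸ I`. Their ranks decrease, so
two consecutive ones agree and the images differ by torsion. Since `W` is contained in every `C ^ e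
(M) + A`, working modulo `W` costs nothing. -/
theorem exists_smul_iterateRange_mem_of_isPrime [IsNoetherianRing R] [Module.Finite R M]
    (I : Ideal R) [I.IsPrime] (A : Submodule R M) (e₀ : ℕ)
    (h : ∀ a ∈ I, ∀ m ∈ iterateRange hC e₀, ∀ e, a • m ∈ iterateRange hC e ⊔ A) :
    ∃ a ∉ I, ∃ e₁, ∀ m ∈ iterateRange hC e₁, a • m ∈ iterateRange hC (e₁ + 1) ⊔ A := by
  set W : Submodule R M := ⨅ e, iterateRange hC e ⊔ A with hW
  let Y := (iterateRange hC e₀).map W.mkQ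
  have hY : ∀ a ∈ I, ∀ y : Y, a • y = 0 := by
    rintro a ha ⟨_, m, hm, rfl⟩
    apply Subtype.ext
    change a • W.mkQ m = 0
    rw [← map_smul, Submodule.mkQ_apply, Submodule.Quotient.mk_eq_zero, hW, Submodule.mem_iInf]
    exact h a ha m hm
  obtain ⟨l, hl⟩ := exists_rank_function (M := Y) I hY
  let N : ℕ → Submodule R Y := fun e => ((iterateRange hC (e₀ + e)).map W.mkQ).comap Y.subtype
  have hN : Antitone N := fun a b hab =>
    Submodule.comap_mono (Submodule.map_mono (iterateRange_antitone hC (by lia)))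
  obtain ⟨n, hn⟩ := WellFoundedGT.monotone_chain_condition
    (⟨fun e => OrderDual.toDual (l (N e)), fun a b hab => (hl _ _ (hN hab)).1⟩ : ℕ →o ℕᵒᵈ)
  obtain ⟨a, ha, h1⟩ := (hl _ _ (hN n.le_succ)).2 (hn (n + 1) n.le_succ).symm
  refine ⟨a, ha, e₀ + n, fun m hm => ?_⟩
  obtain ⟨m', hm', h2⟩ := h1 ⟨W.mkQ m, m, iterateRange_antitone hC (by lia) hm, rfl⟩ ⟨m, hm, rfl⟩
  replace h2 : W.mkQ m' = W.mkQ (a • m) := h2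
  rw [Submodule.mkQ_apply, Submodule.mkQ_apply, Submodule.Quotient.eq] at h2
  have h3 := (Submodule.mem_iInf _).1 h2 (e₀ + n + 1)
  have h4 := Submodule.sub_mem _ (Submodule.mem_sup_left hm') h3
  rwa [sub_sub_cancel] at h4

/-- Noetherian induction on `I`: each case reaches the hypothesis for a strictly larger ideal,
possibly with a larger `e₀`. The stable submodule `A` has to be arbitrary because the case of a
non-prime `I` changes it. -/
theorem iterateRange_sup_stabilizes [IsNoetherianRing R] [Module.Finite R M] (hq : 2 ≤ q)
    (I : Ideal R) : ∀ (A : Submodule R M), (∀ m ∈ A, C m ∈ A) → ∀ e₀,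
    (∀ a ∈ I, ∀ m ∈ iterateRange hC e₀, ∀ e, a • m ∈ iterateRange hC e ⊔ A) →
    ∃ e₁, ∀ e, iterateRange hC e₁ ≤ iterateRange hC e ⊔ A := by
  induction I using WellFoundedGT.induction with
  | ind I ih =>
  intro A hA e₀ h
  set W : Submodule R M := ⨅ e, iterateRange hC e ⊔ A with hW
  have memW (m : M) : m ∈ W ↔ ∀ e, m ∈ iterateRange hC e ⊔ A := Submodule.mem_iInf _
  have stabW : ∀ m ∈ W, C m ∈ W := fun m hm => map_mem_iInf_iterateRange_sup hC hA hm
  simp only [← memW] at h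
  by_cases htop : I = ⊤
  · exact ⟨e₀, fun e m hm => (memW _).1 (one_smul R m ▸ h 1 (htop ▸ Submodule.mem_top) m hm) e⟩
  by_cases hrad : I.IsRadical
  swap
  · have hlt : I < I.radical :=
      lt_of_le_of_ne Ideal.le_radical fun h => hrad (Ideal.radical_eq_iff.1 h.symm)
    obtain ⟨n, hn⟩ := I.exists_radical_pow_le_of_fg (IsNoetherian.noetherian _)
    -- For `a` in the radical, `a • C ^ n (y) = C ^ n (a ^ (q ^ n) • y)`, and `a ^ (q ^ n)` lies in
    -- `I` because `n ≤ q ^ n`. Thus `n` further iterates replace `I` by its radical.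
    refine ih _ hlt A hA (e₀ + n) fun a ha m hm e => (memW _).1 ?_ e
    obtain ⟨x, rfl⟩ := hm
    rw [add_comm, Function.iterate_add_apply, ← iterate_pow_smul hC]
    refine iterate_map_mem stabW _ (h _ ?_ _ (iterate_mem_iterateRange hC _ _))
    exact I.pow_mem_of_pow_mem (hn (Ideal.pow_mem_pow ha n)) (Nat.lt_pow_self hq).le
  -- A multiplier outside `I` for one step is enough: its square stays outside the radical ideal
  -- `I`, works for all later steps, and so can be adjoined to `I`.
  suffices H : ∃ a ∉ I, ∃ e₁, ∀ m ∈ iterateRange hC e₁, a • m ∈ iterateRange hC (e₁ + 1) ⊔ A by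
    obtain ⟨x, hx, e₁, h1⟩ := H
    have hlt : I < I ⊔ Ideal.span {x ^ 2} := by
      refine lt_of_le_of_ne le_sup_left fun h => hx (hrad ⟨2, ?_⟩)
      rw [h]
      exact Ideal.mem_sup_right (Ideal.mem_span_singleton_self _)
    refine ih _ hlt A hA (max e₀ e₁) fun a ha m hm e => ?_
    obtain ⟨i, hi, j, hj, rfl⟩ := Submodule.mem_sup.1 ha
    obtain ⟨r, rfl⟩ := Ideal.mem_span_singleton'.1 hj
    rw [add_smul, mul_smul]
    refine Submodule.add_mem _ ((memW _).1 (h i hi m ?_) e) (Submodule.smul_mem _ _ ?_)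
    · exact iterateRange_antitone hC (le_max_left _ _) hm
    · exact sq_smul_mem_of_smul_mem_succ hC hq hA h1 e m
        (iterateRange_antitone hC (le_max_right _ _) hm)
  by_cases hprime : I.IsPrime
  · exact exists_smul_iterateRange_mem_of_isPrime hC I A e₀ fun a ha m hm => (memW _).1 (h a ha m hm)
  · obtain ⟨a, ha, b, hb, hab⟩ : ∃ a ∉ I, ∃ b ∉ I, a * b ∈ I := by
      by_contra! H
      exact hprime ⟨htop, fun {x y} hxy => or_iff_not_imp_left.2 fun hx => by
        by_contra hy; exact H x hx y hy hxy⟩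
    -- Modulo `A₁`, the elements that `a` carries into `W`, the image is killed by `b` as well as by
    -- `I`, since `a * b ∈ I`. Multiplying the resulting inclusion by `a` turns `A₁` back into `W`.
    let A₁ : Submodule R M := W.comap (LinearMap.lsmul R M a)
    have hlt : I < I ⊔ Ideal.span {b} := by
      refine lt_of_le_of_ne le_sup_left fun h => hb ?_
      rw [h]
      exact Ideal.mem_sup_right (Ideal.mem_span_singleton_self _)
    obtain ⟨e₁, h1⟩ := ih _ hlt A₁
      (fun m hm => map_mem_torsionBy_mod hC (by lia) stabW a hm) e₀ fun x hx m hm e => by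
        refine Submodule.mem_sup_right ?_
        obtain ⟨i, hi, j, hj, rfl⟩ := Submodule.mem_sup.1 hx
        obtain ⟨r, rfl⟩ := Ideal.mem_span_singleton'.1 hj
        change a • (i + r * b) • m ∈ W
        have : a • (i + r * b) • m = a • i • m + r • (a * b) • m := by
          simp only [smul_smul, ← add_smul]; congr 1; ring
        rw [this]
        exact W.add_mem (W.smul_mem _ (h i hi m hm)) (W.smul_mem _ (h _ hab m hm))
    refine ⟨a, ha, e₁, fun m hm => ?_⟩
    obtain ⟨x, hx, y, hy, rfl⟩ := Submodule.mem_sup.1 (h1 (e₁ + 1) hm)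
    rw [smul_add]
    exact Submodule.add_mem _ (Submodule.mem_sup_left (Submodule.smul_mem _ _ hx))
      ((memW _).1 hy _)

/-- The images of the powers of a `q⁻¹`-linear endomorphism of a finite module over a Noetherian
ring are stationary. -/
theorem iterateRange_stabilizes [IsNoetherianRing R] [Module.Finite R M] (hq : 2 ≤ q) :
    ∃ e₁, ∀ e, iterateRange hC e₁ ≤ iterateRange hC e := by
  obtain ⟨e₁, h⟩ := iterateRange_sup_stabilizes hC hq ⊥ ⊥ (by simp) 0 (by simp)
  exact ⟨e₁, fun e => by simpa using h e⟩

end QLinear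

/-! ### Uniform denominators for stable submodules over an `F`-finite domain -/

section Domain

variable {A : Type u} [CommRing A]

theorem exists_linearIndependent_smul_mem_span [IsDomain A] [IsNoetherianRing A] (M : Type v)
    [AddCommGroup M] [Module A M] [Module.Finite A M] :
    ∃ (n : ℕ) (v : Fin n → M), LinearIndependent A v ∧ n = Module.finrank A M ∧
      ∃ c : A, c ≠ 0 ∧ ∀ m : M, c • m ∈ Submodule.span A (Set.range v) := by
  obtain ⟨v, hv⟩ := exists_linearIndependent_of_le_finrank (le_refl (Module.finrank A M))
  obtain ⟨c, hc, h⟩ := exists_smul_mem_of_finrank_eq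
    (le_top : Submodule.span A (Set.range v) ≤ ⊤)
    (by rw [finrank_span_eq_card hv, Fintype.card_fin, finrank_top])
  exact ⟨_, v, hv, rfl, c, hc, fun m => h m trivial⟩

/-- The ring `A` as a module over itself through a ring endomorphism. -/
def FrobeniusPush (_F : A →+* A) : Type u := A

instance (F : A →+* A) : AddCommGroup (FrobeniusPush F) := inferInstanceAs (AddCommGroup A)

instance (F : A →+* A) : Module A (FrobeniusPush F) := Module.compHom A F

/-- The `q`-power map is additive, and finite. -/
structure FrobeniusFinite (q : ℕ) (A : Type u) [CommRing A] : Prop where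
  two_le : 2 ≤ q
  add_pow : ∀ x y : A, (x + y) ^ q = x ^ q + y ^ q
  exists_generators : ∃ (n : ℕ) (g : Fin n → A), ∀ a, ∃ c : Fin n → A, a = ∑ i, c i ^ q * g i

variable {q : ℕ}

theorem FrobeniusFinite.quotient (h : FrobeniusFinite q A) (I : Ideal A) :
    FrobeniusFinite q (A ⧸ I) where
  two_le := h.two_le
  add_pow x y := by
    obtain ⟨x, rfl⟩ := Ideal.Quotient.mk_surjective x
    obtain ⟨y, rfl⟩ := Ideal.Quotient.mk_surjective y
    rw [← map_add, ← map_pow, h.add_pow, map_add, map_pow, map_pow]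
  exists_generators := by
    obtain ⟨n, g, hg⟩ := h.exists_generators
    refine ⟨n, fun i => Ideal.Quotient.mk I (g i), fun a => ?_⟩
    obtain ⟨a, rfl⟩ := Ideal.Quotient.mk_surjective a
    obtain ⟨c, hc⟩ := hg a
    refine ⟨fun i => Ideal.Quotient.mk I (c i), ?_⟩
    rw [hc, map_sum]
    simp

/-- The `q`-power map as a ring endomorphism. -/
def FrobeniusFinite.ringHom (h : FrobeniusFinite q A) : A →+* A where
  toFun x := x ^ q
  map_one' := one_pow q
  map_mul' x y := mul_pow x y q
  map_zero' := zero_pow (by have := h.two_le; lia)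
  map_add' := h.add_pow

/-- A generic basis of `A` over its `q`-th powers: a maximal independent family in `A`, viewed as a
finite module over itself through the `q`-power map. The factor `c ^ q` is the scalar `c` acting
through that map. -/
theorem FrobeniusFinite.exists_independent [IsDomain A] [IsNoetherianRing A]
    (h : FrobeniusFinite q A) :
    ∃ (d : ℕ) (e : Fin d → A), (∀ x : Fin d → A, ∑ i, x i ^ q * e i = 0 → ∀ i, x i = 0) ∧
      ∃ c : A, c ≠ 0 ∧ ∀ a, ∃ y : Fin d → A, c ^ q * a = ∑ i, y i ^ q * e i := by
  have : Module.Finite A (FrobeniusPush h.ringHom) := by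
    obtain ⟨n, g, hg⟩ := h.exists_generators
    refine Module.Finite.of_surjective (Fintype.linearCombination A
      (fun i => (show FrobeniusPush h.ringHom from g i))) fun a => ?_
    obtain ⟨c, hc⟩ := hg a
    exact ⟨c, hc.symm⟩
  obtain ⟨_, v, hv, -, c, hc, hcv⟩ := exists_linearIndependent_smul_mem_span (A := A)
    (FrobeniusPush h.ringHom)
  refine ⟨_, v, fun x hx => Fintype.linearIndependent_iff.1 hv x hx, c, hc, fun a => ?_⟩
  obtain ⟨y, hy⟩ := (Submodule.mem_span_range_iff_exists_fun A).1 (hcv a)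
  exact ⟨y, hy.symm⟩

variable {M : Type v} [AddCommGroup M] [Module A M] {C : M →+ M}
  (hC : ∀ (r : A) m, C (r ^ q • m) = r • C m)

-- A dual basis up to a denominator: `m' ↦ (C (e j • m'))_j` is injective by nondegeneracy, and its
-- image `T` in `Fin d → M` has full rank, so one `c` carries every vector into `T`.
include hC in
theorem exists_dual_vectors [IsDomain A] [IsNoetherianRing A] [Module.Finite A M]
    (htf : ∀ (a : A) (m : M), a • m = 0 → a = 0 ∨ m = 0)
    (hnd : ∀ m, (∀ r : A, C (r • m) = 0) → m = 0) {d : ℕ} {e : Fin d → A}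
    (he : ∀ x : Fin d → A, ∑ i, x i ^ q * e i = 0 → ∀ i, x i = 0) {c₀ : A} (hc₀ : c₀ ≠ 0)
    (hc : ∀ a, ∃ y : Fin d → A, c₀ ^ q * a = ∑ i, y i ^ q * e i) :
    ∃ c : A, c ≠ 0 ∧ ∀ (i : Fin d) (m : M), ∃ m', ∀ j, C (e j • m') = if j = i then c • m else 0 := by
  let T : Submodule A (Fin d → M) :=
    { carrier := Set.range fun m' j => C (e j • m')
      zero_mem' := ⟨0, by ext; simp⟩
      add_mem' := by
        rintro _ _ ⟨a, rfl⟩ ⟨b, rfl⟩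
        exact ⟨a + b, by ext; simp⟩
      smul_mem' := by
        rintro r _ ⟨a, rfl⟩
        exact ⟨r ^ q • a, by ext j; simp [smul_comm (e j), hC]⟩ }
  have hinj : ∀ m', (∀ j, C (e j • m') = 0) → m' = 0 := by
    refine fun m' h => hnd m' fun r => ?_
    refine (htf c₀ _ ?_).resolve_left hc₀
    obtain ⟨y, hy⟩ := hc r
    rw [← hC, smul_smul, hy, Finset.sum_smul, map_sum]
    refine Finset.sum_eq_zero fun i _ => ?_
    rw [mul_smul, hC, h, smul_zero]
  obtain ⟨n, v, hv, -, c₁, hc₁, hcv⟩ := exists_linearIndependent_smul_mem_span (A := A) M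
  have h1 : Module.finrank A (Fin d → M) ≤ d * n := by
    let φ : M →ₗ[A] Fin n →₀ A :=
      hv.repr ∘ₗ (LinearMap.lsmul A M c₁).codRestrict _ hcv
    have hφ : Function.Injective φ := by
      rw [← LinearMap.ker_eq_bot, LinearMap.ker_comp, hv.repr_ker, Submodule.comap_bot,
        LinearMap.ker_eq_bot']
      intro m hm
      exact (htf c₁ m (congrArg Subtype.val hm)).resolve_left hc₁
    have := LinearMap.finrank_le_finrank_of_injective (f := φ.compLeft (Fin d))
      (fun a b hab => funext fun i => hφ (congrFun hab i))
    refine this.trans (le_of_eq ?_)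
    rw [Module.finrank_pi_fintype]
    simp
  -- The images of the `e i • v k` are independent: coefficients `g` pull back to `g ^ q` before
  -- `C`, and then the independence of `v` and that of `e` apply in turn.
  have h2 : d * n ≤ Module.finrank A T := by
    let w : Fin d × Fin n → T := fun p => ⟨fun j => C (e j • e p.1 • v p.2), _, rfl⟩
    have hw : LinearIndependent A w := by
      rw [Fintype.linearIndependent_iff]
      intro g hg p
      have h3 : ∑ p : Fin d × Fin n, g p ^ q • e p.1 • v p.2 = 0 := by
        refine hinj _ fun j => ?_
        have := congrFun (congrArg Subtype.val hg) j
        rw [Submodule.coe_sum, Finset.sum_apply] at this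
        rw [Finset.smul_sum, map_sum, ← show (0 : M) = _ from rfl]
        refine (Finset.sum_congr rfl fun p _ => ?_).trans this
        rw [smul_comm (e j), hC]
        rfl
      rw [Fintype.sum_prod_type_right] at h3
      have h4 := Fintype.linearIndependent_iff.1 hv (fun k => ∑ i, g (i, k) ^ q * e i) (by
        rw [← h3]
        refine Finset.sum_congr rfl fun k _ => ?_
        rw [Finset.sum_smul]
        simp [mul_smul]) p.2
      exact he _ h4 p.1
    simpa using hw.fintype_card_le_finrank
  obtain ⟨c, hc, h3⟩ := exists_smul_mem_of_finrank_eq (le_top : T ≤ ⊤)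
    (le_antisymm (Submodule.finrank_mono le_top) (by rw [finrank_top]; exact h1.trans h2))
  refine ⟨c, hc, fun i m => ?_⟩
  obtain ⟨m', hm'⟩ := h3 (Pi.single i m) trivial
  refine ⟨m', fun j => (congrFun hm' j).trans ?_⟩
  rw [Pi.smul_apply, Pi.single_apply]
  split_ifs <;> simp

/-- Cayley–Hamilton for multiplication by `t` on `J`: a monic polynomial with lower coefficients in
`J` kills `t` on `J`, hence kills `t` itself in a domain, so its leading power lies in `J`. -/
theorem exists_pow_mem_of_smul_le_sq [IsDomain A] [IsNoetherianRing A] {J : Ideal A} (hJ : J ≠ ⊥)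
    {t : A} (h : ∀ a ∈ J, t * a ∈ J * J) : ∃ k, t ^ k ∈ J := by
  obtain ⟨p, hp, -, hp1, hp2⟩ :=
    LinearMap.exists_monic_and_natDegree_eq_and_coeff_mem_pow_and_aeval_eq_zero
      A (algebraMap A (Module.End A J) t) J (by
        rintro _ ⟨a, rfl⟩
        rw [Submodule.mem_smul_top_iff]
        exact h a a.2)
  obtain ⟨j, hj, hj0⟩ := Submodule.exists_mem_ne_zero_of_ne_bot hJ
  rw [Polynomial.aeval_algebraMap_apply_eq_algebraMap_eval] at hp2
  have h1 : p.eval t * j = 0 := congrArg Subtype.val (congr($hp2 ⟨j, hj⟩))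
  have h2 := (mul_eq_zero.1 h1).resolve_right hj0
  rw [Polynomial.eval_eq_sum_range, Finset.sum_range_succ, hp.coeff_natDegree, one_mul] at h2
  refine ⟨p.natDegree, ?_⟩
  rw [← add_eq_zero_iff_neg_eq.1 h2]
  refine J.neg_mem (Ideal.sum_mem _ fun k hk => J.mul_mem_right _ ?_)
  refine Ideal.pow_le_self ?_ (hp1 k)
  have := Finset.mem_range.1 hk
  lia

-- The constant comes from the dual vectors and the generic basis alone, so it does not depend on
-- `N`. With `J = (N : M)`, evaluating `C` on `a • m'` for dual vectors `m'` shows that the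
-- coordinates of `c₀ ^ q * a` lie in `J` after multiplication by `c`.
include hC in
theorem exists_smul_mem_of_generically_eq [IsDomain A] [IsNoetherianRing A] [Module.Finite A M]
    (hF : FrobeniusFinite q A)
    (htf : ∀ (a : A) (m : M), a • m = 0 → a = 0 ∨ m = 0)
    (hnd : ∀ m, (∀ r : A, C (r • m) = 0) → m = 0) (hs : Function.Surjective C) :
    ∃ c : A, c ≠ 0 ∧ ∀ N : Submodule A M, (∀ m ∈ N, C m ∈ N) → (∃ a : A, a ≠ 0 ∧ ∀ m, a • m ∈ N) →
      ∀ m, c • m ∈ N := by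
  obtain ⟨d, e, he, c₀, hc₀, h0⟩ := hF.exists_independent
  obtain ⟨c, hc, h1⟩ := exists_dual_vectors hC htf hnd he hc₀ h0
  refine ⟨c * c₀, mul_ne_zero hc hc₀, fun N hN ⟨a₀, ha₀, haN⟩ => ?_⟩
  let J : Ideal A := N.colon Set.univ
  have memJ (a : A) : a ∈ J ↔ ∀ m, a • m ∈ N := by simp [J, Submodule.mem_colon]
  have hJ : ∀ a ∈ J, (c * c₀) ^ q * a ∈ J * J := by
    intro a ha
    obtain ⟨y, hy⟩ := h0 a
    have h2 : ∀ i, c * y i ∈ J := by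
      refine fun i => (memJ _).2 fun m => ?_
      obtain ⟨m', hm'⟩ := h1 i m
      have h3 : c₀ • C (a • m') = (c * y i) • m := by
        rw [← hC, smul_smul, hy, Finset.sum_smul, map_sum]
        simp only [mul_smul, hC, hm']
        simp [smul_smul, mul_comm]
      rw [← h3]
      exact N.smul_mem _ (hN _ ((memJ a).1 ha m'))
    -- Since `q ≥ 2`, each `(c * y i) ^ q` has two factors in `J`; this gives membership in `J * J`.
    rw [mul_pow, mul_assoc, hy, Finset.mul_sum]
    refine Ideal.sum_mem _ fun i _ => ?_
    obtain ⟨k, rfl⟩ := Nat.exists_eq_add_of_le hF.two_le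
    have : c ^ (2 + k) * (y i ^ (2 + k) * e i) =
      ((c * y i) * (c * y i)) * (c ^ k * y i ^ k * e i) := by ring
    rw [this]
    exact Ideal.mul_mem_right _ _ (Ideal.mul_mem_mul (h2 i) (h2 i))
  obtain ⟨k, hk⟩ := exists_pow_mem_of_smul_le_sq
    (fun h => ha₀ (by simpa [h] using (memJ a₀).2 haN)) hJ
  rw [← pow_mul] at hk
  intro m
  -- The exponent `k` depends on `N`. Writing `m` as a value of `C ^ (q * k)` turns `c * c₀` into
  -- its power of exponent `q ^ (q * k) ≥ q * k`, which lies in `J`.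
  obtain ⟨m', rfl⟩ := hs.iterate (q * k) m
  rw [← iterate_pow_smul hC]
  refine iterate_map_mem hN _ ((memJ _).1 ?_ m')
  exact J.pow_mem_of_pow_mem hk (Nat.lt_pow_self hF.two_le).le

end Domain

/-! ### Stable submodules and their quotients -/

section Restrict

variable {R : Type u} [CommRing R] {M : Type v} [AddCommGroup M] [Module R M]

/-- The restriction of an additive endomorphism to a stable submodule. -/
def restrictStable (C : M →+ M) (B : Submodule R M) (hB : ∀ m ∈ B, C m ∈ B) : B →+ B where
  toFun m := ⟨C m, hB m m.2⟩
  map_zero' := Subtype.ext (map_zero C : C (0 : M) = 0)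
  map_add' a b := Subtype.ext (map_add C (a : M) b)

theorem coe_restrictStable_iterate (C : M →+ M) (B : Submodule R M) (hB : ∀ m ∈ B, C m ∈ B)
    (e : ℕ) (m : B) : ((restrictStable C B hB)^[e] m : M) = C^[e] m := by
  induction e with
  | zero => rfl
  | succ e ih =>
    rw [Function.iterate_succ_apply', Function.iterate_succ_apply', ← ih]
    rfl

/-- The endomorphism of the quotient by a stable submodule. -/
def quotientStable (C : M →+ M) (B : Submodule R M) (hB : ∀ m ∈ B, C m ∈ B) : M ⧸ B →+ M ⧸ B :=
  QuotientAddGroup.map B.toAddSubgroup B.toAddSubgroup C hB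

theorem quotientStable_mk (C : M →+ M) (B : Submodule R M) (hB : ∀ m ∈ B, C m ∈ B) (m : M) :
    quotientStable C B hB (B.mkQ m) = B.mkQ (C m) := rfl

theorem quotientStable_iterate_mk (C : M →+ M) (B : Submodule R M) (hB : ∀ m ∈ B, C m ∈ B)
    (e : ℕ) (m : M) : (quotientStable C B hB)^[e] (B.mkQ m) = B.mkQ (C^[e] m) := by
  induction e with
  | zero => rfl
  | succ e ih => rw [Function.iterate_succ_apply', Function.iterate_succ_apply', ih,
      quotientStable_mk]

end Restrict

/-! ### Minimal stable submodules in the torsion-free nondegenerate case -/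

section Smallest

variable {A : Type u} [CommRing A] {q : ℕ} {M : Type v} [AddCommGroup M] [Module A M] {C : M →+ M}

theorem eq_bot_of_iterate_eq_zero (hC : ∀ (r : A) m, C (r ^ q • m) = r • C m)
    (hnd : ∀ m, (∀ r : A, C (r • m) = 0) → m = 0) {B : Submodule A M} (e : ℕ)
    (h : ∀ m ∈ B, C^[e] m = 0) : B = ⊥ := by
  induction e with
  | zero => exact (Submodule.eq_bot_iff B).2 h
  | succ e ih =>
    refine ih fun m hm => hnd _ fun r => ?_
    rw [← iterate_pow_smul hC, ← Function.iterate_succ_apply' C]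
    exact h _ (B.smul_mem _ hm)

/-- Inside the stable image of a nonzero stable submodule of least rank, all nonzero stable
submodules have the same rank. The uniform denominator then keeps their intersection from vanishing,
and this intersection is minimal. -/
theorem exists_minimal_stable [IsDomain A] [IsNoetherianRing A] [Module.Finite A M]
    (hC : ∀ (r : A) m, C (r ^ q • m) = r • C m) (hF : FrobeniusFinite q A)
    (htf : ∀ (a : A) (m : M), a • m = 0 → a = 0 ∨ m = 0)
    (hnd : ∀ m, (∀ r : A, C (r • m) = 0) → m = 0) (hM : (⊤ : Submodule A M) ≠ ⊥) :
    ∃ B : Submodule A M, (∀ m ∈ B, C m ∈ B) ∧ B ≠ ⊥ ∧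
      ∀ N : Submodule A M, (∀ m ∈ N, C m ∈ N) → N ≠ ⊥ → N ≤ B → N = B := by
  classical
  have hex : ∃ n, ∃ B : Submodule A M, (∀ m ∈ B, C m ∈ B) ∧ B ≠ ⊥ ∧ Module.finrank A B = n :=
    ⟨_, ⊤, fun _ _ => trivial, hM, rfl⟩
  obtain ⟨B, hB, hB0, hBn⟩ := Nat.find_spec hex
  have hmin (N : Submodule A M) (hN : ∀ m ∈ N, C m ∈ N) (hN0 : N ≠ ⊥) :
      Nat.find hex ≤ Module.finrank A N := Nat.find_min' hex ⟨N, hN, hN0, rfl⟩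
  rw [← hBn] at hmin
  have hCB : ∀ (r : A) m, restrictStable C B hB (r ^ q • m) = r • restrictStable C B hB m :=
    fun r m => Subtype.ext (hC r m)
  obtain ⟨e, he⟩ := iterateRange_stabilizes hCB hF.two_le
  -- The stable image of `B`: here `C` is surjective, as the uniform denominator requires, and
  -- nondegeneracy keeps it nonzero.
  set B₀ : Submodule A M := (iterateRange hCB e).map B.subtype with hB₀
  have mem₀ (m : M) : m ∈ B₀ ↔ ∃ b ∈ B, C^[e] b = m := by
    constructor
    · rintro ⟨_, ⟨b, rfl⟩, rfl⟩
      exact ⟨b, b.2, (coe_restrictStable_iterate C B hB e b).symm⟩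
    · rintro ⟨b, hb, rfl⟩
      exact ⟨_, ⟨⟨b, hb⟩, rfl⟩, coe_restrictStable_iterate C B hB e ⟨b, hb⟩⟩
  have hs₀ : ∀ m ∈ B₀, C m ∈ B₀ := by
    intro m hm
    obtain ⟨b, hb, rfl⟩ := (mem₀ m).1 hm
    exact (mem₀ _).2 ⟨C b, hB b hb, by
      rw [← Function.iterate_succ_apply C, Function.iterate_succ_apply' C]⟩
  have hsurj : Function.Surjective (restrictStable C B₀ hs₀) := by
    rintro ⟨m, hm⟩
    have hm' := hm
    obtain ⟨_, hx, rfl⟩ := hm'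
    obtain ⟨b, hb⟩ := he (e + 1) hx
    refine ⟨⟨C^[e] b, (mem₀ _).2 ⟨b, b.2, rfl⟩⟩, Subtype.ext ?_⟩
    change C (C^[e] b) = _
    rw [← Function.iterate_succ_apply' C, ← coe_restrictStable_iterate C B hB, hb]
    rfl
  have h₀ : B₀ ≠ ⊥ := fun h => hB0 <| eq_bot_of_iterate_eq_zero hC hnd e fun m hm =>
    (Submodule.mem_bot A).1 (h ▸ (mem₀ _).2 ⟨m, hm, rfl⟩)
  have hle : B₀ ≤ B := Submodule.map_subtype_le _ _
  obtain ⟨c, hc, hcN⟩ := exists_smul_mem_of_generically_eq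
    (C := restrictStable C B₀ hs₀) (fun r m => Subtype.ext (hC r m)) hF
    (fun a m h => (htf a m (congrArg Subtype.val h)).imp_right Subtype.ext)
    (fun m h => Subtype.ext (hnd m fun r => congrArg Subtype.val (h r))) hsurj
  have key (N : Submodule A M) (hN : ∀ m ∈ N, C m ∈ N) (hN0 : N ≠ ⊥) (hNB : N ≤ B₀) :
      ∀ m ∈ B₀, c • m ∈ N := by
    obtain ⟨a, ha, h1⟩ := exists_smul_mem_of_finrank_eq hNB
      ((Submodule.finrank_mono hNB).antisymm ((Submodule.finrank_mono hle).trans (hmin N hN hN0)))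
    exact fun m hm => hcN (N.comap B₀.subtype) (fun m hm => hN _ hm) ⟨a, ha, fun m => h1 m m.2⟩
      ⟨m, hm⟩
  refine ⟨sInf {N | (∀ m ∈ N, C m ∈ N) ∧ N ≠ ⊥ ∧ N ≤ B₀}, fun m hm => ?_, fun h => ?_,
    fun N hN hN0 hNB => le_antisymm hNB (sInf_le ⟨hN, hN0, hNB.trans (sInf_le ⟨hs₀, h₀, le_rfl⟩)⟩)⟩
  · rw [Submodule.mem_sInf] at hm ⊢
    exact fun N hN => hN.1 _ (hm N hN)
  · obtain ⟨m, hm, hm0⟩ := Submodule.exists_mem_ne_zero_of_ne_bot h₀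
    refine (htf c m ?_).elim hc hm0
    rw [← Submodule.mem_bot A, ← h, Submodule.mem_sInf]
    exact fun N hN => key N hN.1 hN.2.1 hN.2.2 m hm

end Smallest

/-! ### Finite length up to nilpotence over a ring -/

section NilLength

variable {R : Type u} [CommRing R] {q : ℕ} {M : Type v} [AddCommGroup M] [Module R M] {C : M →+ M}

/-- The interval `[A, B]` of stable submodules has finite length up to nilpotence: there is a
monotone function on it with values in `ℕ` that only identifies submodules with nilpotent
quotient. -/
def HasNilLength (C : M →+ M) (A B : Submodule R M) : Prop :=
  ∃ d : Submodule R M → ℕ, ∀ N₁ N₂ : Submodule R M, (∀ m ∈ N₁, C m ∈ N₁) → (∀ m ∈ N₂, C m ∈ N₂) →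
    A ≤ N₁ → N₁ ≤ N₂ → N₂ ≤ B → d N₁ ≤ d N₂ ∧ (d N₁ = d N₂ → ∃ e, ∀ m ∈ N₂, C^[e] m ∈ N₁)

/-- The length function is the sum of those of `N ⊓ B` and `N ⊔ B`. If both are unchanged, a power
of `C` moves `N₂` into `N₁ + B`, and a second power moves the part in `B`, which lies in `N₂ ⊓ B`,
into `N₁`. -/
theorem HasNilLength.trans {A B D : Submodule R M} (hB : ∀ m ∈ B, C m ∈ B) (hAB : A ≤ B)
    (hBD : B ≤ D) (h₁ : HasNilLength C A B) (h₂ : HasNilLength C B D) : HasNilLength C A D := by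
  obtain ⟨d₁, h₁⟩ := h₁
  obtain ⟨d₂, h₂⟩ := h₂
  have hinf (N : Submodule R M) (hN : ∀ m ∈ N, C m ∈ N) : ∀ m ∈ N ⊓ B, C m ∈ N ⊓ B :=
    fun m hm => ⟨hN m hm.1, hB m hm.2⟩
  have hsup (N : Submodule R M) (hN : ∀ m ∈ N, C m ∈ N) : ∀ m ∈ N ⊔ B, C m ∈ N ⊔ B := by
    intro m hm
    obtain ⟨a, ha, b, hb, rfl⟩ := Submodule.mem_sup.1 hm
    rw [map_add]
    exact Submodule.add_mem_sup (hN a ha) (hB b hb)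
  refine ⟨fun N => d₁ (N ⊓ B) + d₂ (N ⊔ B), fun N₁ N₂ hN₁ hN₂ hA h12 hD => ?_⟩
  obtain ⟨ha, ha'⟩ := h₁ _ _ (hinf N₁ hN₁) (hinf N₂ hN₂) (le_inf hA hAB)
    (inf_le_inf_right B h12) inf_le_right
  obtain ⟨hb, hb'⟩ := h₂ _ _ (hsup N₁ hN₁) (hsup N₂ hN₂) le_sup_right
    (sup_le_sup_right h12 B) (sup_le hD hBD)
  refine ⟨add_le_add ha hb, fun h => ?_⟩
  obtain ⟨e, he⟩ := ha' (by lia)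
  obtain ⟨e', he'⟩ := hb' (by lia)
  refine ⟨e + e', fun m hm => ?_⟩
  rw [Function.iterate_add_apply]
  obtain ⟨x, hx, y, hy, h3⟩ := Submodule.mem_sup.1 (he' m (Submodule.mem_sup_left hm))
  rw [← h3, iterate_map_add]
  refine N₁.add_mem (iterate_map_mem hN₁ e hx) (he y ⟨?_, hy⟩).1
  rw [← add_sub_cancel_left x y, h3]
  exact N₂.sub_mem (iterate_map_mem hN₂ e' hm) (h12 hx)

theorem HasNilLength.of_quotient {A : Submodule R M} (hA : ∀ m ∈ A, C m ∈ A)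
    {B : Submodule R (M ⧸ A)} (h : HasNilLength (quotientStable C A hA) ⊥ B) :
    HasNilLength C A (B.comap A.mkQ) := by
  obtain ⟨d, h⟩ := h
  have hst (N : Submodule R M) (hN : ∀ m ∈ N, C m ∈ N) :
      ∀ m ∈ N.map A.mkQ, quotientStable C A hA m ∈ N.map A.mkQ := by
    rintro _ ⟨m, hm, rfl⟩
    exact ⟨C m, hN m hm, rfl⟩
  refine ⟨fun N => d (N.map A.mkQ), fun N₁ N₂ hN₁ hN₂ hA1 h12 hB => ?_⟩
  obtain ⟨h1, h2⟩ := h _ _ (hst N₁ hN₁) (hst N₂ hN₂) bot_le (Submodule.map_mono h12)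
    (Submodule.map_le_iff_le_comap.2 hB)
  refine ⟨h1, fun h3 => ?_⟩
  obtain ⟨e, he⟩ := h2 h3
  refine ⟨e, fun m hm => ?_⟩
  obtain ⟨m', hm', h4⟩ := he _ ⟨m, hm, rfl⟩
  rw [quotientStable_iterate_mk, Submodule.mkQ_apply, Submodule.mkQ_apply,
    Submodule.Quotient.eq] at h4
  rw [← sub_sub_cancel m' (C^[e] m)]
  exact N₁.sub_mem hm' (hA1 h4)

theorem HasNilLength.of_restrict {B : Submodule R M} (hB : ∀ m ∈ B, C m ∈ B)
    (h : HasNilLength (R := R) (restrictStable C B hB) ⊥ ⊤) : HasNilLength C ⊥ B := by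
  obtain ⟨d, h⟩ := h
  refine ⟨fun N => d (N.comap B.subtype), fun N₁ N₂ hN₁ hN₂ _ h12 hNB => ?_⟩
  obtain ⟨h1, h2⟩ := h _ _ (fun m hm => hN₁ _ hm) (fun m hm => hN₂ _ hm) bot_le
    (Submodule.comap_mono (f := B.subtype) h12) le_top
  refine ⟨h1, fun h3 => ?_⟩
  obtain ⟨e, he⟩ := h2 h3
  refine ⟨e, fun m hm => ?_⟩
  have := he ⟨m, hNB hm⟩ hm
  rwa [Submodule.mem_comap, Submodule.subtype_apply, coe_restrictStable_iterate] at this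

variable [IsNoetherianRing R] [Module.Finite R M]

theorem exists_minimal_stable_of_isPrime (hC : ∀ (r : R) m, C (r ^ q • m) = r • C m)
    (hF : FrobeniusFinite q R) (I : Ideal R) [I.IsPrime] (hI : ∀ a ∈ I, ∀ m : M, a • m = 0)
    (htf : ∀ a ∉ I, ∀ m : M, a • m = 0 → m = 0)
    (hnd : ∀ m, (∀ r : R, C (r • m) = 0) → m = 0) (hM : (⊤ : Submodule R M) ≠ ⊥) :
    ∃ B : Submodule R M, (∀ m ∈ B, C m ∈ B) ∧ B ≠ ⊥ ∧
      ∀ N : Submodule R M, (∀ m ∈ N, C m ∈ N) → N ≠ ⊥ → N ≤ B → N = B := by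
  have hT : Module.IsTorsionBySet R M I := fun m a => hI a a.2 m
  let := hT.module
  have hs : IsScalarTower R (R ⧸ I) M := hT.isScalarTower
  have : Module.Finite (R ⧸ I) M := Module.Finite.of_restrictScalars_finite R _ _
  have hbot : (⊤ : Submodule (R ⧸ I) M) ≠ ⊥ := by
    intro h
    refine hM ((Submodule.eq_bot_iff _).2 fun m _ => ?_)
    exact (Submodule.mem_bot (R ⧸ I)).1 (h ▸ (Submodule.mem_top : m ∈ (⊤ : Submodule (R ⧸ I) M)))
  obtain ⟨B, hB, hB0, hmin⟩ := exists_minimal_stable (A := R ⧸ I) (M := M) (C := C)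
    (fun r m => by
      obtain ⟨r, rfl⟩ := Ideal.Quotient.mk_surjective r
      exact hC r m) (hF.quotient I)
    (fun a m h => by
      obtain ⟨a, rfl⟩ := Ideal.Quotient.mk_surjective a
      by_cases ha : a ∈ I
      · exact Or.inl (Ideal.Quotient.eq_zero_iff_mem.2 ha)
      · exact Or.inr (htf a ha m h))
    (fun m h => hnd m fun r => h (Ideal.Quotient.mk I r)) hbot
  refine ⟨B.restrictScalars R, hB, by simpa using hB0, fun N hN hN0 hNB => ?_⟩
  let N' : Submodule (R ⧸ I) M :=
    { N with
      smul_mem' := by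
        intro a m hm
        obtain ⟨a, rfl⟩ := Ideal.Quotient.mk_surjective a
        exact N.smul_mem a hm }
  have h1 : N'.restrictScalars R = N := rfl
  have h2 : N' = B := hmin N' hN (fun h => hN0 (by rw [← h1, h]; rfl)) hNB
  rw [← h1, h2]

/-- Over an `F`-finite Noetherian ring, finite modules with a `q⁻¹`-linear endomorphism have finite
length up to nilpotence. -/
theorem hasNilLength_of_annihilated (hF : FrobeniusFinite q R) (I : Ideal R) :
    ∀ (M : Type v) [AddCommGroup M] [Module R M] [Module.Finite R M] (C : M →+ M),
      (∀ (r : R) m, C (r ^ q • m) = r • C m) → (∀ a ∈ I, ∀ m : M, a • m = 0) →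
      HasNilLength (R := R) C ⊥ ⊤ := by
  induction I using WellFoundedGT.induction with
  | ind I ih =>
  intro M _ _ _ C hC hI
  have hlt {a : R} (ha : a ∉ I) : I < I ⊔ Ideal.span {a} := by
    refine lt_of_le_of_ne le_sup_left fun h => ha ?_
    rw [h]
    exact Ideal.mem_sup_right (Ideal.mem_span_singleton_self _)
  have hq : q ≠ 0 := by have := hF.two_le; lia
  -- modules killed by `I` and `a`
  have ih' (a : R) (ha : a ∉ I) (M : Type v) [AddCommGroup M] [Module R M] [Module.Finite R M]
      (C : M →+ M) (hC : ∀ (r : R) m, C (r ^ q • m) = r • C m) (hI : ∀ a ∈ I, ∀ m : M, a • m = 0)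
      (hM : ∀ m : M, a • m = 0) : HasNilLength (R := R) C ⊥ ⊤ := by
    refine ih _ (hlt ha) M C hC fun x hx m => ?_
    obtain ⟨i, hi, j, hj, rfl⟩ := Submodule.mem_sup.1 hx
    obtain ⟨r, rfl⟩ := Ideal.mem_span_singleton'.1 hj
    rw [add_smul, mul_smul, hM, smul_zero, hI i hi, add_zero]
  have stabT (M : Type v) [AddCommGroup M] [Module R M] (C : M →+ M)
      (hC : ∀ (r : R) m, C (r ^ q • m) = r • C m) (a : R) :
      ∀ m ∈ LinearMap.ker (LinearMap.lsmul R M a), C m ∈ LinearMap.ker (LinearMap.lsmul R M a) :=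
    fun m hm => (Submodule.mem_bot R).1 <| map_mem_torsionBy_mod (W := ⊥) hC hq
      (by simp) a ((Submodule.mem_bot R).2 hm)
  by_cases htop : I = ⊤
  · have h0 (m : M) : m = 0 := by
      rw [← one_smul R m]
      exact hI 1 (htop ▸ Submodule.mem_top) m
    exact ⟨fun _ => 0, fun N₁ N₂ _ _ _ _ _ => ⟨le_rfl, fun _ => ⟨0, fun m _ => h0 m ▸ N₁.zero_mem⟩⟩⟩
  by_cases hprime : I.IsPrime
  swap
  -- The kernel of `a` is killed by `a`, and the quotient by it is killed by `b`, because `a * b ∈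
  -- I`; both are covered by larger ideals.
  · obtain ⟨a, ha, b, hb, hab⟩ : ∃ a ∉ I, ∃ b ∉ I, a * b ∈ I := by
      by_contra! H
      exact hprime ⟨htop, fun {x y} hxy => or_iff_not_imp_left.2 fun hx => by
        by_contra hy; exact H x hx y hy hxy⟩
    have hB := stabT M C hC a
    set B := LinearMap.ker (LinearMap.lsmul R M a) with hBdef
    refine HasNilLength.trans hB bot_le le_top (.of_restrict hB ?_)
      (Submodule.comap_top (f := B.mkQ) ▸ HasNilLength.of_quotient hB ?_)
    · exact ih' a ha B _ (fun r m => Subtype.ext (hC r m)) (fun a ha m => Subtype.ext (hI a ha m))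
        fun m => Subtype.ext m.2
    · refine ih' b hb (M ⧸ B) _ (fun r m => ?_) (fun a ha m => ?_) fun m => ?_ <;>
        obtain ⟨m, rfl⟩ := B.mkQ_surjective m
      · rw [← map_smul, quotientStable_mk, hC, map_smul]
        rfl
      · rw [← map_smul, hI a ha, map_zero]
      · rw [← map_smul, Submodule.mkQ_apply, Submodule.Quotient.mk_eq_zero]
        change a • b • m = 0
        rw [smul_smul, hI _ hab]
  -- every nonzero module contains a nonzero piece of finite length
  have step (M : Type v) [AddCommGroup M] [Module R M] [Module.Finite R M]
      (C : M →+ M) (hC : ∀ (r : R) m, C (r ^ q • m) = r • C m) (hI : ∀ a ∈ I, ∀ m : M, a • m = 0)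
      (hM : (⊤ : Submodule R M) ≠ ⊥) :
      ∃ B : Submodule R M, (∀ m ∈ B, C m ∈ B) ∧ B ≠ ⊥ ∧ HasNilLength C ⊥ B := by
    by_cases htf : ∀ a ∉ I, ∀ m : M, a • m = 0 → m = 0
    swap
    · push Not at htf
      obtain ⟨a, ha, m, hm, hm0⟩ := htf
      have hB := stabT M C hC a
      refine ⟨LinearMap.ker (LinearMap.lsmul R M a), hB, fun h => hm0 ?_, .of_restrict hB
        (ih' a ha _ _ (fun r m => Subtype.ext (hC r m)) (fun a ha m => Subtype.ext (hI a ha m))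
        fun m => Subtype.ext m.2)⟩
      rw [← Submodule.mem_bot R, ← h]
      exact hm
    by_cases hnd : ∀ m, (∀ r : R, C (r • m) = 0) → m = 0
    swap
    · push Not at hnd
      obtain ⟨m, hm, hm0⟩ := hnd
      -- The largest submodule killed by `C`. On it every quotient is nilpotent, so the zero
      -- function is a length.
      refine ⟨{ carrier := {m | ∀ r : R, C (r • m) = 0}
                zero_mem' := by simp
                add_mem' := fun {a b} ha hb r => by rw [smul_add, map_add, ha, hb, add_zero]
                smul_mem' := fun c m hm r => by rw [smul_smul]; exact hm _ }, ?_, ?_, fun _ => 0,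
        fun N₁ N₂ _ _ _ _ h => ⟨le_rfl, fun _ => ⟨1, fun m hm => ?_⟩⟩⟩
      · intro m hm r
        rw [← one_smul R m, hm, smul_zero, map_zero]
      · exact fun h => hm0 ((Submodule.mem_bot R).1 (h ▸ hm))
      · have : C m = 0 := by rw [← one_smul R m]; exact h hm 1
        rw [Function.iterate_one, this]
        exact N₁.zero_mem
    obtain ⟨B, hB, hB0, hmin⟩ := exists_minimal_stable_of_isPrime hC hF I hI htf hnd hM
    classical
    -- By minimality the only stable submodules of `B` are `⊥` and `B`, so lengths `0` and `1`
    -- suffice.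
    refine ⟨B, hB, hB0, fun N => if N = ⊥ then 0 else 1, fun N₁ N₂ hN₁ hN₂ _ h12 hN => ?_⟩
    dsimp only
    by_cases h2 : N₂ = ⊥
    · rw [h2, le_bot_iff] at h12
      rw [h2, h12]
      exact ⟨le_rfl, fun _ => ⟨0, fun m hm => hm⟩⟩
    · by_cases h1 : N₁ = ⊥
      · simp [h1, h2]
      · rw [if_neg h1, if_neg h2, hmin N₁ hN₁ h1 (h12.trans hN), hmin N₂ hN₂ h2 hN]
        exact ⟨le_rfl, fun _ => ⟨0, fun m hm => hm⟩⟩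
  -- A maximal stable submodule of finite length must be everything: otherwise a nonzero piece of
  -- the quotient would enlarge it.
  obtain ⟨A, ⟨hA, hAd⟩, hmax⟩ := WellFounded.has_min (wellFounded_gt (α := Submodule R M))
    {A | (∀ m ∈ A, C m ∈ A) ∧ HasNilLength C ⊥ A} ⟨⊥, by simp, fun _ => 0,
      fun N₁ N₂ _ _ _ _ h => ⟨le_rfl, fun _ => ⟨0, fun m hm => by
        rw [le_bot_iff.1 h, Submodule.mem_bot] at hm
        rw [hm]
        exact N₁.zero_mem⟩⟩⟩
  by_cases hAt : A = ⊤
  · exact hAt ▸ hAd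
  exfalso
  obtain ⟨B, hB, hB0, hBd⟩ := step (M ⧸ A) (quotientStable C A hA) (fun r m => by
      obtain ⟨m, rfl⟩ := A.mkQ_surjective m
      rw [← map_smul, quotientStable_mk, hC, map_smul]
      rfl) (fun a ha m => by
      obtain ⟨m, rfl⟩ := A.mkQ_surjective m
      rw [← map_smul, hI a ha, map_zero]) (fun h => hAt ((Submodule.eq_top_iff').2 fun m => by
        rw [← Submodule.Quotient.mk_eq_zero, ← Submodule.mem_bot R, ← h]
        trivial))
  have hle : A ≤ B.comap A.mkQ := fun m hm => by
    rw [Submodule.mem_comap, Submodule.mkQ_apply, (Submodule.Quotient.mk_eq_zero A).2 hm]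
    exact B.zero_mem
  refine hmax (B.comap A.mkQ) ⟨fun m hm => hB _ hm,
    hAd.trans hA bot_le hle (.of_quotient hA hBd)⟩ (lt_of_le_of_ne hle fun h => hB0 ?_)
  rw [Submodule.eq_bot_iff]
  intro m hm
  obtain ⟨m, rfl⟩ := A.mkQ_surjective m
  rw [Submodule.mkQ_apply, Submodule.Quotient.mk_eq_zero, h]
  exact hm

theorem hasNilLength (hC : ∀ (r : R) m, C (r ^ q • m) = r • C m) (hF : FrobeniusFinite q R) :
    HasNilLength (R := R) C ⊥ ⊤ :=
  hasNilLength_of_annihilated hF ⊥ M C hC (by simp)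

end NilLength

noncomputable section

/-! ### Quasi-coherence as a localization property on affine opens -/

namespace AlgebraicGeometry.Scheme.Modules

variable {X : Scheme.{u}}

/-- A sheaf of modules satisfies the two halves of the localization property on `U` and `f`. -/
structure LocalizesAt (M : X.Modules) (U : X.Opens) (f : Γ(X, U)) : Prop where
  exists_lift (s : Γ(M, X.basicOpen f)) : ∃ (n : ℕ) (t : Γ(M, U)),
    M.presheaf.map (homOfLE (X.basicOpen_le f)).op t =
      X.presheaf.map (homOfLE (X.basicOpen_le f)).op f ^ n • s
  exists_pow_smul_eq_zero (t : Γ(M, U)) :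
    M.presheaf.map (homOfLE (X.basicOpen_le f)).op t = 0 → ∃ n : ℕ, f ^ n • t = 0

theorem smul_restrict_fromSpec (M : X.Modules) {U : X.Opens} (hU : IsAffineOpen U)
    (W : (Spec Γ(X, U)).Opens) (hW : hU.fromSpec ''ᵁ W ≤ U) (r : Γ(X, U))
    (x : Γ(M.restrict hU.fromSpec, W)) :
    (M.restrictAppIso hU.fromSpec W).hom (r • x) =
      X.presheaf.map (homOfLE hW).op r • (M.restrictAppIso hU.fromSpec W).hom x := by
  rw [smul_Spec_def, smul_restrictAppIso_hom_apply]
  congr 1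
  simp_rw [← ConcreteCategory.comp_apply, Category.assoc]
  have : (ΓSpecIso Γ(X, U)).inv ≫ (Spec Γ(X, U)).presheaf.map W.leTop.op ≫
      (hU.fromSpec.appIso W).inv = X.presheaf.map (homOfLE hW).op := by
    rw [← Category.assoc, Iso.comp_inv_eq, Scheme.Hom.appIso_hom', Scheme.Hom.map_appLE,
      Scheme.Hom.appLE, hU.fromSpec_app_self, Category.assoc, ← Functor.map_comp]
    rfl
  exact congr($this r)

/-- Sections of the pullback to the spectrum of an affine open. -/
def restrictFromSpecEquiv (M : X.Modules) {U : X.Opens} (hU : IsAffineOpen U)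
    {W : (Spec Γ(X, U)).Opens} {V : X.Opens} (h : hU.fromSpec ''ᵁ W = V) :
    Γ(M.restrict hU.fromSpec, W) ≃+ Γ(M, V) :=
  (M.restrictAppIso hU.fromSpec W ≪≫
    M.presheaf.mapIso (eqToIso h.symm).op).addCommGroupIsoToAddEquiv

theorem restrictFromSpecEquiv_smul (M : X.Modules) {U : X.Opens} (hU : IsAffineOpen U)
    {W : (Spec Γ(X, U)).Opens} {V : X.Opens} (h : hU.fromSpec ''ᵁ W = V) (hV : V ≤ U)
    (r : Γ(X, U)) (x : Γ(M.restrict hU.fromSpec, W)) :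
    M.restrictFromSpecEquiv hU h (r • x) =
      X.presheaf.map (homOfLE hV).op r • M.restrictFromSpecEquiv hU h x := by
  subst h
  refine (congrArg _ (smul_restrict_fromSpec M hU W hV r x)).trans ?_
  refine (map_smul M (𝟙 _) _ _).trans ?_
  congr 1
  exact congr($(X.presheaf.map_id _) _)

theorem restrictFromSpecEquiv_map (M : X.Modules) {U : X.Opens} (hU : IsAffineOpen U)
    {W W' : (Spec Γ(X, U)).Opens} {V V' : X.Opens} (h : hU.fromSpec ''ᵁ W = V)
    (h' : hU.fromSpec ''ᵁ W' = V') (i : W' ⟶ W) (j : V' ⟶ V)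
    (x : Γ(M.restrict hU.fromSpec, W)) :
    M.restrictFromSpecEquiv hU h' ((M.restrict hU.fromSpec).presheaf.map i.op x) =
      M.presheaf.map j.op (M.restrictFromSpecEquiv hU h x) := by
  subst h h'
  have h1 (V : X.Opens) (y : Γ(M, V)) : M.presheaf.map (𝟙 V).op y = y :=
    congr($(M.presheaf.map_id _) y)
  exact (h1 _ _).trans (congrArg (M.presheaf.map j.op) (h1 _ _)).symm

theorem isLocalizing_iff_forall {R : CommRingCat.{u}} (M : (Spec R).Modules) :
    IsLocalizing (modulesSpecToSheaf.obj M) ↔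
      ∀ (f : R) (D : (Spec R).Opens), D = PrimeSpectrum.basicOpen f →
        IsLocalizedModule.Away f
          (((modulesSpecToSheaf.obj M).obj.map D.leTop.op).hom : Γ(M, ⊤) →ₗ[R] Γ(M, D)) := by
  refine ⟨fun h f D hD => ?_, fun h f => h f _ rfl⟩
  subst hD
  exact h f

/-- After transport along `fromSpec`, lifting and annihilation up to powers of `f` are the two
nontrivial conditions for a localized module; the invertibility of `f` on `D(f)` is automatic. -/
theorem isLocalizing_iff_localizesAt (M : X.Modules) {U : X.Opens} (hU : IsAffineOpen U) :
    IsLocalizing (modulesSpecToSheaf.obj (M.restrict hU.fromSpec)) ↔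
      ∀ f : Γ(X, U), M.LocalizesAt U f := by
  have htop : hU.fromSpec ''ᵁ ⊤ = U := by
    rw [Scheme.Hom.image_top_eq_opensRange, hU.opensRange_fromSpec]
  let e := M.restrictFromSpecEquiv hU htop
  have he (r : Γ(X, U)) (x : Γ(M.restrict hU.fromSpec, ⊤)) : e (r • x) = r • e x := by
    refine (restrictFromSpecEquiv_smul M hU htop le_rfl r x).trans ?_
    congr 1
    exact congr($(X.presheaf.map_id _) r)
  rw [isLocalizing_iff_forall]
  refine forall_congr' fun f => ?_
  obtain ⟨D, hD⟩ : ∃ D : (Spec Γ(X, U)).Opens, D = PrimeSpectrum.basicOpen f := ⟨_, rfl⟩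
  have hD' : hU.fromSpec ''ᵁ D = X.basicOpen f := hD ▸ hU.fromSpec_image_basicOpen f
  let e' := M.restrictFromSpecEquiv hU hD'
  let l : Γ(M.restrict hU.fromSpec, ⊤) →ₗ[Γ(X, U)] Γ(M.restrict hU.fromSpec, D) :=
    ((modulesSpecToSheaf.obj (M.restrict hU.fromSpec)).obj.map D.leTop.op).hom
  have he' (r : Γ(X, U)) (x : Γ(M.restrict hU.fromSpec, D)) :
      e' (r • x) = X.presheaf.map (homOfLE (X.basicOpen_le f)).op r • e' x :=
    restrictFromSpecEquiv_smul M hU hD' (X.basicOpen_le f) r x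
  have hl (x : Γ(M.restrict hU.fromSpec, ⊤)) :
      e' (l x) = M.presheaf.map (homOfLE (X.basicOpen_le f)).op (e x) :=
    restrictFromSpecEquiv_map M hU htop hD' _ _ x
  suffices IsLocalizedModule.Away f l ↔ M.LocalizesAt U f from
    ⟨fun h => this.1 (h D hD), fun h D' hD' => by
      obtain rfl : D = D' := hD.trans hD'.symm
      exact this.2 h⟩
  refine ⟨fun h => ⟨fun s => ?_, fun t ht => ?_⟩, fun h =>
    IsLocalizedModule.Away.mk_of_addCommGroup ?_ (fun x => ?_) fun x hx => ?_⟩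
  · obtain ⟨n, t, ht⟩ := IsLocalizedModule.Away.surj l f (e'.symm s)
    refine ⟨n, e t, ?_⟩
    rw [← hl, ← ht, he', map_pow, AddEquiv.apply_symm_apply]
  · have h1 : l (e.symm t) = 0 := e'.injective (by
      rw [hl, AddEquiv.apply_symm_apply, ht, map_zero])
    obtain ⟨⟨_, n, rfl⟩, hn⟩ := (IsLocalizedModule.eq_zero_iff (.powers f) l).mp h1
    refine ⟨n, ?_⟩
    have := he (f ^ n) (e.symm t)
    rw [AddEquiv.apply_symm_apply] at this
    exact this.symm.trans ((congrArg e hn).trans (map_zero e))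
  · exact isUnit_algebraMap_end_of_le_basicOpen f hD.le
  · obtain ⟨n, t, ht⟩ := h.exists_lift (e' x)
    refine ⟨n, e.symm t, e'.injective ?_⟩
    rw [hl, AddEquiv.apply_symm_apply, ht, he', map_pow]
  · obtain ⟨n, hn⟩ := h.exists_pow_smul_eq_zero (e x) (by rw [← hl, hx, map_zero])
    exact ⟨n, e.injective (by rw [he, hn, map_zero])⟩

theorem localizesAt_of_isQuasicoherent (M : X.Modules) (hM : M.IsQuasicoherent) {U : X.Opens}
    (hU : IsAffineOpen U) (f : Γ(X, U)) : M.LocalizesAt U f :=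
  (M.isLocalizing_iff_localizesAt hU).1
    ((isIso_fromTildeΓ_iff_isLocalizing _).1 inferInstance) f

/-- A sheaf with the localization property on an affine open has a presentation there. -/
def presentationOfLocalizesAt (M : X.Modules) {U : X.Opens} (hU : IsAffineOpen U)
    (h : ∀ f : Γ(X, U), M.LocalizesAt U f) : (M.over U).Presentation :=
  -- On the spectrum the sheaf is a tilde and has a presentation. It is carried along `isoSpec` to
  -- the open subscheme, and along `overEquiv U` to the slice over `U`.
  let p1 : (M.restrict hU.fromSpec).Presentation :=
    @SheafOfModules.Presentation.ofIsIso.{u, u, u} _ _ _ _ _ _ _ _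
      (M.restrict hU.fromSpec).fromTildeΓ
      ((isIso_fromTildeΓ_iff_isLocalizing _).2 ((M.isLocalizing_iff_localizesAt hU).2 h))
      (presentationTilde.{u} _ .univ (by simp) _ (Submodule.span_eq _))
  let i2 := (restrictFunctorComp _ _).symm ≪≫
      restrictFunctorCongr (hU.isoSpec_hom_fromSpec) |>.app M
  let p2 : (M.restrict U.ι).Presentation :=
    @SheafOfModules.Presentation.ofIsIso.{u, u, u} _ _ _ _ _ _ _ _ i2.hom (Iso.isIso_hom i2)
      (presentationRestrict hU.isoSpec.hom p1)
  let η : SheafOfModules.unit (X.ringCatSheaf.over U) ≅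
      (overEquiv U).inverse.obj (SheafOfModules.unit _) :=
    (overEquiv U).unitIso.app _ ≪≫ (overEquiv U).inverse.mapIso
      ((overFunctorEquiv U).app (SheafOfModules.unit X.ringCatSheaf) ≪≫ restrictUnitIso U.ι)
  have hp : Limits.PreservesColimitsOfSize.{u, u} (overEquiv U).inverse := inferInstance
  let i3 := (overEquiv U).inverse.mapIso ((overFunctorEquiv U).app M).symm ≪≫
      ((overEquiv U).unitIso.app (M.over U)).symm
  @SheafOfModules.Presentation.ofIsIso.{u, u, u} _ _ _ _ _ _ _ _ i3.hom (Iso.isIso_hom i3)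
    (@SheafOfModules.Presentation.map _ _ _ _ _ _ _ _ _ _ _ _ _ p2 (overEquiv U).inverse hp η)

theorem isQuasicoherent_of_localizesAt (M : X.Modules)
    (h : ∀ (U : X.Opens) (_ : IsAffineOpen U) (f : Γ(X, U)), M.LocalizesAt U f) :
    M.IsQuasicoherent :=
  SheafOfModules.QuasicoherentData.isQuasicoherent (R := X.ringCatSheaf) (M := M)
    (q := { I := X.affineOpens
            X := fun U => U.1
            coversTop := by
              rw [Opens.coversTop_iff, IsOpenCover]
              exact iSup_affineOpens_eq_top X
            presentation := fun U => M.presentationOfLocalizesAt U.2 (h U.1 U.2) })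

end AlgebraicGeometry.Scheme.Modules

/-! ### Sections over affine opens and power-linear maps of sheaves -/

namespace AlgebraicGeometry.Scheme.Modules

variable {X : Scheme.{u}}

/-- Restriction of functions. -/
def resO {U V : X.Opens} (h : V ≤ U) : Γ(X, U) →+* Γ(X, V) := (X.presheaf.map (homOfLE h).op).hom

/-- Restriction of sections. -/
def res (M : X.Modules) {U V : X.Opens} (h : V ≤ U) : Γ(M, U) →+ Γ(M, V) :=
  (M.presheaf.map (homOfLE h).op).hom

variable (M : X.Modules) {U V W : X.Opens}

theorem map_eq_res (i : V ⟶ U) (m : Γ(M, U)) : M.presheaf.map i.op m = M.res i.le m := rfl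

@[simp]
theorem res_res (h : V ≤ U) (h' : W ≤ V) (m : Γ(M, U)) :
    M.res h' (M.res h m) = M.res (h'.trans h) m :=
  congr($(M.presheaf.map_comp (homOfLE h).op (homOfLE h').op) m).symm

@[simp]
theorem res_self (h : U ≤ U) (m : Γ(M, U)) : M.res h m = m := congr($(M.presheaf.map_id _) m)

@[simp]
theorem res_smul (h : V ≤ U) (r : Γ(X, U)) (m : Γ(M, U)) :
    M.res h (r • m) = resO h r • M.res h m := map_smul M (homOfLE h) r m

theorem isUnit_resO_basicOpen {f : Γ(X, U)} (h : V ≤ X.basicOpen f) :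
    IsUnit (resO (h.trans (X.basicOpen_le f)) f) := by
  have h1 := (RingedSpace.isUnit_res_basicOpen X.toRingedSpace f).map (resO h)
  have h2 : resO h (resO (X.basicOpen_le f) f) = resO (h.trans (X.basicOpen_le f)) f :=
    congr($(X.presheaf.map_comp (homOfLE (X.basicOpen_le f)).op (homOfLE h).op) f).symm
  rw [← h2]
  exact h1

theorem eq_of_locally {m m' : Γ(M, U)}
    (h : ∀ x ∈ U, ∃ (V : X.Opens) (i : V ≤ U), x ∈ V ∧ M.res i m = M.res i m') : m = m' := by
  choose V i hV he using fun x : U => h x.1 x.2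
  exact TopCat.Sheaf.eq_of_locally_eq' ⟨M.presheaf, M.isSheaf⟩ V U (fun x => homOfLE (i x))
    (fun x hx => Opens.mem_iSup.2 ⟨⟨x, hx⟩, hV _⟩) _ _ he

/-- A section over an affine open lies in a submodule if it does so locally, up to powers of the
functions that define the cover. -/
theorem mem_of_locally_pow_smul_mem (hU : IsAffineOpen U) (T : Submodule Γ(X, U) Γ(M, U))
    {s : Γ(M, U)} (h : ∀ x ∈ U, ∃ f : Γ(X, U), x ∈ X.basicOpen f ∧ ∃ k : ℕ, f ^ k • s ∈ T) :
    s ∈ T := by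
  -- The functions that carry `s` into `T`. The radical contains functions whose principal opens
  -- cover `U`, so `J` is the unit ideal.
  let J : Ideal Γ(X, U) := T.comap (LinearMap.toSpanSingleton Γ(X, U) _ s)
  have h1 : Ideal.span (J.radical : Set Γ(X, U)) = ⊤ := by
    refine hU.self_le_iSup_basicOpen_iff.1 fun x hx => ?_
    obtain ⟨f, hf, k, hk⟩ := h x hx
    exact Opens.mem_iSup.2 ⟨⟨f, k, hk⟩, hf⟩
  rw [Ideal.span_eq, Ideal.radical_eq_top] at h1
  have h2 : (1 : Γ(X, U)) ∈ J := h1 ▸ Submodule.mem_top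
  rw [← one_smul Γ(X, U) s]
  exact h2

/-- If a section over a quasi-compact open is locally killed by powers of `f`, then it is killed by
a power of `f`. -/
theorem exists_pow_smul_eq_zero_of_locally (hU : IsAffineOpen U) (f : Γ(X, U)) {s : Γ(M, U)}
    (h : ∀ x ∈ U, ∃ (V : X.Opens) (i : V ≤ U), x ∈ V ∧ ∃ k : ℕ, M.res i (f ^ k • s) = 0) :
    ∃ k : ℕ, f ^ k • s = 0 := by
  obtain ⟨k, hk⟩ := hU.isCompact.induction_on
    (p := fun S => ∃ k : ℕ, ∀ x ∈ S, ∃ (V : X.Opens) (i : V ≤ U), x ∈ V ∧ M.res i (f ^ k • s) = 0)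
    ⟨0, fun _ h => h.elim⟩ (fun S T hST ⟨k, hk⟩ => ⟨k, fun x hx => hk x (hST hx)⟩) (by
      rintro S T ⟨k, hk⟩ ⟨l, hl⟩
      refine ⟨k + l, fun x hx => ?_⟩
      obtain hx | hx := hx
      · obtain ⟨V, i, hV, h⟩ := hk x hx
        exact ⟨V, i, hV, by rw [add_comm, pow_add, mul_smul, res_smul, h, smul_zero]⟩
      · obtain ⟨V, i, hV, h⟩ := hl x hx
        exact ⟨V, i, hV, by rw [pow_add, mul_smul, res_smul, h, smul_zero]⟩) (by
      intro x hx
      obtain ⟨V, i, hV, k, h⟩ := h x hx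
      exact ⟨V, mem_nhdsWithin_of_mem_nhds (V.2.mem_nhds hV), k, fun y hy => ⟨V, i, hy, h⟩⟩)
  refine ⟨k, M.eq_of_locally fun x hx => ?_⟩
  obtain ⟨V, i, hV, h⟩ := hk x hx
  exact ⟨V, i, hV, by rw [h, map_zero]⟩

theorem exists_basicOpen_le (hU : IsAffineOpen U) (h : V ≤ U) {x : X} (hx : x ∈ V) :
    ∃ f : Γ(X, U), x ∈ X.basicOpen f ∧ X.basicOpen f ≤ V := by
  obtain ⟨f, hf, hxf⟩ := hU.exists_basicOpen_le ⟨x, hx⟩ (h hx)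
  exact ⟨f, hxf, hf⟩

variable {M}

theorem exists_lift_of_isQuasicoherent (hM : M.IsQuasicoherent) (hU : IsAffineOpen U)
    (f : Γ(X, U)) (s : Γ(M, X.basicOpen f)) : ∃ (n : ℕ) (t : Γ(M, U)),
      M.res (X.basicOpen_le f) t = resO (X.basicOpen_le f) (f ^ n) • s := by
  obtain ⟨n, t, h⟩ := (M.localizesAt_of_isQuasicoherent hM hU f).exists_lift s
  exact ⟨n, t, by rw [map_pow]; exact h⟩

theorem exists_pow_smul_eq_zero_of_isQuasicoherent (hM : M.IsQuasicoherent) (hU : IsAffineOpen U)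
    (f : Γ(X, U)) (t : Γ(M, U)) (h : M.res (X.basicOpen_le f) t = 0) : ∃ n : ℕ, f ^ n • t = 0 :=
  (M.localizesAt_of_isQuasicoherent hM hU f).exists_pow_smul_eq_zero t h

theorem isQuasicoherent_of_forall
    (h₁ : ∀ (U : X.Opens) (_ : IsAffineOpen U) (f : Γ(X, U)) (s : Γ(M, X.basicOpen f)),
      ∃ (n : ℕ) (t : Γ(M, U)), M.res (X.basicOpen_le f) t = resO (X.basicOpen_le f) (f ^ n) • s)
    (h₂ : ∀ (U : X.Opens) (_ : IsAffineOpen U) (f : Γ(X, U)) (t : Γ(M, U)),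
      M.res (X.basicOpen_le f) t = 0 → ∃ n : ℕ, f ^ n • t = 0) : M.IsQuasicoherent :=
  M.isQuasicoherent_of_localizesAt fun U hU f => ⟨fun s => by
    obtain ⟨n, t, h⟩ := h₁ U hU f s
    exact ⟨n, t, by rw [← map_pow]; exact h⟩, h₂ U hU f⟩

/-- A map of sheaves `φ` with `φ (r ^ n • m) = r • φ m`. -/
structure PowLinear (P Q : X.Modules) (n : ℕ) where
  app (U : X.Opens) : Γ(P, U) →+ Γ(Q, U)
  app_res {U V : X.Opens} (h : V ≤ U) (m : Γ(P, U)) : app V (P.res h m) = Q.res h (app U m)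
  app_pow_smul {U : X.Opens} (r : Γ(X, U)) (m : Γ(P, U)) : app U (r ^ n • m) = r • app U m

namespace PowLinear

variable {P Q : X.Modules} {n : ℕ} (φ : PowLinear P Q n)

/-- The range on sections over `U`. -/
def range (U : X.Opens) : Submodule Γ(X, U) Γ(Q, U) where
  carrier := Set.range (φ.app U)
  zero_mem' := ⟨0, map_zero _⟩
  add_mem' := by
    rintro _ _ ⟨a, rfl⟩ ⟨b, rfl⟩
    exact ⟨a + b, map_add _ a b⟩
  smul_mem' := by
    rintro r _ ⟨a, rfl⟩
    exact ⟨r ^ n • a, φ.app_pow_smul r a⟩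

/-- Sections in the range over an affine open that vanish on the principal open subset `D(f)` are
killed by a power of `f`. -/
def KerLocalizes : Prop :=
  ∀ (U : X.Opens) (_ : IsAffineOpen U) (f : Γ(X, U)) (m : Γ(P, U)),
    Q.res (X.basicOpen_le f) (φ.app U m) = 0 → ∃ k : ℕ, f ^ k • φ.app U m = 0

variable {φ}

theorem kerLocalizes_of_isQuasicoherent (hQ : Q.IsQuasicoherent) : φ.KerLocalizes :=
  fun _ hU f _ h => exists_pow_smul_eq_zero_of_isQuasicoherent hQ hU f _ h

/-- No quasi-coherence of `Q` is needed, so this also serves to establish it for a target. A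
preimage on `D(g)` lifts after multiplication by `g ^ N`; the exponent is then raised to `N * n`,
because only `(g ^ N) ^ n` passes through `φ`, as `g ^ N`. -/
theorem exists_app_eq_of_locally (hn : n ≠ 0) (hP : P.IsQuasicoherent) (hφ : φ.KerLocalizes)
    (hU : IsAffineOpen U) {s : Γ(Q, U)} (h : ∀ x ∈ U, ∃ (V : X.Opens) (i : V ≤ U), x ∈ V ∧
      ∃ m, φ.app V m = Q.res i s) : ∃ m, φ.app U m = s := by
  have h' : ∀ x ∈ U, ∃ f : Γ(X, U), x ∈ X.basicOpen f ∧ ∃ m,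
      φ.app (X.basicOpen f) m = Q.res (X.basicOpen_le f) s := by
    intro x hx
    obtain ⟨V, i, hV, m, hm⟩ := h x hx
    obtain ⟨f, hxf, hf⟩ := exists_basicOpen_le hU i hV
    exact ⟨f, hxf, P.res hf m, by rw [φ.app_res, hm, res_res]⟩
  refine Q.mem_of_locally_pow_smul_mem hU (φ.range U) fun x hx => ?_
  obtain ⟨g, hxg, m, hm⟩ := h' x hx
  obtain ⟨N, t, ht⟩ := exists_lift_of_isQuasicoherent hP hU g m
  -- `g ^ N' • s` and the image of `t'` agree on `D(g)`
  have h1 : Q.res (X.basicOpen_le g) (g ^ N • s - φ.app U (g ^ (N * n - N) • t)) = 0 := by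
    have hle : N ≤ N * n := Nat.le_mul_of_pos_right _ (Nat.pos_of_ne_zero hn)
    rw [map_sub, res_smul, ← hm, ← φ.app_res, res_smul, ht, smul_smul, ← map_mul, ← pow_add,
      Nat.sub_add_cancel hle, pow_mul, map_pow _ (g ^ N), φ.app_pow_smul, sub_self]
  -- The difference itself is not known to be in the image, but on a cover it is `φ b'`, where
  -- `KerLocalizes` applies; quasi-compactness makes the exponent uniform.
  obtain ⟨k, hk⟩ : ∃ k : ℕ, g ^ k • (g ^ N • s - φ.app U (g ^ (N * n - N) • t)) = 0 := by
    refine Q.exists_pow_smul_eq_zero_of_locally hU g fun y hy => ?_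
    obtain ⟨f, hyf, b, hb⟩ := h' y hy
    set b' := resO (X.basicOpen_le f) (g ^ N) ^ n • b -
      P.res (X.basicOpen_le f) (g ^ (N * n - N) • t) with hb'
    have h2 : φ.app _ b' = Q.res (X.basicOpen_le f)
        (g ^ N • s - φ.app U (g ^ (N * n - N) • t)) := by
      rw [hb', map_sub, φ.app_pow_smul, hb, φ.app_res, map_sub, res_smul]
    have h3 : X.basicOpen (resO (X.basicOpen_le f) g) ≤ X.basicOpen g := by
      refine (X.basicOpen_res g (homOfLE (X.basicOpen_le f)).op).le.trans inf_le_right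
    obtain ⟨k, hk⟩ := hφ _ (hU.basicOpen f) (resO (X.basicOpen_le f) g) b' (by
      rw [h2, res_res, ← res_res Q (X.basicOpen_le g) h3, h1, map_zero])
    refine ⟨X.basicOpen f, X.basicOpen_le f, hyf, k, ?_⟩
    rw [res_smul, ← h2, map_pow, hk]
  refine ⟨g, hxg, k + N, g ^ (k * n) • g ^ (N * n - N) • t, ?_⟩
  rw [pow_mul, φ.app_pow_smul, pow_add, mul_smul]
  rw [smul_sub, sub_eq_zero] at hk
  exact hk.symm

theorem isQuasicoherent_of_locally_surjective (hn : n ≠ 0) (hP : P.IsQuasicoherent)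
    (hφ : φ.KerLocalizes) (h : ∀ (U : X.Opens) (s : Γ(Q, U)), ∀ x ∈ U,
      ∃ (V : X.Opens) (i : V ≤ U), x ∈ V ∧ ∃ m, φ.app V m = Q.res i s) : Q.IsQuasicoherent := by
  refine isQuasicoherent_of_forall (fun U hU f s => ?_) fun U hU f t ht => ?_
  · obtain ⟨m, rfl⟩ := exists_app_eq_of_locally hn hP hφ (hU.basicOpen f) (h _ s)
    obtain ⟨N, t, ht⟩ := exists_lift_of_isQuasicoherent hP hU f m
    have hle : N ≤ N * n := Nat.le_mul_of_pos_right _ (Nat.pos_of_ne_zero hn)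
    refine ⟨N, φ.app U (f ^ (N * n - N) • t), ?_⟩
    rw [← φ.app_res, res_smul, ht, smul_smul, ← map_mul, ← pow_add, Nat.sub_add_cancel hle,
      pow_mul, map_pow _ (f ^ N), φ.app_pow_smul]
  · obtain ⟨m, rfl⟩ := exists_app_eq_of_locally hn hP hφ hU (h _ t)
    obtain ⟨k, hk⟩ := hφ U hU f m ht
    exact ⟨k, hk⟩

end PowLinear

end AlgebraicGeometry.Scheme.Modules

open AlgebraicGeometry.Scheme.Modules

/-! ### Cartier submodules and inclusions up to a power of `C` -/

namespace PreCartier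

variable {q : ℕ} {X : Scheme.{u}} (M : PreCartier q X)

/-- The structural map on sections. -/
def c (U : X.Opens) : Γ(M.toModules, U) →+ Γ(M.toModules, U) := (M.C.app (op U)).hom

theorem c_res {U V : X.Opens} (h : V ≤ U) (m : Γ(M.toModules, U)) :
    M.c V (M.toModules.res h m) = M.toModules.res h (M.c U m) :=
  NatTrans.naturality_apply M.C (homOfLE h).op m

theorem c_smul {U : X.Opens} (r : Γ(X, U)) (m : Γ(M.toModules, U)) :
    M.c U (r ^ q • m) = r • M.c U m := M.C_smul U r m

theorem powC_app (e : ℕ) (U : X.Opens) (m : Γ(M.toModules, U)) :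
    (M.powC e).app (op U) m = (M.c U)^[e] m := by
  induction e with
  | zero => rfl
  | succ e ih =>
    rw [Function.iterate_succ_apply', ← ih]
    rfl

theorem iterate_c_smul (e : ℕ) {U : X.Opens} (r : Γ(X, U)) (m : Γ(M.toModules, U)) :
    (M.c U)^[e] (r ^ q ^ e • m) = r • (M.c U)^[e] m :=
  iterate_pow_smul (fun r m => M.c_smul r m) e r m

theorem iterate_c_res (e : ℕ) {U V : X.Opens} (h : V ≤ U) (m : Γ(M.toModules, U)) :
    (M.c V)^[e] (M.toModules.res h m) = M.toModules.res h ((M.c U)^[e] m) := by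
  induction e with
  | zero => rfl
  | succ e ih => rw [Function.iterate_succ_apply', Function.iterate_succ_apply', ih, c_res]

theorem isNilpotent_iff :
    M.IsNilpotent ↔ ∃ e, ∀ (U : X.Opens) (m : Γ(M.toModules, U)), (M.c U)^[e] m = 0 := by
  refine exists_congr fun e => ⟨fun h U m => ?_, fun h => ?_⟩
  · rw [← powC_app, h]
    rfl
  · ext U m
    exact (M.powC_app e U m).trans (h _ m)

variable {M} {N : PreCartier q X}

namespace Hom

/-- A morphism on sections. -/
def ap (f : Hom M N) (U : X.Opens) : Γ(M.toModules, U) →+ Γ(N.toModules, U) := (f.toHom.app U).hom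

variable (f : Hom M N) {U V : X.Opens}

theorem ap_res (h : V ≤ U) (m : Γ(M.toModules, U)) :
    f.ap V (M.toModules.res h m) = N.toModules.res h (f.ap U m) :=
  NatTrans.naturality_apply f.toHom.mapPresheaf (homOfLE h).op m

theorem ap_smul (r : Γ(X, U)) (m : Γ(M.toModules, U)) : f.ap U (r • m) = r • f.ap U m :=
  f.toHom.app_smul r m

theorem ap_c (m : Γ(M.toModules, U)) : f.ap U (M.c U m) = N.c U (f.ap U m) := f.comm U m

theorem ap_iterate_c (e : ℕ) (m : Γ(M.toModules, U)) :
    f.ap U ((M.c U)^[e] m) = (N.c U)^[e] (f.ap U m) := by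
  induction e with
  | zero => rfl
  | succ e ih => rw [Function.iterate_succ_apply', Function.iterate_succ_apply', ap_c, ih]

/-- A morphism, seen as a `PowLinear` map. -/
def powLinear : PowLinear M.toModules N.toModules 1 where
  app := f.ap
  app_res := f.ap_res
  app_pow_smul r m := by rw [pow_one, ap_smul]

/-- Every section of the target is locally in the image. -/
def LocallySurjective : Prop :=
  ∀ (U : X.Opens) (s : Γ(N.toModules, U)), ∀ x ∈ U,
    ∃ (V : X.Opens) (i : V ≤ U), x ∈ V ∧ ∃ m, f.ap V m = N.toModules.res i s

variable {f}

theorem LocallySurjective.surjective (hf : f.LocallySurjective) (hM : M.IsCartier)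
    (hN : N.IsCartier) (hU : IsAffineOpen U) : Function.Surjective (f.ap U) := fun s =>
  PowLinear.exists_app_eq_of_locally (φ := f.powLinear) one_ne_zero hM
    (PowLinear.kerLocalizes_of_isQuasicoherent hN) hU (hf U s)

end Hom

namespace Sub

variable {N N₁ N₂ N₃ : M.Sub} {U V : X.Opens}

theorem le_def : N₁ ≤ N₂ ↔ ∀ U, ∀ m ∈ N₁.carrier U, m ∈ N₂.carrier U := Iff.rfl

theorem mem_inf {m : Γ(M.toModules, U)} :
    m ∈ (N₁ ⊓ N₂).carrier U ↔ m ∈ N₁.carrier U ∧ m ∈ N₂.carrier U := by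
  refine ⟨fun h => ⟨(inf_le_left : N₁ ⊓ N₂ ≤ N₁) U h, (inf_le_right : N₁ ⊓ N₂ ≤ N₂) U h⟩,
    fun h => ?_⟩
  change m ∈ ⨅ N ∈ ({N₁, N₂} : Set M.Sub), N.carrier U
  simpa [Submodule.mem_iInf] using h

theorem mem_iInf {ι : Type*} {K : ι → M.Sub} {m : Γ(M.toModules, U)} :
    m ∈ (⨅ i, K i).carrier U ↔ ∀ i, m ∈ (K i).carrier U := by
  change m ∈ ⨅ N ∈ Set.range K, N.carrier U ↔ _
  simp [Submodule.mem_iInf]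

theorem res_mem (h : V ≤ U) {m : Γ(M.toModules, U)} (hm : m ∈ N.carrier U) :
    M.toModules.res h m ∈ N.carrier V := N.map_mem (homOfLE h) hm

theorem mem_of_locally_res {m : Γ(M.toModules, U)}
    (h : ∀ x ∈ U, ∃ (V : X.Opens) (i : V ≤ U), x ∈ V ∧ M.toModules.res i m ∈ N.carrier V) :
    m ∈ N.carrier U :=
  N.mem_of_locally m fun x hx =>
    let ⟨V, i, hV, h⟩ := h x hx
    ⟨V, homOfLE i, hV, h⟩

theorem c_mem {m : Γ(M.toModules, U)} (hm : m ∈ N.carrier U) : M.c U m ∈ N.carrier U := N.C_mem hm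

theorem iterate_c_mem (e : ℕ) {m : Γ(M.toModules, U)} (hm : m ∈ N.carrier U) :
    (M.c U)^[e] m ∈ N.carrier U :=
  iterate_map_mem (fun _ => c_mem) e hm

variable (N) in
/-- The inclusion of a submodule. -/
def incl : Hom N.toPreCartier M where
  toHom := SheafOfModules.Hom.mk (X := N.toModules) (Y := M.toModules) N.toPre.ι
  comm _ _ := rfl

theorem coe_iterate_c (e : ℕ) (m : Γ(N.toPreCartier.toModules, U)) :
    N.incl.ap U ((N.toPreCartier.c U)^[e] m) = (M.c U)^[e] (N.incl.ap U m) :=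
  N.incl.ap_iterate_c e m

/-- Inside a quasi-coherent sheaf the annihilation half of the localization property is inherited,
so only lifting remains; a lift to `M` exists, and the condition moves it into `N`. -/
theorem isCartier_iff (hM : M.IsCartier) : N.IsCartier ↔
    ∀ (U : X.Opens) (_ : IsAffineOpen U) (f : Γ(X, U)) (m : Γ(M.toModules, U)),
      M.toModules.res (X.basicOpen_le f) m ∈ N.carrier (X.basicOpen f) →
      ∃ n : ℕ, f ^ n • m ∈ N.carrier U := by
  refine ⟨fun h U hU f m hm => ?_, fun h => isQuasicoherent_of_forall (fun U hU f s => ?_)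
    fun U hU f t ht => ?_⟩
  · obtain ⟨n, t, ht⟩ := exists_lift_of_isQuasicoherent h hU f ⟨_, hm⟩
    let t₀ : Γ(M.toModules, U) := t.1
    replace ht : M.toModules.res (X.basicOpen_le f) t₀ =
      resO (X.basicOpen_le f) (f ^ n) • M.toModules.res (X.basicOpen_le f) m :=
      congrArg Subtype.val ht
    obtain ⟨k, hk⟩ := exists_pow_smul_eq_zero_of_isQuasicoherent hM hU f (f ^ n • m - t₀) (by
      rw [map_sub, ht, res_smul, sub_self])
    refine ⟨k + n, ?_⟩
    rw [smul_sub, sub_eq_zero, smul_smul, ← pow_add] at hk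
    rw [hk]
    exact (N.carrier U).smul_mem _ t.2
  · obtain ⟨n, t, ht⟩ := exists_lift_of_isQuasicoherent hM hU f (N.incl.ap _ s)
    obtain ⟨k, hk⟩ := h U hU f t (by
      rw [ht]
      exact (N.carrier _).smul_mem _ s.2)
    refine ⟨k + n, ⟨_, hk⟩, Subtype.ext ?_⟩
    refine (res_smul M.toModules (X.basicOpen_le f) (f ^ k) t).trans ?_
    rw [ht, smul_smul, ← map_mul, ← pow_add]
    rfl
  · obtain ⟨n, hn⟩ := exists_pow_smul_eq_zero_of_isQuasicoherent hM hU f t.1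
      (congrArg Subtype.val ht)
    exact ⟨n, Subtype.ext hn⟩

theorem isCartier_bot (hM : M.IsCartier) : (⊥ : M.Sub).IsCartier :=
  (isCartier_iff hM).2 fun _ hU f m hm => exists_pow_smul_eq_zero_of_isQuasicoherent hM hU f m hm

theorem IsCartier.inf (hM : M.IsCartier) (h₁ : N₁.IsCartier) (h₂ : N₂.IsCartier) :
    (N₁ ⊓ N₂).IsCartier := by
  rw [isCartier_iff hM] at h₁ h₂ ⊢
  intro U hU f m hm
  rw [mem_inf] at hm
  obtain ⟨n₁, h₁⟩ := h₁ U hU f m hm.1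
  obtain ⟨n₂, h₂⟩ := h₂ U hU f m hm.2
  refine ⟨n₁ + n₂, mem_inf.2 ⟨?_, ?_⟩⟩
  · rw [add_comm, pow_add, mul_smul]
    exact (N₁.carrier U).smul_mem _ h₁
  · rw [pow_add, mul_smul]
    exact (N₂.carrier U).smul_mem _ h₂

variable (N₁ N₂) in
/-- `C ^ e (N₁) ⊆ N₂`. -/
def PowLE (e : ℕ) : Prop :=
  ∀ (U : X.Opens), ∀ m ∈ N₁.carrier U, (M.c U)^[e] m ∈ N₂.carrier U

theorem PowLE.trans {e e' : ℕ} (h : PowLE N₁ N₂ e) (h' : PowLE N₂ N₃ e') :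
    PowLE N₁ N₃ (e' + e) := fun U m hm => by
  rw [Function.iterate_add_apply]
  exact h' U _ (h U m hm)

theorem PowLE.of_le (h : N₁ ≤ N₂) (e : ℕ) : PowLE N₁ N₂ e := fun U _ hm =>
  iterate_c_mem e (h U hm)

theorem PowLE.mono {e e' : ℕ} (h : PowLE N₁ N₂ e) (he : e ≤ e') : PowLE N₁ N₂ e' := by
  obtain ⟨k, rfl⟩ := Nat.exists_eq_add_of_le' he
  exact h.trans (.of_le le_rfl k)

theorem powLE_zero : PowLE N₁ N₂ 0 ↔ N₁ ≤ N₂ := Iff.rfl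

theorem isNilpotent_iff_powLE : N.toPreCartier.IsNilpotent ↔ ∃ e, PowLE N ⊥ e := by
  rw [isNilpotent_iff]
  refine exists_congr fun e => ⟨fun h U m hm => ?_, fun h U m => ?_⟩
  · exact (coe_iterate_c e ⟨m, hm⟩).symm.trans (congrArg (N.incl.ap U) (h U ⟨m, hm⟩))
  · exact Subtype.ext ((coe_iterate_c e m).trans (h U m.1 m.2))

/-- The inclusion `C ^ e (N₁) ⊆ N₂` can be checked on an affine cover. -/
theorem PowLE.of_cover (hq : q ≠ 0) (h₁ : N₁.IsCartier) {ι : Type*}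
    {W : ι → X.Opens} (hW : ∀ i, IsAffineOpen (W i)) (hc : ∀ x, ∃ i, x ∈ W i) {e : ℕ}
    (h : ∀ i, ∀ m ∈ N₁.carrier (W i), (M.c (W i))^[e] m ∈ N₂.carrier (W i)) : PowLE N₁ N₂ e := by
  intro U m hm
  refine mem_of_locally_res fun x hx => ?_
  obtain ⟨i, hi⟩ := hc x
  obtain ⟨g, hxg, hg⟩ := exists_basicOpen_le (hW i) (inf_le_right : U ⊓ W i ≤ W i) ⟨hx, hi⟩
  refine ⟨X.basicOpen g, hg.trans inf_le_left, hxg, ?_⟩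
  obtain ⟨n, t, ht⟩ := exists_lift_of_isQuasicoherent h₁ (hW i) g
    ⟨_, N₁.res_mem (hg.trans inf_le_left) hm⟩
  let t₀ : Γ(M.toModules, W i) := t.1
  replace ht : M.toModules.res (X.basicOpen_le g) t₀ =
    resO (X.basicOpen_le g) (g ^ n) • M.toModules.res (hg.trans inf_le_left) m :=
    congrArg Subtype.val ht
  -- The lift is multiplied up to exponent `n * q ^ e`, so that `g ^ n` comes out of `C ^ e`; as a
  -- unit on `D(g)` it can then be cancelled.
  have hle : n ≤ n * q ^ e := Nat.le_mul_of_pos_right _ (Nat.pow_pos (Nat.pos_of_ne_zero hq))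
  have h2 := N₂.res_mem (X.basicOpen_le g) (h i (g ^ (n * q ^ e - n) • t₀)
    ((N₁.carrier _).smul_mem _ t.2))
  rw [← iterate_c_res, res_smul, ht, smul_smul, ← map_mul, ← pow_add, Nat.sub_add_cancel hle,
    pow_mul, map_pow _ (g ^ n), iterate_c_smul, iterate_c_res, map_pow] at h2
  obtain ⟨v, hv⟩ := ((isUnit_resO_basicOpen (le_refl (X.basicOpen g))).pow n).exists_left_inv
  have h3 := (N₂.carrier _).smul_mem v h2
  rw [smul_smul] at h3
  erw [hv] at h3
  rwa [one_smul] at h3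

theorem exists_affine_nhd (x : X) : ∃ U : X.affineOpens, x ∈ U.1 := by
  have h : x ∈ (⨆ U : X.affineOpens, U.1) := by
    rw [AlgebraicGeometry.iSup_affineOpens_eq_top]
    trivial
  exact Opens.mem_iSup.1 h

theorem PowLE.of_affine (hq : q ≠ 0) (h₁ : N₁.IsCartier) {e : ℕ}
    (h : ∀ U : X.Opens, IsAffineOpen U → ∀ m ∈ N₁.carrier U, (M.c U)^[e] m ∈ N₂.carrier U) :
    PowLE N₁ N₂ e :=
  .of_cover hq h₁ (W := fun U : X.affineOpens => U.1) (fun U => U.2) exists_affine_nhd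
    fun U => h U.1 U.2

theorem le_of_affine (hq : q ≠ 0) (h₁ : N₁.IsCartier)
    (h : ∀ U : X.Opens, IsAffineOpen U → ∀ m ∈ N₁.carrier U, m ∈ N₂.carrier U) : N₁ ≤ N₂ :=
  powLE_zero.1 (.of_affine hq h₁ h)

end Sub

end PreCartier

/-! ### Ranges of power-linear maps over affine opens -/

namespace AlgebraicGeometry.Scheme.Modules.PowLinear

variable {X : Scheme.{u}} {P Q : X.Modules} {n : ℕ} {φ : PowLinear P Q n}

theorem exists_pow_smul_mem_range (hn : n ≠ 0) (hP : P.IsQuasicoherent) (hQ : Q.IsQuasicoherent)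
    {U : X.Opens} (hU : IsAffineOpen U) (f : Γ(X, U)) (s : Γ(Q, U))
    (hs : Q.res (X.basicOpen_le f) s ∈ φ.range (X.basicOpen f)) :
    ∃ k : ℕ, f ^ k • s ∈ φ.range U := by
  obtain ⟨m, hm⟩ := hs
  obtain ⟨N, t, ht⟩ := exists_lift_of_isQuasicoherent hP hU f m
  have hle : N ≤ N * n := Nat.le_mul_of_pos_right _ (Nat.pos_of_ne_zero hn)
  obtain ⟨k, hk⟩ := exists_pow_smul_eq_zero_of_isQuasicoherent hQ hU f
    (f ^ N • s - φ.app U (f ^ (N * n - N) • t)) (by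
      rw [map_sub, res_smul, ← hm, ← φ.app_res, res_smul, ht, smul_smul, ← map_mul, ← pow_add,
        Nat.sub_add_cancel hle, pow_mul, map_pow _ (f ^ N), φ.app_pow_smul, sub_self])
  refine ⟨k + N, f ^ (k * n) • f ^ (N * n - N) • t, ?_⟩
  rw [pow_mul, φ.app_pow_smul, pow_add, mul_smul]
  rw [smul_sub, sub_eq_zero] at hk
  exact hk.symm

theorem res_mem_range (φ : PowLinear P Q n) {U V : X.Opens} (h : V ≤ U) (m : Γ(Q, U))
    (hm : m ∈ φ.range U) : Q.res h m ∈ φ.range V := by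
  obtain ⟨m, rfl⟩ := hm
  exact ⟨P.res h m, φ.app_res h m⟩

end AlgebraicGeometry.Scheme.Modules.PowLinear

/-! ### Cartier submodules from local data -/

namespace PreCartier

variable {q : ℕ} {X : Scheme.{u}} {M M' : PreCartier q X}

namespace Sub

variable {N N₁ N₂ N₃ : M.Sub} {U V : X.Opens}

theorem exists_lift_mem (hN : N.IsCartier) (hU : IsAffineOpen U) (f : Γ(X, U))
    {m : Γ(M.toModules, X.basicOpen f)} (hm : m ∈ N.carrier (X.basicOpen f)) :
    ∃ (n : ℕ), ∃ t ∈ N.carrier U,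
      M.toModules.res (X.basicOpen_le f) t = resO (X.basicOpen_le f) (f ^ n) • m := by
  obtain ⟨n, t, ht⟩ := exists_lift_of_isQuasicoherent hN hU f ⟨m, hm⟩
  exact ⟨n, t.1, t.2, congrArg Subtype.val ht⟩

/-- The subsheaf of sections that lie locally in a family of submodules. -/
def ofLocal (T : ∀ U : X.Opens, Submodule Γ(X, U) Γ(M.toModules, U))
    (hres : ∀ {U V : X.Opens} (h : V ≤ U) (m : Γ(M.toModules, U)), m ∈ T U →
      M.toModules.res h m ∈ T V)
    (hc : ∀ (U : X.Opens) (m : Γ(M.toModules, U)), m ∈ T U → M.c U m ∈ T U) : M.Sub where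
  carrier U :=
    { carrier := {m | ∀ x ∈ U, ∃ (V : X.Opens) (i : V ≤ U), x ∈ V ∧ M.toModules.res i m ∈ T V}
      zero_mem' := fun x hx => ⟨U, le_rfl, hx, by rw [map_zero]; exact zero_mem _⟩
      add_mem' := by
        intro a b ha hb x hx
        obtain ⟨V, i, hV, ha⟩ := ha x hx
        obtain ⟨W, j, hW, hb⟩ := hb x hx
        refine ⟨V ⊓ W, inf_le_left.trans i, ⟨hV, hW⟩, ?_⟩
        rw [map_add, ← res_res _ i inf_le_left, ← res_res _ j inf_le_right]
        exact add_mem (hres _ _ ha) (hres _ _ hb)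
      smul_mem' := by
        intro r m hm x hx
        obtain ⟨V, i, hV, hm⟩ := hm x hx
        refine ⟨V, i, hV, ?_⟩
        rw [res_smul]
        exact (T V).smul_mem _ hm }
  map_mem := by
    intro U V i m hm x hx
    obtain ⟨W, j, hW, h⟩ := hm x (i.le hx)
    refine ⟨W ⊓ V, inf_le_right, ⟨hW, hx⟩, ?_⟩
    rw [map_eq_res, res_res, ← res_res _ j inf_le_left]
    exact hres _ _ h
  mem_of_locally := by
    intro U m hm x hx
    obtain ⟨V, i, hV, h⟩ := hm x hx
    obtain ⟨W, j, hW, h⟩ := h x hV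
    refine ⟨W, j.trans i.le, hW, ?_⟩
    rwa [map_eq_res, res_res] at h
  C_mem := by
    intro U m hm x hx
    obtain ⟨V, i, hV, h⟩ := hm x hx
    refine ⟨V, i, hV, ?_⟩
    have := hc _ _ h
    rwa [c_res] at this

section ofLocal

variable {T : ∀ U : X.Opens, Submodule Γ(X, U) Γ(M.toModules, U)}
  {hres : ∀ {U V : X.Opens} (h : V ≤ U) (m : Γ(M.toModules, U)), m ∈ T U →
      M.toModules.res h m ∈ T V}
  {hc : ∀ (U : X.Opens) (m : Γ(M.toModules, U)), m ∈ T U → M.c U m ∈ T U}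

theorem mem_ofLocal_of_mem {m : Γ(M.toModules, U)} (h : m ∈ T U) :
    m ∈ (ofLocal T hres hc).carrier U := fun x hx => ⟨U, le_rfl, hx, by rwa [res_self]⟩

variable (hT : ∀ (U : X.Opens) (_ : IsAffineOpen U) (f : Γ(X, U)) (m : Γ(M.toModules, U)),
  M.toModules.res (X.basicOpen_le f) m ∈ T (X.basicOpen f) → ∃ n : ℕ, f ^ n • m ∈ T U)

include hT

/-- With the localization condition, sheafifying adds no sections over an affine open. Images and
sums can hence be computed on affine sections. -/
theorem mem_ofLocal_iff (hU : IsAffineOpen U) {m : Γ(M.toModules, U)} :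
    m ∈ (ofLocal T hres hc).carrier U ↔ m ∈ T U := by
  refine ⟨fun h => mem_of_locally_pow_smul_mem _ hU (T U) fun x hx => ?_, mem_ofLocal_of_mem⟩
  obtain ⟨V, i, hV, h⟩ := h x hx
  obtain ⟨f, hxf, hf⟩ := exists_basicOpen_le hU i hV
  have := hres hf _ h
  rw [res_res] at this
  exact ⟨f, hxf, hT U hU f m this⟩

theorem isCartier_ofLocal (hM : M.IsCartier) : (ofLocal T hres hc).IsCartier := by
  rw [isCartier_iff hM]
  intro U hU f m hm
  rw [mem_ofLocal_iff hT (hU.basicOpen f)] at hm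
  simp_rw [mem_ofLocal_iff hT hU]
  exact hT U hU f m hm

end ofLocal

/-! ### Images -/

section image

variable {P : X.Modules} {n : ℕ} (φ : PowLinear P M.toModules n)
  (hc : ∀ (U : X.Opens) (m : Γ(M.toModules, U)), m ∈ φ.range U → M.c U m ∈ φ.range U)

/-- The image sheaf of a map of sheaves `φ` with `φ (r ^ n • m) = r • φ m`. -/
def image : M.Sub := ofLocal φ.range φ.res_mem_range hc

theorem mem_image_of_app (m : Γ(P, U)) : φ.app U m ∈ (image φ hc).carrier U :=
  mem_ofLocal_of_mem (hres := φ.res_mem_range) ⟨m, rfl⟩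

theorem mem_image (hn : n ≠ 0) (hP : P.IsQuasicoherent) (hM : M.IsCartier) (hU : IsAffineOpen U)
    {m : Γ(M.toModules, U)} : m ∈ (image φ hc).carrier U ↔ ∃ m', φ.app U m' = m :=
  mem_ofLocal_iff (hres := φ.res_mem_range) (fun _ hU f m h => PowLinear.exists_pow_smul_mem_range hn hP hM hU f m h) hU

theorem isCartier_image (hn : n ≠ 0) (hP : P.IsQuasicoherent) (hM : M.IsCartier) :
    (image φ hc).IsCartier :=
  isCartier_ofLocal (hres := φ.res_mem_range)
    (fun _ hU f m h => PowLinear.exists_pow_smul_mem_range hn hP hM hU f m h) hM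

end image

variable (N) in
/-- The map `C ^ e` on a submodule. -/
def powCLinear (e : ℕ) : PowLinear N.toPreCartier.toModules M.toModules (q ^ e) where
  app U := ⟨⟨fun m => (M.c U)^[e] (N.incl.ap U m), by
      rw [map_zero, iterate_map_zero]⟩, fun a b => by
      change (M.c U)^[e] (N.incl.ap U (a + b)) = _
      rw [map_add, iterate_map_add]⟩
  app_res h m := M.iterate_c_res e h (N.incl.ap _ m)
  app_pow_smul r m := by
    change (M.c _)^[e] (N.incl.ap _ (r ^ q ^ e • m)) = _
    rw [Hom.ap_smul, iterate_c_smul]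
    rfl

variable (N) in
/-- The image sheaf `C ^ e (N)`. -/
def powImage (e : ℕ) : M.Sub := image (N.powCLinear e) (by
  rintro U _ ⟨m, rfl⟩
  refine ⟨N.toPreCartier.c U m, ?_⟩
  exact (Function.iterate_succ_apply (M.c U) e (N.incl.ap U m)).symm.trans
    (Function.iterate_succ_apply' (M.c U) e (N.incl.ap U m)))

theorem iterate_c_mem_powImage (e : ℕ) {m : Γ(M.toModules, U)} (hm : m ∈ N.carrier U) :
    (M.c U)^[e] m ∈ (N.powImage e).carrier U :=
  mem_image_of_app (N.powCLinear e) _ ⟨m, hm⟩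

theorem mem_powImage (hq : q ≠ 0) (hM : M.IsCartier) (hN : N.IsCartier) {e : ℕ}
    (hU : IsAffineOpen U) {m : Γ(M.toModules, U)} :
    m ∈ (N.powImage e).carrier U ↔ ∃ m' ∈ N.carrier U, (M.c U)^[e] m' = m :=
  (mem_image (N.powCLinear e) _ (pow_ne_zero e hq) hN hM hU).trans
    ⟨fun ⟨m', h⟩ => ⟨m'.1, m'.2, h⟩, fun ⟨m', h, h'⟩ => ⟨⟨m', h⟩, h'⟩⟩

theorem IsCartier.powImage (hq : q ≠ 0) (hM : M.IsCartier) (hN : N.IsCartier) (e : ℕ) :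
    (N.powImage e).IsCartier := isCartier_image _ _ (pow_ne_zero e hq) hN hM

theorem powImage_le_iff {e : ℕ} : N₁.powImage e ≤ N₂ ↔ PowLE N₁ N₂ e := by
  refine ⟨fun h U m hm => h U (iterate_c_mem_powImage e hm), fun h U m hm => ?_⟩
  refine mem_of_locally_res fun x hx => ?_
  obtain ⟨V, i, hV, m', h1⟩ := hm x hx
  refine ⟨V, i, hV, ?_⟩
  rw [← h1]
  exact h V m'.1 m'.2

theorem powImage_le (e : ℕ) : N.powImage e ≤ N := powImage_le_iff.2 (.of_le le_rfl e)

theorem powImage_antitone : Antitone N.powImage := by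
  refine antitone_nat_of_succ_le fun e => powImage_le_iff.2 fun U m hm => ?_
  exact iterate_c_mem_powImage e (c_mem hm)

theorem powImage_mono (h : N₁ ≤ N₂) (e : ℕ) : N₁.powImage e ≤ N₂.powImage e :=
  powImage_le_iff.2 fun _ _ hm => iterate_c_mem_powImage e (h _ hm)

/-! ### Sums -/

theorem exists_pow_smul_mem_sup (hM : M.IsCartier) (h₁ : N₁.IsCartier) (h₂ : N₂.IsCartier)
    (hU : IsAffineOpen U) (f : Γ(X, U)) (m : Γ(M.toModules, U))
    (hm : M.toModules.res (X.basicOpen_le f) m ∈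
      N₁.carrier (X.basicOpen f) ⊔ N₂.carrier (X.basicOpen f)) :
    ∃ n : ℕ, f ^ n • m ∈ N₁.carrier U ⊔ N₂.carrier U := by
  obtain ⟨a, ha, b, hb, hab⟩ := Submodule.mem_sup.1 hm
  obtain ⟨n₁, t₁, ht₁, h₁⟩ := exists_lift_mem h₁ hU f ha
  obtain ⟨n₂, t₂, ht₂, h₂⟩ := exists_lift_mem h₂ hU f hb
  obtain ⟨k, hk⟩ := exists_pow_smul_eq_zero_of_isQuasicoherent hM hU f
    (f ^ (n₁ + n₂) • m - (f ^ n₂ • t₁ + f ^ n₁ • t₂)) (by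
      rw [map_sub, map_add, res_smul, res_smul, res_smul, h₁, h₂, ← hab, smul_smul, smul_smul,
        ← map_mul, ← map_mul, ← pow_add, ← pow_add, add_comm n₂ n₁, smul_add, sub_self])
  refine ⟨k + (n₁ + n₂), ?_⟩
  rw [smul_sub, sub_eq_zero, smul_smul, ← pow_add] at hk
  rw [hk]
  exact Submodule.smul_mem _ _ (Submodule.add_mem_sup (Submodule.smul_mem _ _ ht₁)
    (Submodule.smul_mem _ _ ht₂))

theorem sup_eq_ofLocal : N₁ ⊔ N₂ = ofLocal (fun U => N₁.carrier U ⊔ N₂.carrier U)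
    (by
      intro U V h m hm
      obtain ⟨a, ha, b, hb, rfl⟩ := Submodule.mem_sup.1 hm
      rw [map_add]
      exact Submodule.add_mem_sup (res_mem h ha) (res_mem h hb))
    (by
      intro U m hm
      obtain ⟨a, ha, b, hb, rfl⟩ := Submodule.mem_sup.1 hm
      rw [map_add]
      exact Submodule.add_mem_sup (c_mem ha) (c_mem hb)) := by
  refine le_antisymm (sup_le (fun U m hm => mem_ofLocal_of_mem (Submodule.mem_sup_left hm))
    (fun U m hm => mem_ofLocal_of_mem (Submodule.mem_sup_right hm))) fun U m hm => ?_
  refine mem_of_locally_res fun x hx => ?_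
  obtain ⟨V, i, hV, h⟩ := hm x hx
  refine ⟨V, i, hV, ?_⟩
  exact sup_le ((le_sup_left : N₁ ≤ N₁ ⊔ N₂) V) ((le_sup_right : N₂ ≤ N₁ ⊔ N₂) V) h

theorem mem_sup_iff (hM : M.IsCartier) (h₁ : N₁.IsCartier) (h₂ : N₂.IsCartier)
    (hU : IsAffineOpen U) : (N₁ ⊔ N₂).carrier U = N₁.carrier U ⊔ N₂.carrier U := by
  ext m
  rw [sup_eq_ofLocal]
  exact mem_ofLocal_iff (fun U hU f m => exists_pow_smul_mem_sup hM h₁ h₂ hU f m) hU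

theorem IsCartier.sup (hM : M.IsCartier) (h₁ : N₁.IsCartier) (h₂ : N₂.IsCartier) :
    (N₁ ⊔ N₂).IsCartier := by
  rw [sup_eq_ofLocal]
  exact isCartier_ofLocal (fun U hU f m => exists_pow_smul_mem_sup hM h₁ h₂ hU f m) hM

theorem PowLE.sup (hq : q ≠ 0) (hM : M.IsCartier) (h₁ : N₁.IsCartier) (h₂ : N₂.IsCartier)
    {e₁ e₂ : ℕ} (h₁' : PowLE N₁ N₃ e₁) (h₂' : PowLE N₂ N₃ e₂) : PowLE (N₁ ⊔ N₂) N₃ (e₁ + e₂) := by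
  refine .of_affine hq (h₁.sup hM h₂) fun U hU m hm => ?_
  rw [mem_sup_iff hM h₁ h₂ hU] at hm
  obtain ⟨a, ha, b, hb, rfl⟩ := Submodule.mem_sup.1 hm
  rw [iterate_map_add]
  exact add_mem (h₁'.mono (Nat.le_add_right _ _) U a ha) (h₂'.mono (Nat.le_add_left _ _) U b hb)

/-! ### Preimages and images under morphisms -/

/-- The preimage of a submodule. -/
def comap (f : Hom M M') (N : M'.Sub) : M.Sub where
  carrier U :=
    { carrier := {m | f.ap U m ∈ N.carrier U}
      zero_mem' := by
        rw [Set.mem_ofPred_eq, map_zero]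
        exact zero_mem _
      add_mem' := fun ha hb => by
        rw [Set.mem_ofPred_eq, map_add]
        exact add_mem ha hb
      smul_mem' := fun r m hm => by
        rw [Set.mem_ofPred_eq, Hom.ap_smul]
        exact Submodule.smul_mem _ _ hm }
  map_mem {U V} i m hm := by
    change f.ap V (M.toModules.res i.le m) ∈ N.carrier V
    rw [Hom.ap_res]
    exact res_mem i.le hm
  mem_of_locally {U} m hm := by
    refine mem_of_locally_res fun x hx => ?_
    obtain ⟨V, i, hV, h⟩ := hm x hx
    refine ⟨V, i.le, hV, ?_⟩
    rw [← f.ap_res]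
    exact h
  C_mem {U} m hm := by
    change f.ap U (M.c U m) ∈ N.carrier U
    rw [Hom.ap_c]
    exact c_mem hm

theorem mem_comap {f : Hom M M'} {N : M'.Sub} {m : Γ(M.toModules, U)} :
    m ∈ (comap f N).carrier U ↔ f.ap U m ∈ N.carrier U := Iff.rfl

theorem IsCartier.comap (hM : M.IsCartier) (hM' : M'.IsCartier) (f : Hom M M') {N : M'.Sub}
    (hN : N.IsCartier) : (comap f N).IsCartier := by
  rw [isCartier_iff hM]
  rw [isCartier_iff hM'] at hN
  intro U hU g m hm
  rw [mem_comap, f.ap_res] at hm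
  obtain ⟨n, hn⟩ := hN U hU g _ hm
  refine ⟨n, ?_⟩
  rw [mem_comap, f.ap_smul]
  exact hn

variable (N) in
/-- The restriction of a morphism to a submodule. -/
def mapLinear (f : Hom M M') : PowLinear N.toPreCartier.toModules M'.toModules 1 where
  app U := (f.ap U).comp (N.incl.ap U)
  app_res h m := f.ap_res h (N.incl.ap _ m)
  app_pow_smul r m := by
    rw [pow_one, AddMonoidHom.comp_apply, Hom.ap_smul, Hom.ap_smul, AddMonoidHom.comp_apply]

/-- The image sheaf of a submodule under a morphism. -/
def map (f : Hom M M') (N : M.Sub) : M'.Sub := image (N.mapLinear f) (by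
    rintro U _ ⟨m, rfl⟩
    exact ⟨N.toPreCartier.c U m, f.ap_c (N.incl.ap U m)⟩)

theorem ap_mem_map (f : Hom M M') {m : Γ(M.toModules, U)} (hm : m ∈ N.carrier U) :
    f.ap U m ∈ (map f N).carrier U :=
  mem_image_of_app (N.mapLinear f) _ ⟨m, hm⟩

theorem exists_of_mem_map {f : Hom M M'} {m : Γ(M'.toModules, U)} (hm : m ∈ (map f N).carrier U)
    {x : X} (hx : x ∈ U) : ∃ (V : X.Opens) (i : V ≤ U) (m' : Γ(M.toModules, V)), x ∈ V ∧
      m' ∈ N.carrier V ∧ f.ap V m' = M'.toModules.res i m := by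
  obtain ⟨V, i, hV, m', h⟩ := hm x hx
  exact ⟨V, i, m'.1, hV, m'.2, h⟩

theorem IsCartier.map (hM' : M'.IsCartier) (f : Hom M M') (hN : N.IsCartier) :
    (map f N).IsCartier :=
  isCartier_image _ _ one_ne_zero hN hM'

theorem map_le_iff (f : Hom M M') {N' : M'.Sub} : map f N ≤ N' ↔ N ≤ comap f N' := by
  refine ⟨fun h U m hm => h U (ap_mem_map f hm), fun h U m hm => ?_⟩
  refine mem_of_locally_res fun x hx => ?_
  obtain ⟨V, i, m', hV, hm', h1⟩ := exists_of_mem_map hm hx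
  refine ⟨V, i, hV, ?_⟩
  rw [← h1]
  exact h V hm'

theorem PowLE.map_le {f : Hom M M'} {N' : M'.Sub} {e : ℕ} (h : PowLE N (comap f N') e) :
    PowLE (map f N) N' e := by
  intro U m hm
  refine mem_of_locally_res fun x hx => ?_
  obtain ⟨V, i, m', hV, hm', h1⟩ := exists_of_mem_map hm hx
  refine ⟨V, i, hV, ?_⟩
  rw [← iterate_c_res, ← h1, ← f.ap_iterate_c]
  exact h V m' hm'

end Sub

end PreCartier

/-! ### Noetherian arguments and stable images -/

namespace PreCartier

variable {q : ℕ} {X : Scheme.{u}} {M M' : PreCartier q X}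

namespace Sub

variable {N N₁ N₂ N₃ P : M.Sub} {U V : X.Opens}

theorem exists_finite_affine_cover (X : Scheme.{u}) [CompactSpace X] :
    ∃ (ι : Type u) (_ : Finite ι) (W : ι → X.Opens), (∀ i, IsAffineOpen (W i)) ∧
      ∀ x, ∃ i, x ∈ W i := by
  obtain ⟨t, ht⟩ := isCompact_univ.elim_finite_subcover (fun U : X.affineOpens => (U.1 : Set X))
    (fun U => U.1.2) fun x _ => by
      obtain ⟨U, hU⟩ := exists_affine_nhd x
      exact Set.mem_iUnion.2 ⟨U, hU⟩
  refine ⟨t, inferInstance, fun i => i.1.1, fun i => i.1.2, fun x => ?_⟩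
  obtain ⟨U, hU, hx⟩ := Set.mem_iUnion₂.1 (ht (Set.mem_univ x))
  exact ⟨⟨U, hU⟩, hx⟩

theorem le_of_cover (hq : q ≠ 0) (h₁ : N₁.IsCartier) {ι : Type*}
    {W : ι → X.Opens} (hW : ∀ i, IsAffineOpen (W i)) (hc : ∀ x, ∃ i, x ∈ W i)
    (h : ∀ i, N₁.carrier (W i) ≤ N₂.carrier (W i)) : N₁ ≤ N₂ :=
  powLE_zero.1 (.of_cover hq h₁ hW hc h)

section Noetherian

variable [IsLocallyNoetherian X]

theorem isNoetherian_sections (hM : M.IsCoherent) (hU : IsAffineOpen U) :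
    IsNoetherian Γ(X, U) Γ(M.toModules, U) :=
  have : IsNoetherianRing Γ(X, U) := IsLocallyNoetherian.component_noetherian ⟨U, hU⟩
  have := hM.2 U hU
  inferInstance

theorem IsCartier.isCoherent (hM : M.IsCoherent) (hN : N.IsCartier) : N.toPreCartier.IsCoherent :=
  ⟨hN, fun U hU => by
    have := isNoetherian_sections hM hU
    change Module.Finite Γ(X, U) (N.carrier U)
    infer_instance⟩

variable [CompactSpace X]

/-- A set of Cartier submodules of a coherent Cartier module that is closed under finite sums has a
greatest element. -/
theorem exists_isGreatest (hq : q ≠ 0) (hM : M.IsCoherent) {S : Set M.Sub} (hne : S.Nonempty)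
    (hS : ∀ N ∈ S, N.IsCartier) (hsup : ∀ N₁ ∈ S, ∀ N₂ ∈ S, N₁ ⊔ N₂ ∈ S) : ∃ K, IsGreatest S K := by
  obtain ⟨ι, _, W, hW, hc⟩ := exists_finite_affine_cover X
  have (i : ι) := isNoetherian_sections hM (hW i)
  -- Comparisons with a Cartier submodule on the smaller side can be made on finitely many
  -- Noetherian modules of sections, whose product order has the ascending chain condition.
  let g (N : M.Sub) (i : ι) : (Submodule Γ(X, W i) Γ(M.toModules, W i))ᵒᵈ :=
    OrderDual.toDual (N.carrier (W i))
  obtain ⟨_, ⟨K, hK, rfl⟩, hmin⟩ := WellFounded.has_min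
    (wellFounded_lt (α := ∀ i : ι, (Submodule Γ(X, W i) Γ(M.toModules, W i))ᵒᵈ))
    (g '' S) (hne.image g)
  refine ⟨K, hK, fun N hN => ?_⟩
  have h1 : g (K ⊔ N) ≤ g K := fun i => (le_sup_left : K ≤ K ⊔ N) (W i)
  have h2 : g K ≤ g (K ⊔ N) := by
    by_contra h
    exact hmin _ ⟨_, hsup K hK N hN, rfl⟩ (lt_of_le_not_ge h1 h)
  exact le_sup_right.trans (le_of_cover hq (hS _ (hsup K hK N hN)) hW hc fun i => h2 i)

/-- The stable value of the chain `N ⊇ C (N) ⊇ C ^ 2 (N) ⊇ ⋯`. -/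
def core (N : M.Sub) : M.Sub := ⨅ e, N.powImage e

omit [IsLocallyNoetherian X] [CompactSpace X] in
theorem core_le (N : M.Sub) : N.core ≤ N := (iInf_le _ 0).trans (powImage_le 0)

omit [IsLocallyNoetherian X] [CompactSpace X] in
theorem core_mono (h : N₁ ≤ N₂) : N₁.core ≤ N₂.core := iInf_mono fun e => powImage_mono h e

/-- On each member of a finite affine cover this is `iterateRange_stabilizes`; the largest of the
finitely many exponents works globally. -/
theorem exists_core_eq (hq : 2 ≤ q) (hM : M.IsCoherent) (hN : N.IsCartier) :
    ∃ e₀, ∀ e, e₀ ≤ e → N.core = N.powImage e := by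
  have hq' : q ≠ 0 := by omega
  obtain ⟨ι, _, W, hW, hc⟩ := exists_finite_affine_cover X
  cases nonempty_fintype ι
  have h (i : ι) : ∃ e₀, ∀ e, (N.powImage e₀).carrier (W i) ≤ (N.powImage e).carrier (W i) := by
    have : IsNoetherianRing Γ(X, W i) := IsLocallyNoetherian.component_noetherian ⟨W i, hW i⟩
    have := (hN.isCoherent hM).2 (W i) (hW i)
    obtain ⟨e₀, h⟩ := iterateRange_stabilizes (R := Γ(X, W i)) (M := Γ(N.toPreCartier.toModules, W i))
      (C := N.toPreCartier.c (W i)) (fun r m => N.toPreCartier.c_smul r m) hq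
    refine ⟨e₀, fun e m hm => ?_⟩
    rw [mem_powImage hq' hM.1 hN (hW i)] at hm ⊢
    obtain ⟨m, hm, rfl⟩ := hm
    obtain ⟨m', hm'⟩ := h e ⟨⟨m, hm⟩, rfl⟩
    refine ⟨N.incl.ap _ m', m'.2, ?_⟩
    exact (coe_iterate_c e m').symm.trans
      ((congrArg (N.incl.ap _) hm').trans (coe_iterate_c e₀ ⟨m, hm⟩))
  choose E hE using h
  refine ⟨Finset.univ.sup E, fun e he => le_antisymm (iInf_le _ e) (le_iInf fun e' => ?_)⟩
  refine le_of_cover hq' (hN.powImage hq' hM.1 e) hW hc fun i => ?_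
  refine le_trans ?_ (hE i e')
  exact powImage_antitone ((Finset.le_sup (Finset.mem_univ i)).trans he) (W i)

theorem IsCartier.core (hq : 2 ≤ q) (hM : M.IsCoherent) (hN : N.IsCartier) : N.core.IsCartier := by
  obtain ⟨e₀, h⟩ := exists_core_eq hq hM hN
  rw [h e₀ le_rfl]
  exact hN.powImage (by omega) hM.1 e₀

theorem exists_powLE_core (hq : 2 ≤ q) (hM : M.IsCoherent) (hN : N.IsCartier) :
    ∃ e, PowLE N N.core e := by
  obtain ⟨e₀, h⟩ := exists_core_eq hq hM hN
  exact ⟨e₀, powImage_le_iff.1 (h e₀ le_rfl).ge⟩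

/-- The structural map of the submodule is an epimorphism. -/
def IsFull (N : M.Sub) : Prop := N ≤ N.powImage 1

omit [IsLocallyNoetherian X] [CompactSpace X] in
theorem IsFull.exists_iterate (hq : q ≠ 0) (hM : M.IsCartier) (hN : N.IsCartier) (h : N.IsFull)
    (hU : IsAffineOpen U) (e : ℕ) {m : Γ(M.toModules, U)} (hm : m ∈ N.carrier U) :
    ∃ m' ∈ N.carrier U, (M.c U)^[e] m' = m := by
  induction e generalizing m with
  | zero => exact ⟨m, hm, rfl⟩
  | succ e ih =>
    obtain ⟨m₁, hm₁, rfl⟩ := (mem_powImage hq hM hN hU).1 (h U hm)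
    obtain ⟨m₂, hm₂, rfl⟩ := ih hm₁
    exact ⟨m₂, hm₂, Function.iterate_succ_apply' _ _ _⟩

omit [IsLocallyNoetherian X] [CompactSpace X] in
theorem IsFull.le_core (hq : q ≠ 0) (hM : M.IsCartier) (hP : P.IsCartier) (h : P.IsFull)
    (hPN : P ≤ N) : P ≤ N.core := by
  refine le_iInf fun e => le_of_affine hq hP fun U hU m hm => ?_
  obtain ⟨m', hm', rfl⟩ := h.exists_iterate hq hM hP hU e hm
  exact iterate_c_mem_powImage e (hPN U hm')

omit [IsLocallyNoetherian X] [CompactSpace X] in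
theorem IsFull.core_eq (hq : q ≠ 0) (hM : M.IsCartier) (hP : P.IsCartier) (h : P.IsFull) :
    P.core = P := le_antisymm P.core_le (h.le_core hq hM hP le_rfl)

theorem isFull_core (hq : 2 ≤ q) (hM : M.IsCoherent) (hN : N.IsCartier) : N.core.IsFull := by
  have hq' : q ≠ 0 := by omega
  refine le_of_affine hq' (hN.core hq hM) fun U hU m hm => ?_
  obtain ⟨e₀, h⟩ := exists_core_eq hq hM hN
  -- The extra iterate exhibits a section of the core as `C` of a section of `C ^ e₀ (N)`, which is
  -- the core again.
  rw [h (e₀ + 1) (by omega), mem_powImage hq' hM.1 hN hU] at hm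
  obtain ⟨m, hm, rfl⟩ := hm
  rw [Function.iterate_succ_apply']
  refine iterate_c_mem_powImage 1 ?_
  rw [h e₀ le_rfl]
  exact iterate_c_mem_powImage e₀ hm

theorem core_core (hq : 2 ≤ q) (hM : M.IsCoherent) (hN : N.IsCartier) : N.core.core = N.core :=
  (isFull_core hq hM hN).core_eq (by omega) hM.1 (hN.core hq hM)

/-- The passage from nilpotence to order: inclusion up to a power of `C` becomes inclusion of stable
images. For the converse, a section of the full submodule `N₁.core` is `C ^ e` of another one. -/
theorem core_le_core_iff (hq : 2 ≤ q) (hM : M.IsCoherent) (h₁ : N₁.IsCartier) :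
    N₁.core ≤ N₂.core ↔ ∃ e, PowLE N₁ N₂ e := by
  have hq' : q ≠ 0 := by omega
  refine ⟨fun h => ?_, fun ⟨e, he⟩ => ?_⟩
  · obtain ⟨e, he⟩ := exists_powLE_core hq hM h₁
    exact ⟨_, he.trans (.of_le (h.trans N₂.core_le) 0)⟩
  · refine (isFull_core hq hM h₁).le_core hq' hM.1 (h₁.core hq hM) ?_
    refine le_of_affine hq' (h₁.core hq hM) fun U hU m hm => ?_
    obtain ⟨m', hm', rfl⟩ := (isFull_core hq hM h₁).exists_iterate hq' hM.1 (h₁.core hq hM) hU e hm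
    exact he U m' (N₁.core_le U hm')

omit [IsLocallyNoetherian X] [CompactSpace X] in
theorem IsFull.sup (h₁ : N₁.IsFull) (h₂ : N₂.IsFull) : (N₁ ⊔ N₂).IsFull :=
  sup_le (h₁.trans (powImage_mono le_sup_left 1)) (h₂.trans (powImage_mono le_sup_right 1))

/-- The sum of the two cores is full, hence its own core, and a power of `C` maps `N₁ + N₂` into it.
-/
theorem core_sup (hq : 2 ≤ q) (hM : M.IsCoherent) (h₁ : N₁.IsCartier) (h₂ : N₂.IsCartier) :
    (N₁ ⊔ N₂).core = N₁.core ⊔ N₂.core := by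
  have hq' : q ≠ 0 := by omega
  refine le_antisymm ?_ (sup_le (core_mono le_sup_left) (core_mono le_sup_right))
  have hs := (h₁.core hq hM).sup hM.1 (h₂.core hq hM)
  rw [← ((isFull_core hq hM h₁).sup (isFull_core hq hM h₂)).core_eq hq' hM.1 hs,
    core_le_core_iff hq hM (h₁.sup hM.1 h₂)]
  obtain ⟨e₁, he₁⟩ := exists_powLE_core hq hM h₁
  obtain ⟨e₂, he₂⟩ := exists_powLE_core hq hM h₂
  exact ⟨_, PowLE.sup hq' hM.1 h₁ h₂ (he₁.trans (.of_le le_sup_left 0))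
    (he₂.trans (.of_le le_sup_right 0))⟩

end Noetherian

end Sub

end PreCartier

/-! ### Morphisms, quotients and the minimal Cartier module -/

namespace PreCartier

variable {q : ℕ} {X : Scheme.{u}} {M N L : PreCartier q X}

namespace Hom

/-- Composition of morphisms. -/
def comp (f : Hom M N) (g : Hom N L) : Hom M L where
  toHom := f.toHom ≫ g.toHom
  comm U m := (congrArg (g.toHom.app U) (f.comm U m)).trans (g.comm U (f.toHom.app U m))

theorem ap_comp (f : Hom M N) (g : Hom N L) (U : X.Opens) (m : Γ(M.toModules, U)) :
    (f.comp g).ap U m = g.ap U (f.ap U m) := rfl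

theorem LocallySurjective.comp {f : Hom M N} {g : Hom N L} (hf : f.LocallySurjective)
    (hg : g.LocallySurjective) : (f.comp g).LocallySurjective := by
  intro U s x hx
  obtain ⟨V, i, hV, n, hn⟩ := hg U s x hx
  obtain ⟨W, j, hW, m, hm⟩ := hf V n x hV
  exact ⟨W, j.trans i, hW, m, by rw [ap_comp, hm, ap_res, hn, res_res]⟩

/-- The kernel of a morphism. -/
def ker (f : Hom M N) : M.Sub := Sub.comap f ⊥

theorem mem_ker {f : Hom M N} {U : X.Opens} {m : Γ(M.toModules, U)} :
    m ∈ f.ker.carrier U ↔ f.ap U m = 0 := Iff.rfl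

/-- A section of `N` in the image that vanishes on `D(g)` comes from one of `M` lying in the kernel
there; quasi-coherence of the kernel supplies the power of `g`. -/
theorem LocallySurjective.isCartier {f : Hom M N} (hf : f.LocallySurjective) (hM : M.IsCartier)
    (hk : f.ker.IsCartier) : N.IsCartier := by
  refine PowLinear.isQuasicoherent_of_locally_surjective (φ := f.powLinear) one_ne_zero hM ?_ hf
  intro U hU g m hm
  replace hm : f.ap _ (M.toModules.res (X.basicOpen_le g) m) = 0 := (f.ap_res _ m).trans hm
  obtain ⟨n, hn⟩ := (Sub.isCartier_iff hM).1 hk U hU g m hm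
  exact ⟨n, (f.ap_smul _ m).symm.trans hn⟩

theorem LocallySurjective.isCoherent {f : Hom M N} (hf : f.LocallySurjective) (hM : M.IsCoherent)
    (hk : f.ker.IsCartier) : N.IsCoherent := by
  have hN := hf.isCartier hM.1 hk
  refine ⟨hN, fun U hU => ?_⟩
  have := hM.2 U hU
  let g : Γ(M.toModules, U) →ₗ[Γ(X, U)] Γ(N.toModules, U) :=
    { f.ap U with map_smul' := fun r m => f.ap_smul r m }
  exact Module.Finite.of_surjective g (hf.surjective hM.1 hN hU)

theorem LocallySurjective.isNilpotent_iff {f : Hom M N} (hf : f.LocallySurjective) :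
    N.IsNilpotent ↔ ∃ e, Sub.PowLE ⊤ f.ker e := by
  rw [PreCartier.isNilpotent_iff]
  refine exists_congr fun e => ⟨fun h U m _ => ?_, fun h U s => ?_⟩
  · rw [mem_ker, ap_iterate_c, h]
  · refine eq_of_locally _ fun x hx => ?_
    obtain ⟨V, i, hV, m, hm⟩ := hf U s x hx
    refine ⟨V, i, hV, ?_⟩
    rw [← iterate_c_res, ← hm, ← ap_iterate_c, map_zero]
    exact h V m trivial

/-- Restriction of the target of a morphism. -/
def codRestrict (f : Hom M N) (K : N.Sub) (h : ∀ U m, f.ap U m ∈ K.carrier U) :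
    Hom M K.toPreCartier where
  toHom := SheafOfModules.Hom.mk (X := M.toModules) (Y := K.toModules)
    (PresheafOfModules.homMk
      { app := fun U => AddCommGrpCat.ofHom ((f.ap U.unop).codRestrict
          (K.carrier U.unop).toAddSubgroup (fun m => h U.unop m))
        naturality := by
          intro U V i
          ext m
          exact Subtype.ext (f.ap_res i.unop.le m) }
      (fun U r m => Subtype.ext (f.ap_smul r m)))
  comm U m := Subtype.ext (f.ap_c m)

end Hom

namespace Sub

variable {K K₁ K₂ A B P : M.Sub} {U V : X.Opens}

/-- A section of `M` that lies in `K`, as a section of `K`. -/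
def lift {m : Γ(M.toModules, U)} (hm : m ∈ K.carrier U) : Γ(K.toPreCartier.toModules, U) := ⟨m, hm⟩

@[simp]
theorem incl_lift {m : Γ(M.toModules, U)} (hm : m ∈ K.carrier U) : K.incl.ap U (lift hm) = m := rfl

theorem incl_mem (m : Γ(K.toPreCartier.toModules, U)) : K.incl.ap U m ∈ K.carrier U := m.2

theorem incl_injective : Function.Injective (K.incl.ap U) := Subtype.val_injective

variable (K) in
/-- The projection to the quotient. -/
def proj : Hom M K.quot where
  toHom := SheafOfModules.Hom.mk (X := M.toModules) (Y := K.quotModules)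
    (PresheafOfModules.homMk
      { app := fun U => AddCommGrpCat.ofHom (K.toQuot U.unop).toAddMonoidHom
        naturality := by
          intro U V i
          ext m
          exact NatTrans.naturality_apply (CategoryTheory.toSheafify
            (Opens.grothendieckTopology X) K.quotPre.presheaf) i ((K.toPre.obj U).mkQ m) }
      (fun U r m => LinearMap.map_smul (K.toQuot U.unop) r m))
  comm _ m := (K.quotC_toQuot m).symm

theorem proj_ap (m : Γ(M.toModules, U)) : K.proj.ap U m = K.toQuot U m := rfl

theorem locallySurjective_proj : K.proj.LocallySurjective := by
  intro U s x hx
  obtain ⟨V, i, m, hV, hm⟩ := K.exists_toQuot_eq s x hx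
  exact ⟨V, i.le, hV, m, hm⟩

/-- Sheafification is locally injective, so a section that dies in the quotient lies in `K` locally,
hence globally. -/
theorem ker_proj : K.proj.ker = K := by
  ext U m
  rw [Hom.mem_ker, proj_ap]
  refine ⟨fun h => ?_, fun h => ?_⟩
  · refine mem_of_locally_res fun x hx => ?_
    have h1 := Presheaf.equalizerSieve_mem (Opens.grothendieckTopology X)
      (CategoryTheory.toSheafify (Opens.grothendieckTopology X) K.quotPre.presheaf)
      (X := op U) ((K.toPre.obj (op U)).mkQ m) 0 (h.trans (map_zero _).symm)
    obtain ⟨V, i, hi, hV⟩ := h1 x hx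
    refine ⟨V, i.le, hV, ?_⟩
    have h2 := hi.trans (map_zero _)
    exact (Submodule.Quotient.mk_eq_zero _).1 h2
  · exact (congrArg _ ((Submodule.Quotient.mk_eq_zero _).2 h)).trans
      (map_zero ((CategoryTheory.toSheafify (Opens.grothendieckTopology X)
        K.quotPre.presheaf).app (op U)).hom)

theorem isCartier_quot (hM : M.IsCartier) (hK : K.IsCartier) : K.quot.IsCartier :=
  locallySurjective_proj.isCartier hM (by rwa [ker_proj])

theorem isNilpotent_quot_iff : K.quot.IsNilpotent ↔ ∃ e, PowLE ⊤ K e := by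
  rw [locallySurjective_proj.isNilpotent_iff, ker_proj]

theorem mem_inside {m : Γ(B.toPreCartier.toModules, U)} :
    m ∈ (A.inside B).carrier U ↔ B.incl.ap U m ∈ A.carrier U := Iff.rfl

theorem inside_eq_comap : A.inside B = comap B.incl A := rfl

theorem mem_stableImage {m : Γ(M.toModules, U)} : m ∈ M.stableImage.carrier U ↔
    ∀ (e : ℕ), ∀ x ∈ U, ∃ (V : X.Opens) (i : V ≤ U), x ∈ V ∧
      ∃ m', (M.c V)^[e] m' = M.toModules.res i m := by
  refine mem_iInf.trans (forall_congr' fun e => forall₂_congr fun x hx => ⟨?_, ?_⟩)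
  · rintro ⟨V, i, hV, m', h⟩
    exact ⟨V, i.le, hV, m', (M.powC_app e V m').symm.trans h⟩
  · rintro ⟨V, i, hV, m', h⟩
    exact ⟨V, homOfLE i, hV, m', (M.powC_app e V m').trans h⟩

theorem isNilpotent_subquot_iff : (B.subquot A).IsNilpotent ↔ ∃ e, PowLE B A e := by
  refine isNilpotent_quot_iff.trans (exists_congr fun e => ⟨fun h U m hm => ?_, fun h U m _ => ?_⟩)
  · have := h U (lift hm) trivial
    rwa [mem_inside, coe_iterate_c, incl_lift] at this
  · rw [mem_inside, coe_iterate_c]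
    exact h U _ (incl_mem m)

theorem mem_map_incl {K : B.toPreCartier.Sub} {m : Γ(B.toPreCartier.toModules, U)} :
    B.incl.ap U m ∈ (map B.incl K).carrier U ↔ m ∈ K.carrier U := by
  refine ⟨fun h => mem_of_locally_res fun x hx => ?_, ap_mem_map B.incl⟩
  obtain ⟨V, i, m', hV, hm', h⟩ := exists_of_mem_map h hx
  rw [← B.incl.ap_res] at h
  refine ⟨V, i, hV, ?_⟩
  rwa [← incl_injective h]

theorem map_incl_le {K : B.toPreCartier.Sub} : map B.incl K ≤ B :=
  (map_le_iff _).2 fun _ m _ => m.2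

theorem exists_affine_le {x : X} (hx : x ∈ U) : ∃ V ≤ U, IsAffineOpen V ∧ x ∈ V := by
  obtain ⟨W, hW⟩ := exists_affine_nhd x
  obtain ⟨f, hxf, hf⟩ := exists_basicOpen_le W.2 (inf_le_right : U ⊓ W.1 ≤ W.1) ⟨hx, hW⟩
  exact ⟨_, hf.trans inf_le_left, W.2.basicOpen f, hxf⟩

variable [IsLocallyNoetherian X] [CompactSpace X]

/-- The sum of all nilpotent Cartier submodules of a coherent Cartier module is the greatest
nilpotent Cartier submodule. -/
theorem isGreatest_nil (hq : q ≠ 0) (hM : M.IsCoherent) :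
    IsGreatest {K : M.Sub | K.IsCartier ∧ K.toPreCartier.IsNilpotent} M.nil := by
  obtain ⟨K, hK⟩ := exists_isGreatest hq hM
    (S := {K : M.Sub | K.IsCartier ∧ K.toPreCartier.IsNilpotent})
    ⟨⊥, isCartier_bot hM.1, isNilpotent_iff_powLE.2 ⟨0, fun _ _ h => h⟩⟩ (fun _ h => h.1) (by
      rintro K₁ ⟨h₁, h₁'⟩ K₂ ⟨h₂, h₂'⟩
      obtain ⟨e₁, h₁'⟩ := isNilpotent_iff_powLE.1 h₁'
      obtain ⟨e₂, h₂'⟩ := isNilpotent_iff_powLE.1 h₂'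
      exact ⟨h₁.sup hM.1 h₂, isNilpotent_iff_powLE.2 ⟨_, h₁'.sup hq hM.1 h₁ h₂ h₂'⟩⟩)
  have : M.nil = K := hK.isLUB.sSup_eq
  rwa [this]

/-- The Cartier submodules of `P` that some power of `C` maps into `A`. -/
def absorbed (P A : M.Sub) : Set M.Sub := {K | K.IsCartier ∧ K ≤ P ∧ ∃ e, PowLE K A e}

theorem exists_isGreatest_absorbed (hq : q ≠ 0) (hM : M.IsCoherent) (P A : M.Sub) :
    ∃ K, IsGreatest (absorbed P A) K := by
  refine exists_isGreatest hq hM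
    ⟨⊥, isCartier_bot hM.1, bot_le, 0, powLE_zero.2 bot_le⟩ (fun _ h => h.1) ?_
  rintro K₁ ⟨h₁, hP₁, e₁, he₁⟩ K₂ ⟨h₂, hP₂, e₂, he₂⟩
  exact ⟨h₁.sup hM.1 h₂, sup_le hP₁ hP₂, _, he₁.sup hq hM.1 h₁ h₂ he₂⟩

/-- If `P` is a full Cartier submodule of `B` and `C ^ e (B) ⊆ P + A`, then `(B / A)_min` is a
quotient of `P`. -/
theorem exists_hom_min (hq : q ≠ 0) (hM : M.IsCoherent) (hA : A.IsCartier) (hB : B.IsCartier)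
    (hP : P.IsCartier) (hPf : P.IsFull) (hPB : P ≤ B) {e : ℕ}
    (he : PowLE B (P ⊔ A) e) (hK : IsGreatest (absorbed P A) K) :
    ∃ f : Hom P.toPreCartier (B.subquot A).min, f.LocallySurjective ∧ f.ker = K.inside P := by
  have hAB : (A.inside B).IsCartier := IsCartier.comap hB hM.1 B.incl hA
  let F := B.subquot A
  have hF : F.IsCartier := isCartier_quot hB hAB
  let π : Hom B.toPreCartier F := (A.inside B).proj
  have hπ : π.LocallySurjective := locallySurjective_proj
  have hπk : π.ker = A.inside B := ker_proj
  let g : Hom P.toPreCartier F := (P.incl.codRestrict B fun U m => hPB U m.2).comp π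
  have hg {U : X.Opens} (m : Γ(P.toPreCartier.toModules, U)) :
      g.ap U m = 0 ↔ P.incl.ap U m ∈ A.carrier U := by
    have : g.ker = comap (P.incl.codRestrict B fun U m => hPB U m.2) π.ker := rfl
    rw [← Hom.mem_ker, this, hπk]
    rfl
  let S := F.stableImage
  -- As `P` is full, every section of `P` over an affine open is a value of `C ^ e` for each `e`, so
  -- the map lands in the stable image.
  have hgS (U : X.Opens) (m : Γ(P.toPreCartier.toModules, U)) : g.ap U m ∈ S.carrier U := by
    refine mem_stableImage.2 fun e x hx => ?_
    obtain ⟨V, hVU, hV, hxV⟩ := exists_affine_le hx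
    obtain ⟨m', hm', h⟩ := hPf.exists_iterate hq hM.1 hP hV e (P.res_mem hVU (incl_mem m))
    refine ⟨V, hVU, hxV, g.ap V (lift hm'), ?_⟩
    rw [← g.ap_iterate_c, ← g.ap_res]
    congr 1
    apply incl_injective
    rw [coe_iterate_c, incl_lift, Hom.ap_res, h]
  let f₀ := g.codRestrict S hgS
  have hf₀g {U : X.Opens} (m : Γ(P.toPreCartier.toModules, U)) :
      S.incl.ap U (f₀.ap U m) = g.ap U m := rfl
  -- A section of the stable image is locally `C ^ e` of a class from `B`, and `C ^ e (B) ⊆ P + A`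
  -- replaces it by one from `P`.
  have hf₀ : f₀.LocallySurjective := by
    intro U s x hx
    obtain ⟨V, i, hV, s', hs'⟩ := mem_stableImage.1 (incl_mem s) e x hx
    obtain ⟨W, j, hW, b, hb⟩ := hπ V s' x hV
    obtain ⟨W', hW'W, hW'a, hW'⟩ := exists_affine_le hW
    have h1 := he W' _ (B.res_mem hW'W (incl_mem b))
    rw [mem_sup_iff hM.1 hP hA hW'a] at h1
    obtain ⟨p, hp, a, ha, hpa⟩ := Submodule.mem_sup.1 h1
    refine ⟨W', (hW'W.trans j).trans i, hW', lift hp, incl_injective ?_⟩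
    have h2 : F.toModules.res ((hW'W.trans j).trans i) (S.incl.ap U s) =
        π.ap W' ((B.toPreCartier.c W')^[e] (B.toPreCartier.toModules.res hW'W b)) := by
      rw [Hom.ap_iterate_c, Hom.ap_res, hb, res_res, ← res_res F.toModules i,
        ← hs', ← iterate_c_res]
    rw [S.incl.ap_res, h2, hf₀g]
    change π.ap W' (lift (hPB W' hp)) = _
    rw [← sub_eq_zero, ← map_sub, ← Hom.mem_ker, hπk, mem_inside, map_sub, coe_iterate_c,
      incl_lift, Hom.ap_res, ← hpa, sub_add_cancel_left]
    exact neg_mem ha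
  have hk₀ : f₀.ker = A.inside P := by
    ext U m
    rw [Hom.mem_ker, mem_inside, ← hg, ← hf₀g]
    exact ⟨fun h => by rw [h, map_zero], fun h => incl_injective (h.trans (map_zero _).symm)⟩
  have hPc := hP.isCoherent hM
  have hS : S.toPreCartier.IsCoherent := hf₀.isCoherent hPc (by
    rw [hk₀]
    exact IsCartier.comap hP hM.1 P.incl hA)
  have hnil := isGreatest_nil hq hS
  -- The preimage of the nilpotent part is absorbed by `A`, so it lies in `K`. Conversely a power of
  -- `C` maps `K` into `A ∩ P`, the kernel of `f₀`, so the image of `K` is nilpotent.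
  have hk : (f₀.comp S.toPreCartier.nil.proj).ker = K.inside P := by
    have : (f₀.comp S.toPreCartier.nil.proj).ker = comap f₀ S.toPreCartier.nil.proj.ker := rfl
    rw [this, ker_proj]
    refine le_antisymm (fun U m hm => ?_) ?_
    · refine (show map P.incl (comap f₀ S.toPreCartier.nil) ≤ K from hK.2 ⟨?_, map_incl_le, ?_⟩) U
        (mem_map_incl.2 hm)
      · exact IsCartier.map hM.1 _ (IsCartier.comap hP hS.1 f₀ hnil.1.1)
      · obtain ⟨e', he'⟩ := isNilpotent_iff_powLE.1 hnil.1.2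
        refine ⟨e', PowLE.map_le fun U m hm => ?_⟩
        rw [← inside_eq_comap, ← hk₀, Hom.mem_ker, Hom.ap_iterate_c]
        exact he' U _ hm
    · rw [← map_le_iff]
      refine hnil.2 ⟨IsCartier.map hS.1 _ (IsCartier.comap hP hM.1 P.incl hK.1.1), ?_⟩
      obtain ⟨e', he'⟩ := hK.1.2.2
      refine isNilpotent_iff_powLE.2 ⟨e', PowLE.map_le fun U m hm => ?_⟩
      change _ ∈ f₀.ker.carrier U
      rw [hk₀, mem_inside, coe_iterate_c]
      exact he' U _ hm
  exact ⟨f₀.comp S.toPreCartier.nil.proj, hf₀.comp locallySurjective_proj, hk⟩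

end Sub

end PreCartier

/-! ### Isomorphism theorems up to nilpotence -/

namespace PreCartier

variable {q : ℕ} {X : Scheme.{u}} {M N N' : PreCartier q X}

namespace Hom

theorem LocallySurjective.epi {f : Hom M N} (hf : f.LocallySurjective) : Epi f.toHom where
  left_cancellation {Z} g h hgh := by
    ext U s
    refine eq_of_locally Z fun x hx => ?_
    obtain ⟨V, i, hV, m, hm⟩ := hf U s x hx
    refine ⟨V, i, hV, ?_⟩
    have h1 (g : N.toModules ⟶ Z) : Z.res i (g.app U s) = (f.toHom ≫ g).app V m := by
      refine (NatTrans.naturality_apply g.mapPresheaf (homOfLE i).op s).symm.trans ?_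
      exact (congrArg (g.app V) hm).symm
    exact (h1 g).trans ((congr(($hgh).app V m)).trans (h1 h).symm)

/-- A morphism that kills the kernel of a locally surjective morphism factors through it. -/
theorem LocallySurjective.exists_factor {f : Hom M N} (hf : f.LocallySurjective) (g : Hom M N')
    (h : f.ker ≤ g.ker) : ∃ g' : Hom N N', ∀ U m, g'.ap U (f.ap U m) = g.ap U m := by
  have := hf.epi
  have h0 : Limits.kernel.ι f.toHom ≫ g.toHom = 0 := by
    ext U m
    have h1 := congr(($(Limits.kernel.condition f.toHom)).app U m)
    exact Sub.le_def.1 h U ((Limits.kernel.ι f.toHom).app U m) h1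
  let g' : N.toModules ⟶ N'.toModules := Abelian.epiDesc f.toHom g.toHom h0
  have hg' (U : X.Opens) (m : Γ(M.toModules, U)) : g'.app U (f.ap U m) = g.ap U m :=
    congr(($(Abelian.comp_epiDesc f.toHom g.toHom h0)).app U m)
  refine ⟨⟨g', fun U s => eq_of_locally _ fun x hx => ?_⟩, hg'⟩
  obtain ⟨V, i, hV, m, hm⟩ := hf U s x hx
  refine ⟨V, i, hV, ?_⟩
  have h1 (s : Γ(N.toModules, U)) : N'.toModules.res i (g'.app U s) =
      g'.app V (N.toModules.res i s) :=
    (NatTrans.naturality_apply g'.mapPresheaf (homOfLE i).op s).symm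
  change N'.toModules.res i (g'.app U (N.c U s)) = N'.toModules.res i (N'.c U (g'.app U s))
  rw [← c_res, h1, h1, ← c_res, ← hm, ← ap_c, hg', hg', ap_c]

theorem LocallySurjective.nonempty_iso {f : Hom M N} {f' : Hom M N'} (hf : f.LocallySurjective)
    (hf' : f'.LocallySurjective) (h : f.ker = f'.ker) : Nonempty (N ≅ N') := by
  obtain ⟨g, hg⟩ := hf.exists_factor f' h.le
  obtain ⟨g', hg'⟩ := hf'.exists_factor f h.ge
  have key {L : PreCartier q X} {f : Hom M L} (hf : f.LocallySurjective) (k : Hom L L)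
      (hk : ∀ U m, k.ap U (f.ap U m) = f.ap U m) : k.toHom = 𝟙 _ := by
    have := hf.epi
    rw [← cancel_epi f.toHom]
    ext U m
    exact hk U m
  exact ⟨{ hom := g
           inv := g'
           hom_inv_id := Hom.ext (key hf (g.comp g') fun U m => by rw [ap_comp, hg, hg'])
           inv_hom_id := Hom.ext (key hf' (g'.comp g) fun U m => by rw [ap_comp, hg', hg]) }⟩

end Hom

namespace Sub

variable {K A B P : M.Sub} {U V : X.Opens}

/-- Submodules of `P` see `A` only through `A ⊓ P`, and only up to a power of `C`. -/
theorem absorbed_congr {A A' P : M.Sub} (h : ∃ e, PowLE (A ⊓ P) A' e)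
    (h' : ∃ e, PowLE (A' ⊓ P) A e) : absorbed P A = absorbed P A' := by
  have key {A A' : M.Sub} (h : ∃ e, PowLE (A ⊓ P) A' e) : absorbed P A ⊆ absorbed P A' := by
    rintro K ⟨hK, hKP, e, he⟩
    obtain ⟨e', he'⟩ := h
    refine ⟨hK, hKP, e' + e, PowLE.trans (fun U m hm => ?_) he'⟩
    exact mem_inf.2 ⟨he U m hm, iterate_c_mem e (hKP U hm)⟩
  exact (key h).antisymm (key h')

variable [IsLocallyNoetherian X] [CompactSpace X]

/-- Two subquotients of a coherent Cartier module that are quotients of the same full submodule `P`,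
up to nilpotence, give isomorphic minimal Cartier modules. -/
theorem nonempty_iso_min (hq : q ≠ 0) (hM : M.IsCoherent) {A A' B B' : M.Sub} (hA : A.IsCartier)
    (hB : B.IsCartier) (hA' : A'.IsCartier) (hB' : B'.IsCartier) (hP : P.IsCartier)
    (hPf : P.IsFull) (hPB : P ≤ B) (hPB' : P ≤ B') (h : ∃ e, PowLE B (P ⊔ A) e)
    (h' : ∃ e, PowLE B' (P ⊔ A') e) (hAA' : ∃ e, PowLE (A ⊓ P) A' e)
    (hAA : ∃ e, PowLE (A' ⊓ P) A e) : Nonempty ((B.subquot A).min ≅ (B'.subquot A').min) := by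
  obtain ⟨e, h⟩ := h
  obtain ⟨e', h'⟩ := h'
  obtain ⟨K, hK⟩ := exists_isGreatest_absorbed hq hM P A
  obtain ⟨f, hf, hfk⟩ := exists_hom_min hq hM hA hB hP hPf hPB h hK
  obtain ⟨f', hf', hfk'⟩ := exists_hom_min hq hM hA' hB' hP hPf hPB' h'
    (absorbed_congr hAA' hAA ▸ hK)
  exact hf.nonempty_iso hf' (hfk.trans hfk'.symm)

/-- Both sides are quotients of the full submodule `B.core`, and `A` differs from `A.core` only up
to a power of `C`. -/
theorem nonempty_iso_min_core (hq : 2 ≤ q) (hM : M.IsCoherent) (hA : A.IsCartier)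
    (hB : B.IsCartier) :
    Nonempty ((B.subquot A).min ≅ (B.core.subquot A.core).min) := by
  obtain ⟨e, he⟩ := exists_powLE_core hq hM hB
  obtain ⟨e', he'⟩ := exists_powLE_core hq hM hA
  exact nonempty_iso_min (by omega) hM hA hB (hA.core hq hM) (hB.core hq hM) (hB.core hq hM)
    (isFull_core hq hM hB) B.core_le le_rfl ⟨_, he.trans (.of_le le_sup_left 0)⟩
    ⟨0, .of_le le_sup_left 0⟩ ⟨_, PowLE.trans (.of_le inf_le_left 0) he'⟩
    ⟨0, .of_le (inf_le_left.trans A.core_le) 0⟩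

/-- The second isomorphism theorem, up to nilpotence. -/
theorem nonempty_iso_min_sup (hq : 2 ≤ q) (hM : M.IsCoherent) (hA : A.IsCartier)
    (hB : B.IsCartier) (hBf : B.IsFull) :
    Nonempty (((A ⊔ B).subquot A).min ≅ (B.subquot (A ⊓ B).core).min) := by
  have hAB := hA.inf hM.1 hB
  obtain ⟨e, he⟩ := exists_powLE_core hq hM hAB
  exact nonempty_iso_min (by omega) hM hA (hA.sup hM.1 hB) (hAB.core hq hM) hB hB hBf
    le_sup_right le_rfl ⟨0, .of_le (sup_comm A B).le 0⟩ ⟨0, .of_le le_sup_left 0⟩ ⟨e, he⟩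
    ⟨0, .of_le (inf_le_left.trans ((core_le _).trans inf_le_left)) 0⟩

/-- If there is no full Cartier submodule strictly between the stable images of `A` and `B`, then
`(B / A)_min` is minimal and simple. -/
theorem isMinimal_and_isSimple_min (hq : 2 ≤ q) (hM : M.IsCoherent) (hA : A.IsCartier)
    (hB : B.IsCartier) (hAB : A ≤ B) (hne : ¬ B.core ≤ A.core)
    (h : ∀ P : M.Sub, P.IsCartier → P.IsFull → A.core ≤ P → P ≤ B.core → P = A.core ∨ P = B.core) :
    (B.subquot A).min.IsMinimal ∧ (B.subquot A).min.IsSimple := by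
  have hq' : q ≠ 0 := by omega
  have hAc := hA.core hq hM
  have hBc := hB.core hq hM
  obtain ⟨K, hK⟩ := exists_isGreatest_absorbed hq' hM B.core A
  obtain ⟨e, he⟩ := exists_powLE_core hq hM hB
  obtain ⟨Q, hQ', f, hf, hfk⟩ : ∃ Q, (B.subquot A).min = Q ∧ ∃ f : Hom B.core.toPreCartier Q,
      f.LocallySurjective ∧ f.ker = K.inside B.core :=
    ⟨_, rfl, exists_hom_min hq' hM hA hB hBc (isFull_core hq hM hB) B.core_le
      (he.trans (.of_le le_sup_left 0)) hK⟩
  rw [hQ']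
  have hQ : Q.IsCartier := hf.isCartier hBc (by
    rw [hfk]
    exact IsCartier.comap hBc hM.1 B.core.incl hK.1.1)
  have hAK : A.core ≤ K := hK.2 ⟨hAc, core_mono hAB, 0, A.core_le⟩
  -- A Cartier submodule `N` of the quotient corresponds to `N'` between `K` and `B.core`; the full
  -- submodule `N'.core ⊔ A.core` must be one of the two ends.
  have hsimple (N : Q.Sub) (hN : N.IsCartier) : N = ⊥ ∨ N = ⊤ := by
    let N' : M.Sub := map B.core.incl (comap f N)
    have hN' : N'.IsCartier := IsCartier.map hM.1 _ (IsCartier.comap hBc hQ f hN)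
    have hN'B : N' ≤ B.core := map_incl_le
    have hN'N : (U : X.Opens) → (m : Γ(B.core.toPreCartier.toModules, U)) →
      (B.core.incl.ap U m ∈ N'.carrier U ↔ f.ap U m ∈ N.carrier U) := fun U m => mem_map_incl
    have hfm {U : X.Opens} (m : Γ(B.core.toPreCartier.toModules, U)) :
        f.ap U m = 0 ↔ B.core.incl.ap U m ∈ K.carrier U := by
      rw [← Hom.mem_ker, hfk, mem_inside]
    have hKN' : K ≤ N' := fun U m hm => (hN'N U (lift (hK.1.2.1 U hm))).2 (by
      rw [(hfm _).2 hm]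
      exact zero_mem _)
    have hloc {N₁ : Q.Sub} (hN₁ : ∀ U m, f.ap U m ∈ N.carrier U → f.ap U m ∈ N₁.carrier U) :
        N ≤ N₁ := fun U s hs => mem_of_locally_res fun x hx => by
      obtain ⟨V, i, hV, m, hm⟩ := hf U s x hx
      refine ⟨V, i, hV, ?_⟩
      have := N.res_mem i hs
      rw [← hm] at this ⊢
      exact hN₁ V m this
    obtain h1 | h1 := h (N'.core ⊔ A.core) ((hN'.core hq hM).sup hM.1 hAc)
      ((isFull_core hq hM hN').sup (isFull_core hq hM hA)) le_sup_right
      (sup_le ((core_le _).trans hN'B) (core_mono hAB))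
    -- At the lower end, a power of `C` maps `N'` into `A`, so the maximality of `K` gives `N' ≤ K`.
    · left
      obtain ⟨e', he'⟩ := (core_le_core_iff hq hM hN').1 (le_sup_left.trans h1.le)
      have hN'K : N' ≤ K := hK.2 ⟨hN', hN'B, e', he'⟩
      refine le_bot_iff.1 (hloc fun U m hm => ?_)
      exact (hfm m).2 (hN'K U ((hN'N U m).2 hm))
    · right
      have hBN' : B.core ≤ N' := h1.ge.trans (sup_le (core_le _) (hAK.trans hKN'))
      refine top_le_iff.1 fun U s _ => mem_of_locally_res fun x hx => ?_
      obtain ⟨V, i, hV, m, hm⟩ := hf U s x hx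
      refine ⟨V, i, hV, ?_⟩
      rw [← hm]
      exact (hN'N V m).1 (hBN' V (incl_mem m))
  -- If the quotient were nilpotent, a power of `C` would map `B.core` into `K` and a further one
  -- into `A`, contradicting `hne`.
  have hnil : ¬ ∃ e, PowLE (⊤ : Q.Sub) ⊥ e := by
    rintro ⟨e₁, h₁⟩
    obtain ⟨e₂, h₂⟩ := hK.1.2.2
    refine hne ?_
    rw [← core_core hq hM hB, core_le_core_iff hq hM hBc]
    refine ⟨e₂ + e₁, PowLE.trans (fun U m hm => ?_) h₂⟩
    have h3 : (B.core.toPreCartier.c U)^[e₁] (lift hm) ∈ f.ker.carrier U := by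
      rw [Hom.mem_ker, Hom.ap_iterate_c]
      exact h₁ U _ trivial
    rwa [hfk, mem_inside, coe_iterate_c] at h3
  refine ⟨⟨hQ, fun N hN hN' => ?_, fun N hN hN' => ?_⟩, hQ, fun h => hnil ⟨0, h.ge⟩, hsimple⟩
  · refine (hsimple N hN).resolve_right ?_
    rintro rfl
    exact hnil (isNilpotent_iff_powLE.1 hN')
  · refine (hsimple N hN).resolve_left ?_
    rintro rfl
    exact hnil (isNilpotent_quot_iff.1 hN')

end Sub

end PreCartier

/-! ### Finiteness of the Frobenius on affine opens -/

theorem RingHom.Finite.exists_generators {A B : Type*} [CommRing A] [CommRing B] {φ : A →+* B}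
    (h : φ.Finite) : ∃ (n : ℕ) (g : Fin n → B), ∀ b, ∃ c : Fin n → A, b = ∑ i, φ (c i) * g i := by
  algebraize [φ]
  obtain ⟨n, g, hg⟩ := Module.Finite.exists_fin (R := A) (M := B)
  refine ⟨n, g, fun b => ?_⟩
  obtain ⟨c, hc⟩ := (Submodule.mem_span_range_iff_exists_fun A).1 (hg ▸ Submodule.mem_top (x := b))
  exact ⟨c, by simp_rw [← hc, Algebra.smul_def]; rfl⟩

theorem frobeniusFinite_of_isFinite {k : Type u} [Field k] [Fintype k] {X : Scheme.{u}}
    (s : X ⟶ Spec (.of k)) (hF : IsFinite (qFrobenius s)) {U : X.Opens} (hU : IsAffineOpen U) :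
    FrobeniusFinite (Fintype.card k) Γ(X, U) where
  two_le := Fintype.one_lt_card
  add_pow x y := (powCardHom (scalarsTo s U)).map_add x y
  exists_generators :=
    (show (powCardHom (scalarsTo s U)).Finite from hF.finite_app U hU).exists_generators

/-! ### Finite length, the lattice of full submodules and Jordan–Hölder -/

namespace PreCartier

variable {q : ℕ} {X : Scheme.{u}} {M : PreCartier q X}

namespace Sub

theorem sup_inf_le (hq : q ≠ 0) (hM : M.IsCartier) {A B D : M.Sub} (hA : A.IsCartier)
    (hB : B.IsCartier) (hD : D.IsCartier) (hAD : A ≤ D) : (A ⊔ B) ⊓ D ≤ A ⊔ B ⊓ D := by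
  refine le_of_affine hq ((hA.sup hM hB).inf hM hD) fun U hU m hm => ?_
  rw [mem_inf, mem_sup_iff hM hA hB hU] at hm
  obtain ⟨⟨a, ha, b, hb, rfl⟩, hm⟩ := hm.imp_left Submodule.mem_sup.1
  rw [mem_sup_iff hM hA (hB.inf hM hD) hU]
  refine Submodule.add_mem_sup ha (mem_inf.2 ⟨hb, ?_⟩)
  rw [← add_sub_cancel_left a b]
  exact sub_mem hm (hAD U ha)

section

variable [IsLocallyNoetherian X] [CompactSpace X]

/-- A coherent Cartier module on an `F`-finite Noetherian scheme has finite length up to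
nilpotence. -/
theorem exists_length (hq : q ≠ 0) (hF : ∀ U : X.Opens, IsAffineOpen U → FrobeniusFinite q Γ(X, U))
    (hM : M.IsCoherent) : ∃ d : M.Sub → ℕ, ∀ N₁ N₂ : M.Sub, N₂.IsCartier → N₁ ≤ N₂ →
      d N₁ ≤ d N₂ ∧ (d N₁ = d N₂ → ∃ e, PowLE N₂ N₁ e) := by
  obtain ⟨ι, _, W, hW, hc⟩ := exists_finite_affine_cover X
  cases nonempty_fintype ι
  have h (i : ι) : HasNilLength (R := Γ(X, W i)) (M.c (W i)) ⊥ ⊤ :=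
    have : IsNoetherianRing Γ(X, W i) := IsLocallyNoetherian.component_noetherian ⟨W i, hW i⟩
    have := hM.2 (W i) (hW i)
    hasNilLength (fun r m => M.c_smul r m) (hF _ (hW i))
  choose d hd using h
  have hd' {N₁ N₂ : M.Sub} (h : N₁ ≤ N₂) (i : ι) := hd i (N₁.carrier (W i)) (N₂.carrier (W i))
    (fun _ => c_mem) (fun _ => c_mem) bot_le (h (W i)) le_top
  -- Equality of the sums forces equality of each monotone summand, and the largest of the local
  -- exponents then works on the whole cover.
  refine ⟨fun N => ∑ i, d i (N.carrier (W i)), fun N₁ N₂ h₂ h => ⟨?_, fun heq => ?_⟩⟩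
  · exact Finset.sum_le_sum fun i _ => (hd' h i).1
  · have h1 (i : ι) : d i (N₁.carrier (W i)) = d i (N₂.carrier (W i)) :=
      (Finset.sum_eq_sum_iff_of_le fun i _ => (hd' h i).1).1 heq i (Finset.mem_univ i)
    choose E hE using fun i => (hd' h i).2 (h1 i)
    refine ⟨Finset.univ.sup E, .of_cover hq h₂ hW hc fun i m hm => ?_⟩
    obtain ⟨k, hk⟩ := Nat.exists_eq_add_of_le' (Finset.le_sup (f := E) (Finset.mem_univ i))
    rw [hk, Function.iterate_add_apply]
    exact iterate_c_mem k (hE i m hm)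

end

end Sub

/-- The full Cartier submodules of a coherent Cartier module. -/
def FullSub (M : PreCartier q X) (_ : 2 ≤ q) (_ : M.IsCoherent) : Type u :=
  {N : M.Sub // N.IsCartier ∧ N.IsFull}

namespace FullSub

variable {hq : 2 ≤ q} {hM : M.IsCoherent}

instance : PartialOrder (M.FullSub hq hM) := inferInstanceAs (PartialOrder {_N : M.Sub // _})

theorem le_iff {N₁ N₂ : M.FullSub hq hM} : N₁ ≤ N₂ ↔ N₁.1 ≤ N₂.1 := Iff.rfl

variable [IsLocallyNoetherian X] [CompactSpace X]

/-- The stable image of a Cartier submodule. -/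
def ofCartier (hq : 2 ≤ q) (hM : M.IsCoherent) (N : M.Sub) (hN : N.IsCartier) : M.FullSub hq hM :=
  ⟨N.core, hN.core hq hM, Sub.isFull_core hq hM hN⟩

/-- Sums of full submodules are full; for the meet the intersection is replaced by its core, which
contains every full Cartier submodule of the intersection. -/
instance : Lattice (M.FullSub hq hM) where
  sup N₁ N₂ := ⟨N₁.1 ⊔ N₂.1, N₁.2.1.sup hM.1 N₂.2.1, N₁.2.2.sup N₂.2.2⟩
  le_sup_left N₁ N₂ := le_iff.2 le_sup_left
  le_sup_right N₁ N₂ := le_iff.2 le_sup_right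
  sup_le N₁ N₂ N₃ h₁ h₂ := le_iff.2 (sup_le h₁ h₂)
  inf N₁ N₂ := ofCartier hq hM (N₁.1 ⊓ N₂.1) (N₁.2.1.inf hM.1 N₂.2.1)
  inf_le_left N₁ N₂ := le_iff.2 ((Sub.core_le _).trans inf_le_left)
  inf_le_right N₁ N₂ := le_iff.2 ((Sub.core_le _).trans inf_le_right)
  le_inf N₁ N₂ N₃ h₁ h₂ := le_iff.2 (N₁.2.2.le_core (by omega) hM.1 N₁.2.1 (le_inf h₁ h₂))

theorem sup_val (N₁ N₂ : M.FullSub hq hM) : (N₁ ⊔ N₂).1 = N₁.1 ⊔ N₂.1 := rfl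

theorem inf_val (N₁ N₂ : M.FullSub hq hM) : (N₁ ⊓ N₂).1 = (N₁.1 ⊓ N₂.1).core := rfl

/-- Apply `core` to the modular law for Cartier submodules; it is monotone, commutes with sums and
fixes `N₁`. -/
instance : IsModularLattice (M.FullSub hq hM) where
  sup_inf_le_assoc_of_le {N₁} N₂ {N₃} h := by
    have h1 := N₂.2.1.inf hM.1 N₃.2.1
    refine le_iff.2 ?_
    rw [inf_val, sup_val, sup_val, inf_val]
    refine (Sub.core_mono (Sub.sup_inf_le (by omega) hM.1 N₁.2.1 N₂.2.1 N₃.2.1 h)).trans ?_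
    rw [Sub.core_sup hq hM N₁.2.1 h1, N₁.2.2.core_eq (by omega) hM.1 N₁.2.1]

/-- The relation of having isomorphic minimal subquotients. -/
def MinIso (p p' : M.FullSub hq hM × M.FullSub hq hM) : Prop :=
  Nonempty ((p.2.1.subquot p.1.1).min ≅ (p'.2.1.subquot p'.1.1).min)

/-- The lattice relation is generated by the perspectivities of `x ⊔ y` over `x` with `y` over `x ⊓
y`, which are handled by the second isomorphism theorem up to nilpotence. -/
theorem minIso_of_iso {p p' : M.FullSub hq hM × M.FullSub hq hM}
    (h : JordanHolderLattice.Iso p p') : MinIso p p' := by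
  refine JordanHolderLattice.Iso.rel MinIso ⟨Iso.refl _⟩ (fun ⟨i⟩ => ⟨i.symm⟩)
    (fun ⟨i⟩ ⟨j⟩ => ⟨i ≪≫ j⟩) (fun {x y} _ => ?_) h
  exact Sub.nonempty_iso_min_sup hq hM x.2.1 y.2.1 y.2.2

end FullSub

namespace NilDecompositionSeries

theorem not_powLE (S : M.NilDecompositionSeries) (i : Fin S.length) :
    ¬ ∃ e, Sub.PowLE (S.term i.castSucc) (S.term i.succ) e := fun h =>
  S.not_isNilpotent i (Sub.isNilpotent_subquot_iff.2 h)

theorem refines_refl (S : M.NilDecompositionSeries) : S.Refines S := ⟨id, strictMono_id, fun _ => rfl⟩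

theorem Refines.trans {S₁ S₂ S₃ : M.NilDecompositionSeries} (h : S₁.Refines S₂)
    (h' : S₂.Refines S₃) : S₁.Refines S₃ := by
  obtain ⟨f, hf, hf'⟩ := h
  obtain ⟨g, hg, hg'⟩ := h'
  exact ⟨f ∘ g, hf.comp hg, fun i => by rw [Function.comp_apply, hf', hg']⟩

/-- Insertion of a submodule between two consecutive terms. -/
theorem exists_refines_insert (S : M.NilDecompositionSeries) (i : Fin S.length) (N : M.Sub)
    (hN : N.IsCartier) (h₁ : N ≤ S.term i.castSucc) (h₂ : S.term i.succ ≤ N)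
    (h₁' : ¬ ∃ e, Sub.PowLE (S.term i.castSucc) N e)
    (h₂' : ¬ ∃ e, Sub.PowLE N (S.term i.succ) e) :
    ∃ S' : M.NilDecompositionSeries, S'.Refines S ∧ S'.length = S.length + 1 := by
  let p : RelSeries {(a, b) : M.Sub × M.Sub | b ≤ a ∧ ¬ ∃ e, Sub.PowLE a b e} :=
    { length := S.length
      toFun := S.term
      step := fun i => ⟨S.succ_le i, S.not_powLE i⟩ }
  let p' := p.insertNth i N ⟨h₁, h₁'⟩ ⟨h₂, h₂'⟩
  -- The new term has index `i + 1`, and `j.succAbove` embeds the old indices around it.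
  let j : Fin (S.length + 2) := i.succ.castSucc
  have hp' (l : Fin (S.length + 1)) : p' (j.succAbove l) = S.term l :=
    Fin.insertNth_apply_succAbove (α := fun _ => M.Sub) j N S.term l
  have hpj : p' j = N := Fin.insertNth_apply_same (α := fun _ => M.Sub) j N S.term
  let S' : M.NilDecompositionSeries :=
    { length := S.length + 1
      term := p'
      isCartier := by
        intro l
        obtain rfl | ⟨l, rfl⟩ := Fin.eq_self_or_eq_succAbove j l
        · rwa [hpj]
        · rw [hp']
          exact S.isCartier l
      term_zero := by
        rw [← S.term_zero, ← hp' 0]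
        congr 1
      term_last := by
        rw [← S.term_last, ← hp' (Fin.last _)]
        congr 1
        exact (Fin.succAbove_ne_last_last (Fin.castSucc_ne_last _)).symm
      succ_le := fun l => (p'.step l).1
      not_isNilpotent := fun l h => (p'.step l).2 (Sub.isNilpotent_subquot_iff.1 h) }
  exact ⟨S', ⟨j.succAbove, Fin.strictMono_succAbove j, hp'⟩, rfl⟩

variable [IsLocallyNoetherian X] [CompactSpace X]

/-- A non-nilpotent step strictly lowers the length function `d`, so `d ⊤` bounds the length of
every series and repeated refinement stops. -/
theorem exists_isMaximal_refines (hq : q ≠ 0)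
    (hF : ∀ U : X.Opens, IsAffineOpen U → FrobeniusFinite q Γ(X, U)) (hM : M.IsCoherent)
    (S : M.NilDecompositionSeries) : ∃ S' : M.NilDecompositionSeries,
      S'.IsMaximal ∧ S'.Refines S := by
  obtain ⟨d, hd⟩ := Sub.exists_length hq hF hM
  have hlen (S : M.NilDecompositionSeries) : S.length ≤ d ⊤ := by
    have h (i : Fin (S.length + 1)) : d (S.term i) + i ≤ d ⊤ := by
      induction i using Fin.induction with
      | zero => simp [S.term_zero]
      | succ i ih =>
        obtain ⟨h1, h2⟩ := hd _ _ (S.isCartier i.castSucc) (S.succ_le i)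
        have h3 := lt_of_le_of_ne h1 fun h => S.not_powLE i (h2 h)
        simp only [Fin.val_castSucc, Fin.val_succ] at ih ⊢
        omega
    have := h (Fin.last _)
    rw [Fin.val_last] at this
    omega
  induction hn : d ⊤ - S.length using Nat.strong_induction_on generalizing S with
  | _ n ih =>
    by_cases h : S.IsMaximal
    · exact ⟨S, h, S.refines_refl⟩
    · unfold IsMaximal at h
      push Not at h
      obtain ⟨S₁, h₁, hlt⟩ := h
      obtain ⟨S₂, h₂, h₂'⟩ := ih _ (by have := hlen S₁; omega) S₁ rfl
      exact ⟨S₂, h₂, h₂'.trans h₁⟩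

variable {S : M.NilDecompositionSeries}

/-- The submodule `M_{i+1} + P` has core `P`. If `P` were strictly between the two cores, inserting
this sum would give two non-nilpotent steps and hence a longer refinement. -/
theorem IsMaximal.eq_or_eq (hq : 2 ≤ q) (hM : M.IsCoherent) (hS : S.IsMaximal) (i : Fin S.length)
    (P : M.Sub) (hP : P.IsCartier) (hPf : P.IsFull) (h₁ : (S.term i.succ).core ≤ P)
    (h₂ : P ≤ (S.term i.castSucc).core) :
    P = (S.term i.succ).core ∨ P = (S.term i.castSucc).core := by
  by_contra! hne
  have hB := S.isCartier i.castSucc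
  have hA := S.isCartier i.succ
  have hN := hA.sup hM.1 hP
  have hNc : (S.term i.succ ⊔ P).core = P := by
    rw [Sub.core_sup hq hM hA hP, hPf.core_eq (by omega) hM.1 hP, sup_eq_right.2 h₁]
  obtain ⟨S', hS', hlen⟩ := S.exists_refines_insert i (S.term i.succ ⊔ P) hN
    (sup_le (S.succ_le i) (h₂.trans (Sub.core_le _))) le_sup_left (by
      rw [← Sub.core_le_core_iff hq hM hB, hNc]
      exact fun h => hne.2 (le_antisymm h₂ h)) (by
      rw [← Sub.core_le_core_iff hq hM hN, hNc]
      exact fun h => hne.1 (le_antisymm h h₁))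
  exact hS S' hS' (by omega)

theorem IsMaximal.isMinimal_and_isSimple (hq : 2 ≤ q) (hM : M.IsCoherent) (hS : S.IsMaximal)
    (i : Fin S.length) : (S.factor i).min.IsMinimal ∧ (S.factor i).min.IsSimple :=
  Sub.isMinimal_and_isSimple_min hq hM (S.isCartier _) (S.isCartier _) (S.succ_le i)
    (by
      rw [Sub.core_le_core_iff hq hM (S.isCartier _)]
      exact S.not_powLE i) (hS.eq_or_eq hq hM i)

/-- The composition series of stable images, in increasing order. -/
def IsMaximal.compositionSeries (hq : 2 ≤ q) (hM : M.IsCoherent) (hS : S.IsMaximal) :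
    CompositionSeries (M.FullSub hq hM) where
  length := S.length
  toFun i := FullSub.ofCartier hq hM (S.term i.rev) (S.isCartier _)
  step i := by
    change _ ⋖ _
    -- Nil-decomposition series descend while composition series ascend, hence the reversed indices.
    rw [Fin.rev_castSucc, Fin.rev_succ]
    refine ⟨lt_of_le_not_ge (Sub.core_mono (S.succ_le _)) fun h => ?_, fun P h₁ h₂ => ?_⟩
    · exact S.not_powLE i.rev ((Sub.core_le_core_iff hq hM (S.isCartier _)).1 h)
    · obtain h | h := hS.eq_or_eq hq hM i.rev P.1 P.2.1 P.2.2 h₁.le h₂.le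
      · exact h₁.ne' (Subtype.ext h)
      · exact h₂.ne (Subtype.ext h)

/-- Both composition series run from the core of `0` to the core of `M`, so Jordan–Hölder matches
their factors; `nonempty_iso_min_core` returns from cores to the original subquotients. -/
theorem IsMaximal.exists_equiv (hq : 2 ≤ q) (hM : M.IsCoherent) (hS : S.IsMaximal)
    {T : M.NilDecompositionSeries} (hT : T.IsMaximal) :
    ∃ σ : Fin S.length ≃ Fin T.length, ∀ i : Fin S.length,
      Nonempty ((S.factor i).min ≅ (T.factor (σ i)).min) := by
  obtain ⟨f, hf⟩ := CompositionSeries.jordan_holder (hS.compositionSeries hq hM)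
    (hT.compositionSeries hq hM) (by
      refine Subtype.ext ?_
      change (S.term (Fin.rev 0)).core = (T.term (Fin.rev 0)).core
      rw [Fin.rev_zero, Fin.rev_zero, S.term_last, T.term_last]) (by
      refine Subtype.ext ?_
      change (S.term (Fin.rev (Fin.last _))).core = (T.term (Fin.rev (Fin.last _))).core
      rw [Fin.rev_last, Fin.rev_last, S.term_zero, T.term_zero])
  refine ⟨Fin.revPerm.trans (Equiv.trans f Fin.revPerm), fun i => ?_⟩
  obtain ⟨j⟩ := FullSub.minIso_of_iso (hf i.rev)
  have key {S : M.NilDecompositionSeries} (hS : S.IsMaximal) (i : Fin S.length) :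
      Nonempty ((S.factor i.rev).min ≅
        ((hS.compositionSeries hq hM i.succ).1.subquot
          (hS.compositionSeries hq hM i.castSucc).1).min) := by
    change Nonempty (_ ≅ ((S.term i.succ.rev).core.subquot (S.term i.castSucc.rev).core).min)
    rw [Fin.rev_castSucc, Fin.rev_succ]
    exact Sub.nonempty_iso_min_core hq hM (S.isCartier _) (S.isCartier _)
  obtain ⟨j₁⟩ := key hS i.rev
  obtain ⟨j₂⟩ := key hT (f i.rev)
  rw [Fin.rev_rev] at j₁
  exact ⟨j₁ ≪≫ j ≪≫ j₂.symm⟩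

end NilDecompositionSeries

end PreCartier

end

/-! ### The theorem -/

theorem theorem4p24 {k : Type u} [Field k] [Fintype k] (X : Scheme.{u}) (s : X ⟶ Spec (.of k))
    [IsSeparated s] [IsNoetherian X] (hF : IsFinite (qFrobenius s))
    (M : PreCartier (Fintype.card k) X) (hM : M.IsCoherent) :
    -- every nil-decomposition series refines to a maximal one
    (∀ S : M.NilDecompositionSeries, ∃ S' : M.NilDecompositionSeries,
      S'.IsMaximal ∧ S'.Refines S) ∧
    -- all maximal series have the same length, the quasi-length
    (∀ S T : M.NilDecompositionSeries, S.IsMaximal → T.IsMaximal → S.length = T.length) ∧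
    (∀ S : M.NilDecompositionSeries, S.IsMaximal → S.length = M.quasiLength) ∧
    -- the subquotients `(M_i / M_{i+1})_min` of a maximal series are minimal and simple
    (∀ S : M.NilDecompositionSeries, S.IsMaximal → ∀ i : Fin S.length,
      (S.factor i).min.IsMinimal ∧ (S.factor i).min.IsSimple) ∧
    -- and they are unique up to order and isomorphism
    (∀ S T : M.NilDecompositionSeries, S.IsMaximal → T.IsMaximal →
      ∃ σ : Fin S.length ≃ Fin T.length, ∀ i : Fin S.length,
        Nonempty ((S.factor i).min ≅ (T.factor (σ i)).min)) := by
  have hq : 2 ≤ Fintype.card k := Fintype.one_lt_card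
  have hlen (S T : M.NilDecompositionSeries) (hS : S.IsMaximal) (hT : T.IsMaximal) :
      S.length = T.length := by
    obtain ⟨σ, _⟩ := hS.exists_equiv hq hM hT
    simpa using Fintype.card_congr σ
  refine ⟨fun S => S.exists_isMaximal_refines (by omega)
      (fun U hU => frobeniusFinite_of_isFinite s hF hU) hM,
    hlen, fun S hS => ?_, fun S hS i => hS.isMinimal_and_isSimple hq hM i,
    fun S T hS hT => hS.exists_equiv hq hM hT⟩
  -- All maximal series have the same length, so the infimum defining the quasi-length is taken over
  -- one number.
  have : {n | ∃ T : M.NilDecompositionSeries, T.IsMaximal ∧ T.length = n} = {S.length} := by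
    ext n
    refine ⟨?_, ?_⟩
    · rintro ⟨T, hT, rfl⟩
      exact hlen T S hT hS
    · rintro rfl
      exact ⟨S, hS, rfl⟩
  rw [PreCartier.quasiLength, this, csInf_singleton]
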